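/- A \emph{band} is a commutative monoid $B$ with absorbing element $0$, together with an ideal $N_B$ (the null set) of the semiring $B^+=\mathbb N[B]/\langle 0_B\sim 0\rangle$ such that for every $a\in B$ there is a unique $b\in B$ with $a+b\in N_B$. A band morphism $f:B\to C$ is a multiplicative map preserving $0$ and $1$ with $\sum f(a_i)\in N_C$ whenever $\sum a_i\in N_B$. For a multiplicative subset $S\subset B$, the localization $S^{-1}B$ is the usual localization of the underlying monoid, with null set generated by the sums $\sum\frac{a_i}{1}$ with $\sum a_i\in N_B$. A prime $m$-ideal of $B$ is a subset $\mathfrak p\ni 0$ with $B\mathfrak p\subset\mathfrak p$ whose complement contains $1$ and is closed under multiplication. The spectrum $\operatorname{Spec}B$ is the set of prime $m$-ideals with the topology generated by the sets $U_h=\{\mathfrak p\mid h\notin\mathfrak p\}$ and with the sheaf of bands characterized by $\mathcal O(U_h)=B[h^{-1}]$. A band scheme is a topological space with a sheaf of bands in which every point has an open neighbourhood isomorphic to some $\operatorname{Spec}B$; morphisms are continuous maps together with a sheaf morphism whose stalk maps send non-units to non-units. An \emph{affine presentation} of a band scheme $X$ is an identification $X=\operatorname{colim}\mathcal U$ in the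 category of band schemes, where $\mathcal U$ is a small diagram of affine band schemes and open immersions such that every canonical map $U\to X$, $U\in\mathcal U$, is an open immersion. \textbf{Proposition.} Let $(-)^+_{\mathbb Z}:\mathrm{Bands}\to\mathrm{Rings}$ be the functor $B\mapsto B^+_{\mathbb Z}=\mathbb Z[B]/\langle N_B\rangle$. (1) The functor $(-)^+_{\mathbb Z}$ preserves tensor products, i.e. pushouts, and finite localizations: for every band $B$ and $h\in B$, the map $B^+_{\mathbb Z}\to (B[h^{-1}])^+_{\mathbb Z}$ is the localization of the ring $B^+_{\mathbb Z}$ at the class $[h]$. (2) The functor $(-)^+_{\mathbb Z}$ extends uniquely to a functor $(-)^+_{\mathbb Z}:\mathrm{BSch}\to\mathrm{Sch}$ from band schemes to schemes such that $X^+_{\mathbb Z}=\operatorname{colim}\,\mathcal U^+_{\mathbb Z}$ for every affine presentation $X=\operatorname{colim}\,\mathcal U$ of a band scheme $X$. That is: there are a functor $F:\mathrm{BSch}\to\mathrm{Sch}$ and a natural isomorphism $\varphi:F(\operatorname{Spec}B)\simeq\operatorname{Spec}(B^+_{\mathbb Z})$ such that for every affine presentation $X=\operatorname{colim}\,\mathcal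 U$ the induced cocone exhibits $F(X)$ as the colimit of $F(\mathcal U)$ in the category of schemes; and for any two such pairs $(F,\varphi)$, $(F',\varphi')$ there is a unique natural isomorphism $F\simeq F'$ that is compatible with $\varphi$ and $\varphi'$. -/

import Mathlib

open CategoryTheory CategoryTheory.Limits TopologicalSpace Opposite

universe u

noncomputable section

/-! ### The ambient semiring of a pointed monoid

A pointed monoid is a `CommMonoidWithZero`. -/

/-- The congruence on the free semiring `ℕ[B]` that identifies the element `0` of `B` with the
additive identity: two formal sums are related iff they agree up to adding copies of `0 ∈ B`. -/
def ambientCon (B : Type u) [CommMonoidWithZero B] : RingCon (MonoidAlgebra ℕ B) where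
  r x y := ∃ m n : ℕ, x + m • MonoidAlgebra.single (0 : B) 1 = y + n • MonoidAlgebra.single 0 1
  iseqv :=
    { refl := fun _ ↦ ⟨0, 0, rfl⟩
      symm := fun ⟨m, n, h⟩ ↦ ⟨n, m, h.symm⟩
      trans := by
        rintro x y z ⟨m, n, h⟩ ⟨k, l, h'⟩
        refine ⟨m + k, l + n, ?_⟩
        rw [add_nsmul, ← add_assoc, h, add_right_comm, h', add_right_comm, add_nsmul, ← add_assoc,
          add_right_comm] }
  mul' := by
    have key : ∀ z : MonoidAlgebra ℕ B, ∃ e : ℕ,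
        z * MonoidAlgebra.single (0 : B) 1 = e • MonoidAlgebra.single (0 : B) 1 := by
      intro z
      induction z using MonoidAlgebra.induction_linear with
      | zero => exact ⟨0, by simp⟩
      | add f g hf hg =>
        obtain ⟨a, ha⟩ := hf
        obtain ⟨b, hb⟩ := hg
        exact ⟨a + b, by rw [add_mul, ha, hb, add_nsmul]⟩
      | single a r => exact ⟨r, by simp [MonoidAlgebra.single_mul_single]⟩
    rintro w x y z ⟨m, n, h⟩ ⟨k, l, h'⟩
    obtain ⟨a, ha⟩ := key w
    obtain ⟨b, hb⟩ := key y
    obtain ⟨c, hc⟩ := key x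
    obtain ⟨d, hd⟩ := key z
    have hZ : MonoidAlgebra.single (0 : B) 1 * MonoidAlgebra.single (0 : B) 1 =
        (MonoidAlgebra.single (0 : B) 1 : MonoidAlgebra ℕ B) := by
      simp [MonoidAlgebra.single_mul_single]
    have expand : ∀ (u v : MonoidAlgebra ℕ B) (p q r s : ℕ),
        u * MonoidAlgebra.single (0 : B) 1 = r • MonoidAlgebra.single (0 : B) 1 →
        v * MonoidAlgebra.single (0 : B) 1 = s • MonoidAlgebra.single (0 : B) 1 →
        (u + p • MonoidAlgebra.single (0 : B) 1) * (v + q • MonoidAlgebra.single (0 : B) 1) =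
          u * v + (q * r + p * s + p * q) • MonoidAlgebra.single (0 : B) 1 := by
      intro u v p q r s hu hv
      simp only [nsmul_eq_mul] at hu hv ⊢
      push_cast
      linear_combination (q : MonoidAlgebra ℕ B) * hu + (p : MonoidAlgebra ℕ B) * hv +
        (p : MonoidAlgebra ℕ B) * q * hZ
    refine ⟨k * a + m * b + m * k, l * c + n * d + n * l, ?_⟩
    rw [← expand w y m k a b ha hb, ← expand x z n l c d hc hd, h, h']
  add' := by
    rintro w x y z ⟨m, n, h⟩ ⟨k, l, h'⟩
    refine ⟨m + k, n + l, ?_⟩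
    rw [add_nsmul, add_nsmul, add_add_add_comm, h, h', add_add_add_comm]

/-- The ambient semiring `B⁺` of a pointed monoid `B`: the free semiring `ℕ[B]` modulo the
identification of `0 ∈ B` with the additive identity. -/
def AmbientSemiring (B : Type u) [CommMonoidWithZero B] : Type u :=
  (ambientCon B).Quotient

namespace AmbientSemiring

variable {B C D : Type*} [CommMonoidWithZero B] [CommMonoidWithZero C] [CommMonoidWithZero D]
  {R : Type*} [CommSemiring R]

instance : CommSemiring (AmbientSemiring B) :=
  inferInstanceAs (CommSemiring (ambientCon B).Quotient)

/-- The class of a formal sum of elements of `B` in `B⁺`. -/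
def mk : MonoidAlgebra ℕ B →+* AmbientSemiring B := (ambientCon B).mk'

/-- The embedding of `B` into `B⁺`. -/
def of : B →*₀ AmbientSemiring B where
  toFun b := mk (MonoidAlgebra.single b 1)
  map_zero' := by
    refine (RingCon.eq (ambientCon B)).2 ⟨0, 1, ?_⟩
    simp
  map_one' := by rw [← MonoidAlgebra.one_def, map_one]
  map_mul' a b := by rw [← map_mul, MonoidAlgebra.single_mul_single, one_mul]

/-- The universal property of `B⁺`. -/
def lift (f : B →*₀ R) : AmbientSemiring B →+* R :=
  (ambientCon B).lift (MonoidAlgebra.lift ℕ R B (f : B →* R)).toRingHom (by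
    rintro x y ⟨m, n, h⟩
    have := congrArg (MonoidAlgebra.lift ℕ R B (f : B →* R)) h
    simpa [MonoidAlgebra.lift_single] using this)

@[simp]
theorem lift_of (f : B →*₀ R) (b : B) : lift f (of b) = f b :=
  (MonoidAlgebra.lift_single (R := ℕ) _ b 1).trans (by simp)

theorem hom_ext {f g : AmbientSemiring B →+* R} (h : ∀ b, f (of b) = g (of b)) : f = g := by
  refine RingCon.Quotient.hom_ext (MonoidAlgebra.ringHom_ext (fun r ↦ ?_) h)
  have hr : (MonoidAlgebra.single (1 : B) r) = (r : MonoidAlgebra ℕ B) := by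
    rw [MonoidAlgebra.natCast_def]; simp
  rw [hr, map_natCast, map_natCast]

/-- The semiring homomorphism `∑ aᵢ ↦ ∑ f(aᵢ)` induced by a morphism of pointed monoids. -/
def map (f : B →*₀ C) : AmbientSemiring B →+* AmbientSemiring C := lift (of.comp f)

@[simp]
theorem map_of (f : B →*₀ C) (b : B) : map f (of b) = of (f b) := lift_of _ b

theorem map_id : map (MonoidWithZeroHom.id B) = RingHom.id _ := hom_ext fun b ↦ by simp

theorem map_comp (g : C →*₀ D) (f : B →*₀ C) : map (g.comp f) = (map g).comp (map f) :=
  hom_ext fun b ↦ by simp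

theorem map_map (g : C →*₀ D) (f : B →*₀ C) (x : AmbientSemiring B) :
    map g (map f x) = map (g.comp f) x := by rw [map_comp]; rfl

theorem lift_comp_map (g : C →*₀ R) (f : B →*₀ C) : (lift g).comp (map f) = lift (g.comp f) :=
  hom_ext fun b ↦ by simp

end AmbientSemiring

/-! ### Bands -/

/-- A band: a pointed monoid with an ideal of `B⁺` (the null set) such that every `a` has a unique
additive inverse. -/
class Band (B : Type u) extends CommMonoidWithZero B where
  nullSet : Ideal (AmbientSemiring B)
  existsUnique_neg : ∀ a : B,
    ∃! b : B, AmbientSemiring.of a + AmbientSemiring.of b ∈ nullSet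

namespace Band

open AmbientSemiring

/-- The additive inverse `-a` in a band. -/
def neg {B : Type*} [Band B] (a : B) : B := (existsUnique_neg a).choose

theorem add_neg_mem {B : Type*} [Band B] (a : B) : of a + of (neg a) ∈ nullSet (B := B) :=
  (existsUnique_neg a).choose_spec.1

theorem eq_neg {B : Type*} [Band B] {a b : B} (h : of a + of b ∈ nullSet (B := B)) : b = neg a :=
  (existsUnique_neg a).unique h (add_neg_mem a)

theorem mul_neg {B : Type*} [Band B] (a b : B) : a * neg b = neg (a * b) := by
  refine eq_neg ?_
  rw [map_mul, map_mul, ← mul_add]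
  exact Ideal.mul_mem_left _ _ (add_neg_mem b)

end Band

/-- A band morphism: a morphism of pointed monoids with `∑ f(aᵢ) ∈ N_C` whenever `∑ aᵢ ∈ N_B`. -/
structure BandHom (B C : Type*) [Band B] [Band C] extends B →*₀ C where
  map_nullSet : ∀ x ∈ Band.nullSet (B := B),
    AmbientSemiring.map toMonoidWithZeroHom x ∈ Band.nullSet (B := C)

namespace BandHom

variable {B C D : Type*} [Band B] [Band C] [Band D]

instance : FunLike (BandHom B C) B C where
  coe f := f.toFun
  coe_injective f g h := by
    obtain ⟨f, _⟩ := f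
    obtain ⟨g, _⟩ := g
    congr
    exact DFunLike.coe_injective h

instance : MonoidWithZeroHomClass (BandHom B C) B C where
  map_mul f := f.map_mul'
  map_one f := f.map_one'
  map_zero f := f.map_zero'

@[ext]
theorem ext {f g : BandHom B C} (h : ∀ b, f b = g b) : f = g := DFunLike.ext _ _ h

@[simp]
theorem toMonoidWithZeroHom_apply (f : BandHom B C) (b : B) : f.toMonoidWithZeroHom b = f b := rfl

/-- The identity morphism. -/
def id (B : Type*) [Band B] : BandHom B B where
  toMonoidWithZeroHom := MonoidWithZeroHom.id B
  map_nullSet x hx := by rwa [AmbientSemiring.map_id]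

/-- The composition of band morphisms. -/
def comp (g : BandHom C D) (f : BandHom B C) : BandHom B D where
  toMonoidWithZeroHom := g.toMonoidWithZeroHom.comp f.toMonoidWithZeroHom
  map_nullSet x hx := by
    rw [← AmbientSemiring.map_map]
    exact g.map_nullSet _ (f.map_nullSet _ hx)

theorem map_neg (f : BandHom B C) (b : B) : f (Band.neg b) = Band.neg (f b) := by
  refine Band.eq_neg ?_
  have := f.map_nullSet _ (Band.add_neg_mem b)
  rwa [map_add, AmbientSemiring.map_of, AmbientSemiring.map_of] at this

end BandHom

/-- A bundled band, i.e. an object of the category of bands. -/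
structure BandCat : Type (u + 1) where
  of ::
  carrier : Type u
  [band : Band carrier]

namespace BandCat

instance : CoeSort BandCat.{u} (Type u) := ⟨BandCat.carrier⟩

attribute [instance] BandCat.band

/-- The category of bands and band morphisms. -/
instance : Category BandCat.{u} where
  Hom B C := BandHom B C
  id B := BandHom.id B
  comp f g := g.comp f

instance : ConcreteCategory BandCat.{u} (fun B C ↦ BandHom B C) where
  hom f := f
  ofHom f := f

@[ext]
theorem hom_ext {B C : BandCat.{u}} {f g : B ⟶ C} (h : ∀ b : B, f b = g b) : f = g :=
  BandHom.ext h

end BandCat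

/-! ### Bands from jointly injective families of maps into bands -/

/-- The initial band structure on a pointed monoid with respect to a jointly injective family of
maps into bands: a sum is null iff all of its images are null. -/
@[reducible]
def Band.initial {M : Type u} [CommMonoidWithZero M] {ι : Sort*} {C : ι → Type*} [∀ i, Band (C i)]
    (f : ∀ i, M →*₀ C i) (hf : ∀ x y, (∀ i, f i x = f i y) → x = y)
    (e : M) (he : ∀ i, f i e = Band.neg 1) : Band M where
  nullSet := ⨅ i, Ideal.comap (AmbientSemiring.map (f i)) Band.nullSet
  existsUnique_neg a := by
    have key : ∀ b : M, AmbientSemiring.of a + AmbientSemiring.of b ∈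
        (⨅ i, Ideal.comap (AmbientSemiring.map (f i)) Band.nullSet : Ideal (AmbientSemiring M)) ↔
        ∀ i, AmbientSemiring.of (f i a) + AmbientSemiring.of (f i b) ∈
          Band.nullSet (B := C i) := by
      intro b
      simp [Submodule.mem_iInf]
    refine ⟨a * e, (key _).2 fun i ↦ ?_, fun b hb ↦ hf _ _ fun i ↦ ?_⟩
    · rw [map_mul, he, Band.mul_neg, mul_one]
      exact Band.add_neg_mem _
    · rw [map_mul, he, Band.mul_neg, mul_one]
      exact Band.eq_neg ((key _).1 hb i)

/-! ### Colimits of bands -/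

namespace BandCat

variable {J : Type u} [SmallCategory J] (F : J ⥤ BandCat.{u})

/-- Generators of the colimit: the elements of all `F j`, together with `0` and `-1`. -/
abbrev ColimitGen : Type u := (Σ j, F.obj j) ⊕ Bool

/-- The value of a word in the generators under a cocone. -/
def colimitEval (s : Cocone F) : Multiplicative (Multiset (ColimitGen F)) →* s.pt where
  toFun w := (w.toAdd.map (Sum.elim (fun x ↦ s.ι.app x.1 x.2)
    (fun b ↦ cond b (Band.neg 1) 0))).prod
  map_one' := by simp
  map_mul' x y := by simp

/-- Two words are identified iff all cocones identify them. -/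
def colimitCon : Con (Multiplicative (Multiset (ColimitGen F))) :=
  ⨅ s : Cocone F, Con.ker (colimitEval F s)

theorem colimitCon_iff (x y) :
    colimitCon F x y ↔ ∀ s : Cocone F, colimitEval F s x = colimitEval F s y := by
  rw [colimitCon, Con.coe_iInf]
  simp only [iInf_apply, iInf_Prop_eq]
  rfl

/-- The underlying monoid of the colimit. -/
def ColimitType : Type u := (colimitCon F).Quotient

instance : CommMonoid (ColimitType F) := inferInstanceAs (CommMonoid (colimitCon F).Quotient)

/-- The class of a word. -/
def colimitMk : Multiplicative (Multiset (ColimitGen F)) →* ColimitType F := (colimitCon F).mk'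

theorem colimitMk_surjective : Function.Surjective (colimitMk F) := Con.mk'_surjective

theorem colimitMk_eq_iff {x y} :
    colimitMk F x = colimitMk F y ↔ ∀ s, colimitEval F s x = colimitEval F s y :=
  ((colimitCon F).eq).trans (colimitCon_iff F x y)

/-- The class of a generator. -/
def colimitGen (g : ColimitGen F) : ColimitType F := colimitMk F (Multiplicative.ofAdd {g})

/-- The descent of a cocone, as a monoid homomorphism. -/
def colimitDesc₀ (s : Cocone F) : ColimitType F →* s.pt :=
  (colimitCon F).lift (colimitEval F s) (fun _ _ h ↦ (colimitCon_iff F _ _).1 h s)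

@[simp]
theorem colimitDesc₀_mk (s : Cocone F) (w) : colimitDesc₀ F s (colimitMk F w) = colimitEval F s w :=
  rfl

@[simp]
theorem colimitDesc₀_gen_inl (s : Cocone F) (j : J) (b : F.obj j) :
    colimitDesc₀ F s (colimitGen F (Sum.inl ⟨j, b⟩)) = s.ι.app j b := by
  simp [colimitGen, colimitEval]

@[simp]
theorem colimitDesc₀_gen_true (s : Cocone F) :
    colimitDesc₀ F s (colimitGen F (Sum.inr true)) = Band.neg 1 := by
  simp [colimitGen, colimitEval]

@[simp]
theorem colimitDesc₀_gen_false (s : Cocone F) :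
    colimitDesc₀ F s (colimitGen F (Sum.inr false)) = 0 := by
  simp [colimitGen, colimitEval]

theorem colimitType_ext {x y : ColimitType F}
    (h : ∀ s, colimitDesc₀ F s x = colimitDesc₀ F s y) : x = y := by
  obtain ⟨x, rfl⟩ := colimitMk_surjective F x
  obtain ⟨y, rfl⟩ := colimitMk_surjective F y
  exact (colimitMk_eq_iff F).2 h

instance : CommMonoidWithZero (ColimitType F) where
  zero := colimitGen F (Sum.inr false)
  zero_mul x := colimitType_ext F fun s ↦ by
    rw [map_mul]
    change colimitDesc₀ F s (colimitGen F (Sum.inr false)) * _ =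
      colimitDesc₀ F s (colimitGen F (Sum.inr false))
    simp
  mul_zero x := colimitType_ext F fun s ↦ by
    rw [map_mul]
    change _ * colimitDesc₀ F s (colimitGen F (Sum.inr false)) =
      colimitDesc₀ F s (colimitGen F (Sum.inr false))
    simp

/-- The descent of a cocone, as a morphism of pointed monoids. -/
def colimitDesc₁ (s : Cocone F) : ColimitType F →*₀ s.pt where
  toFun := colimitDesc₀ F s
  map_zero' := colimitDesc₀_gen_false F s
  map_one' := map_one _
  map_mul' := map_mul _

instance : Band (ColimitType F) :=
  Band.initial (colimitDesc₁ F) (fun _ _ h ↦ colimitType_ext F h)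
    (colimitGen F (Sum.inr true)) (colimitDesc₀_gen_true F)

theorem colimit_mem_nullSet_iff (x : AmbientSemiring (ColimitType F)) :
    x ∈ Band.nullSet (B := ColimitType F) ↔
      ∀ s, AmbientSemiring.map (colimitDesc₁ F s) x ∈ Band.nullSet (B := s.pt) :=
  Submodule.mem_iInf _

theorem colimitGen_true : colimitGen F (Sum.inr true) = Band.neg 1 := by
  refine Band.eq_neg ((colimit_mem_nullSet_iff F _).2 fun s ↦ ?_)
  have h : colimitDesc₁ F s (colimitGen F (Sum.inr true)) = Band.neg 1 :=
    colimitDesc₀_gen_true F s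
  rw [map_add, AmbientSemiring.map_of, AmbientSemiring.map_of, h, map_one]
  exact Band.add_neg_mem 1

/-- The inclusions into the colimit, as morphisms of pointed monoids. -/
def colimitι₀ (j : J) : F.obj j →*₀ ColimitType F where
  toFun b := colimitGen F (Sum.inl ⟨j, b⟩)
  map_zero' := colimitType_ext F fun s ↦ by
    rw [colimitDesc₀_gen_inl, map_zero]; exact (map_zero (colimitDesc₁ F s)).symm
  map_one' := colimitType_ext F fun s ↦ by
    rw [colimitDesc₀_gen_inl, map_one, map_one]
  map_mul' a b := colimitType_ext F fun s ↦ by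
    rw [map_mul, colimitDesc₀_gen_inl, colimitDesc₀_gen_inl, colimitDesc₀_gen_inl, map_mul]

/-- The inclusions into the colimit. -/
def colimitι (j : J) : BandHom (F.obj j) (ColimitType F) where
  toMonoidWithZeroHom := colimitι₀ F j
  map_nullSet x hx := (colimit_mem_nullSet_iff F _).2 fun s ↦ by
    let t : BandHom (F.obj j) s.pt := s.ι.app j
    have e : (colimitDesc₁ F s).comp (colimitι₀ F j) = t.toMonoidWithZeroHom :=
      MonoidWithZeroHom.ext fun b ↦ colimitDesc₀_gen_inl F s j b
    rw [AmbientSemiring.map_map, e]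
    exact t.map_nullSet x hx

/-- The colimit cocone. -/
def colimitCocone : Cocone F where
  pt := BandCat.of (ColimitType F)
  ι :=
    { app := fun j ↦ colimitι F j
      naturality := fun i j f ↦ BandCat.hom_ext fun b ↦ colimitType_ext F fun s ↦
        (colimitDesc₀_gen_inl F s j (F.map f b)).trans
          ((ConcreteCategory.congr_hom (s.w f) b).trans (colimitDesc₀_gen_inl F s i b).symm) }

/-- The descent of a cocone, as a band morphism. -/
def colimitDesc (s : Cocone F) : BandHom (ColimitType F) s.pt where
  toMonoidWithZeroHom := colimitDesc₁ F s
  map_nullSet x hx := (colimit_mem_nullSet_iff F x).1 hx s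

/-- The colimit cocone is a colimit. -/
def colimitCoconeIsColimit : IsColimit (colimitCocone F) where
  desc s := colimitDesc F s
  fac s j := BandCat.hom_ext fun b ↦ colimitDesc₀_gen_inl F s j b
  uniq s m hm := BandCat.hom_ext fun x ↦ by
    let m' : BandHom (ColimitType F) s.pt := m
    have hm' : ∀ j (b : F.obj j), m' (colimitGen F (Sum.inl ⟨j, b⟩)) = s.ι.app j b :=
      fun j b ↦ ConcreteCategory.congr_hom (hm j) b
    change m' x = colimitDesc₀ F s x
    obtain ⟨w, rfl⟩ := colimitMk_surjective F x
    induction w using Multiplicative.rec with | _ w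
    induction w using Multiset.induction_on with
    | empty => exact (map_one m').trans (map_one (colimitDesc₀ F s)).symm
    | cons g w ih =>
      have e : colimitMk F (Multiplicative.ofAdd (g ::ₘ w)) =
          colimitGen F g * colimitMk F (Multiplicative.ofAdd w) := by
        rw [colimitGen, ← map_mul, ← ofAdd_add, Multiset.singleton_add]
      rw [e, map_mul, map_mul, ih]
      congr 1
      rcases g with ⟨j, b⟩ | b
      · rw [hm', colimitDesc₀_gen_inl]
      · cases b
        · rw [colimitDesc₀_gen_false]
          exact map_zero m'
        · rw [colimitDesc₀_gen_true, colimitGen_true, BandHom.map_neg, map_one]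

instance : HasColimits BandCat.{u} where
  has_colimits_of_shape _ _ := { has_colimit := fun F ↦ ⟨⟨_, colimitCoconeIsColimit F⟩⟩ }

end BandCat

/-! ### The universal ring -/

/-- The universal ring `B⁺_ℤ = ℤ[B] / ⟨N_B⟩`: the quotient of the monoid ring by the formal sums of
elements of `B` whose class in `B⁺` is null. The element `0 ∈ B` is such a sum, so it becomes `0`. -/
def UniversalRing (B : Type u) [Band B] : Type u :=
  MonoidAlgebra ℤ B ⧸ Ideal.span
    (MonoidAlgebra.mapRingHom B (Nat.castRingHom ℤ) ''
      {x : MonoidAlgebra ℕ B | AmbientSemiring.mk x ∈ Band.nullSet})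

namespace UniversalRing

instance (B : Type u) [Band B] : CommRing (UniversalRing B) :=
  inferInstanceAs (CommRing (MonoidAlgebra ℤ B ⧸ _))

/-- The canonical map from `B` to its universal ring, `b ↦ [b]`. -/
def of (B : Type u) [Band B] (b : B) : UniversalRing B :=
  Ideal.Quotient.mk _ (MonoidAlgebra.single b 1)

/-- The ring homomorphism induced by a band morphism. -/
def map {B C : Type u} [Band B] [Band C] (f : BandHom B C) : UniversalRing B →+* UniversalRing C :=
  Ideal.quotientMap _ (MonoidAlgebra.mapDomainRingHom ℤ (f.toMonoidWithZeroHom : B →* C)) (by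
    rw [Ideal.span_le]
    rintro _ ⟨x, hx, rfl⟩
    refine Ideal.subset_span
      ⟨MonoidAlgebra.mapDomainRingHom ℕ (f.toMonoidWithZeroHom : B →* C) x, ?_, ?_⟩
    · have : AmbientSemiring.mk.comp
          (MonoidAlgebra.mapDomainRingHom ℕ (f.toMonoidWithZeroHom : B →* C)) =
          (AmbientSemiring.map f.toMonoidWithZeroHom).comp AmbientSemiring.mk :=
        MonoidAlgebra.ringHom_ext (fun r ↦ by
          have hr : (MonoidAlgebra.single (1 : B) r) = (r : MonoidAlgebra ℕ B) := by
            rw [MonoidAlgebra.natCast_def]; simp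
          rw [hr, map_natCast, map_natCast]) (fun m ↦ by
            rw [RingHom.comp_apply, RingHom.comp_apply, MonoidAlgebra.mapDomainRingHom_apply,
              MonoidAlgebra.mapDomain_single]
            exact (AmbientSemiring.map_of f.toMonoidWithZeroHom m).symm)
      have h2 := f.map_nullSet _ hx
      have h3 := DFunLike.congr_fun this x
      simp only [RingHom.comp_apply] at h3
      rw [Set.mem_ofPred_eq, h3]
      exact h2
    · have : (MonoidAlgebra.mapRingHom C (Nat.castRingHom ℤ)).comp
          (MonoidAlgebra.mapDomainRingHom ℕ (f.toMonoidWithZeroHom : B →* C)) =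
          (MonoidAlgebra.mapDomainRingHom ℤ (f.toMonoidWithZeroHom : B →* C)).comp
          (MonoidAlgebra.mapRingHom B (Nat.castRingHom ℤ)) :=
        MonoidAlgebra.ringHom_ext (fun r ↦ by simp) (fun m ↦ by simp)
      exact DFunLike.congr_fun this x)

@[simp]
theorem map_of {B C : Type u} [Band B] [Band C] (f : BandHom B C) (b : B) :
    map f (of B b) = of C (f b) := by
  refine (Ideal.quotientMap_mk ..).trans (congrArg (Ideal.Quotient.mk _) ?_)
  simp

theorem hom_ext {B : Type u} [Band B] {R : Type*} [CommRing R] {f g : UniversalRing B →+* R}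
    (h : ∀ b, f (of B b) = g (of B b)) : f = g :=
  Ideal.Quotient.ringHom_ext (MonoidAlgebra.ringHom_ext (fun r ↦ by
    have hr : (MonoidAlgebra.single (1 : B) r) = (r : MonoidAlgebra ℤ B) := by
      rw [MonoidAlgebra.intCast_def]; simp
    rw [hr, map_intCast, map_intCast]) h)

end UniversalRing

/-- The functor `B ↦ B⁺_ℤ` from bands to rings. -/
def universalRing : BandCat.{u} ⥤ CommRingCat.{u} where
  obj B := CommRingCat.of (UniversalRing B)
  map f := CommRingCat.ofHom (UniversalRing.map f)
  map_id B := CommRingCat.hom_ext (UniversalRing.hom_ext fun b ↦ UniversalRing.map_of _ b)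
  map_comp f g := CommRingCat.hom_ext (UniversalRing.hom_ext fun b ↦ by
    refine (UniversalRing.map_of (BandHom.comp g f) b).trans ?_
    refine .trans ?_ (congrArg (UniversalRing.map g) (UniversalRing.map_of f b)).symm
    exact (UniversalRing.map_of g (f b)).symm)

/-! ### Localizations -/

namespace Band

open AmbientSemiring

variable {B : Type u} [Band B] (S : Submonoid B)

/-- The localization map `a ↦ a / 1` as a morphism of pointed monoids. -/
def localizationMap₀ : B →*₀ Localization S where
  toFun b := Localization.mk b 1
  map_zero' := Localization.mk_zero 1
  map_one' := Localization.mk_one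
  map_mul' a b := by rw [Localization.mk_mul, one_mul]

/-- The localization `S⁻¹B` of a band, with the null set generated by the elements `∑ aᵢ / 1` for
`∑ aᵢ` in the null set of `B`. -/
instance : Band (Localization S) where
  nullSet := Ideal.span (AmbientSemiring.map (localizationMap₀ S) ''
    (Band.nullSet : Ideal (AmbientSemiring B)))
  existsUnique_neg := by
    set N : Ideal (AmbientSemiring (Localization S)) :=
      Ideal.span (AmbientSemiring.map (localizationMap₀ S) ''
    (Band.nullSet : Ideal (AmbientSemiring B))) with hN
    have hmem : ∀ a : B, of (Localization.mk a 1 : Localization S) +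
        of (Localization.mk (Band.neg a) 1 : Localization S) ∈ N := fun a ↦
      Ideal.subset_span ⟨_, Band.add_neg_mem a, by rw [map_add, map_of, map_of]; rfl⟩
    -- comparison with the localization of the ambient semiring
    let T : Submonoid (AmbientSemiring B) := S.map (of : B →*₀ AmbientSemiring B)
    let g : Localization S →*₀ Localization T :=
      (Localization.monoidOf S).lift₀
        ((algebraMap (AmbientSemiring B) (Localization T)).toMonoidWithZeroHom.comp of)
        (fun s ↦ IsLocalization.map_units (Localization T) (⟨of s.1, s.1, s.2, rfl⟩ : T))
    have hg : ∀ a : B, g (Localization.mk a 1) = algebraMap _ (Localization T) (of a) := by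
      intro a
      exact (Localization.monoidOf S).lift_eq _ a
    have hle : ∀ x ∈ N, lift g x ∈ Ideal.map (algebraMap (AmbientSemiring B) (Localization T))
        (Band.nullSet : Ideal (AmbientSemiring B)) := by
      intro x hx
      have : N ≤ Ideal.comap (lift g) (Ideal.map
          (algebraMap _ (Localization T)) (Band.nullSet : Ideal (AmbientSemiring B))) := by
        rw [hN, Ideal.span_le]
        rintro _ ⟨y, hy, rfl⟩
        have : lift g (AmbientSemiring.map (localizationMap₀ S) y) =
            algebraMap _ (Localization T) y := by
          rw [← RingHom.comp_apply, lift_comp_map]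
          exact DFunLike.congr_fun (hom_ext fun b ↦ by rw [lift_of]; exact hg b) y
        refine Ideal.mem_comap.2 ?_
        rw [this]
        exact Ideal.mem_map_of_mem _ hy
      exact this hx
    have key : ∀ a b : B, of (Localization.mk a 1 : Localization S) +
        of (Localization.mk b 1 : Localization S) ∈ N →
        (Localization.mk b 1 : Localization S) = Localization.mk (Band.neg a) 1 := by
      intro a b hab
      have h1 := hle _ hab
      rw [map_add, lift_of, lift_of, hg, hg, ← map_add,
        IsLocalization.mem_map_algebraMap_iff T] at h1
      obtain ⟨⟨n, t⟩, hnt⟩ := h1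
      rw [← map_mul] at hnt
      obtain ⟨c, hc⟩ := IsLocalization.exists_of_eq (M := T) hnt
      obtain ⟨_, t, ht, rfl⟩ := t
      obtain ⟨_, c, hc', rfl⟩ := c
      have h2 : of (c * t * a) + of (c * t * b) ∈ nullSet (B := B) := by
        have : of (c * t * a) + of (c * t * b) = of c * ((of a + of b) * of t) := by
          simp only [map_mul]; ring
        rw [this]
        exact hc ▸ Ideal.mul_mem_left _ _ n.2
      have h3 := Band.eq_neg h2
      rw [← Band.mul_neg] at h3
      rw [Localization.mk_eq_mk_iff, Localization.r_iff_exists]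
      exact ⟨⟨c * t, S.mul_mem hc' ht⟩, by simpa using h3⟩
    intro x
    induction x using Localization.induction_on with | _ x
    obtain ⟨a, s⟩ := x
    have hs : ∀ (a : B) (s : S), (Localization.mk a s : Localization S) =
        Localization.mk 1 s * Localization.mk a 1 := fun a s ↦ by
      rw [Localization.mk_mul, one_mul, mul_one]
    refine ⟨Localization.mk (Band.neg a) s, ?_, ?_⟩
    · dsimp only
      rw [hs a, hs (neg a), map_mul, map_mul, ← mul_add]
      exact Ideal.mul_mem_left _ _ (hmem a)
    · intro y hy
      induction y using Localization.induction_on with | _ y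
      obtain ⟨b, t⟩ := y
      have h4 : of (Localization.mk (t * a : B) 1 : Localization S) +
          of (Localization.mk (s * b : B) 1 : Localization S) ∈ N := by
        have e1 : (Localization.mk (t * a : B) 1 : Localization S) =
            Localization.mk (s * t : B) 1 * Localization.mk a s := by
          rw [Localization.mk_mul, Localization.mk_eq_mk_iff, Localization.r_iff_exists]
          exact ⟨1, by simp; ac_rfl⟩
        have e2 : (Localization.mk (s * b : B) 1 : Localization S) =
            Localization.mk (s * t : B) 1 * Localization.mk b t := by
          rw [Localization.mk_mul, Localization.mk_eq_mk_iff, Localization.r_iff_exists]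
          exact ⟨1, by simp; ac_rfl⟩
        rw [e1, e2, map_mul, map_mul, ← mul_add]
        exact Ideal.mul_mem_left _ _ hy
      have h5 := key _ _ h4
      rw [← Band.mul_neg, Localization.mk_eq_mk_iff, Localization.r_iff_exists] at h5
      obtain ⟨c, hc⟩ := h5
      rw [Localization.mk_eq_mk_iff, Localization.r_iff_exists]
      exact ⟨c, by simpa using hc⟩

/-- The localization map `a ↦ a / 1`. -/
def localizationMap : BandHom B (Localization S) where
  toMonoidWithZeroHom := localizationMap₀ S
  map_nullSet x hx := Ideal.subset_span ⟨x, hx, rfl⟩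

/-- The universal property of the localization. -/
def localizationLift {S : Submonoid B} {C : Type*} [Band C] (f : BandHom B C)
    (hf : ∀ s : S, IsUnit (f s)) : BandHom (Localization S) C where
  toMonoidWithZeroHom := (Localization.monoidOf S).lift₀ f.toMonoidWithZeroHom hf
  map_nullSet := by
    have : (Band.nullSet : Ideal (AmbientSemiring (Localization S))) ≤ Ideal.comap
        (AmbientSemiring.map ((Localization.monoidOf S).lift₀ f.toMonoidWithZeroHom hf))
        Band.nullSet := by
      refine Ideal.span_le.2 ?_
      rintro _ ⟨y, hy, rfl⟩
      change AmbientSemiring.map ((Localization.monoidOf S).lift₀ f.toMonoidWithZeroHom hf)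
        (AmbientSemiring.map (localizationMap₀ S) y) ∈ Band.nullSet
      have e : ((Localization.monoidOf S).lift₀ f.toMonoidWithZeroHom hf).comp
          (localizationMap₀ S) = f.toMonoidWithZeroHom :=
        MonoidWithZeroHom.ext fun b ↦ (Localization.monoidOf S).lift_eq hf b
      rw [map_map, e]
      exact f.map_nullSet y hy
    exact this

theorem localizationLift_mk {S : Submonoid B} {C : Type*} [Band C] (f : BandHom B C)
    (hf : ∀ s : S, IsUnit (f s)) (b : B) :
    localizationLift f hf (Localization.mk b 1) = f b :=
  (Localization.monoidOf S).lift_eq hf b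

theorem localization_hom_ext {S : Submonoid B} {C : Type*} [Band C] {f g : BandHom (Localization S) C}
    (h : ∀ b, f (Localization.mk b 1) = g (Localization.mk b 1)) : f = g := by
  ext x
  induction x using Localization.induction_on with | _ x
  obtain ⟨a, s⟩ := x
  have hu : IsUnit (Localization.mk (s : B) 1 : Localization S) :=
    IsUnit.of_mul_eq_one (Localization.mk 1 s) (by
      rw [Localization.mk_mul, mul_one, one_mul]; exact Localization.mk_self s)
  have e : (Localization.mk (s : B) 1 : Localization S) * Localization.mk a s =
      Localization.mk a 1 := by
    rw [Localization.mk_mul, Localization.mk_eq_mk_iff, Localization.r_iff_exists]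
    exact ⟨1, by simp⟩
  have h1 := h a
  rw [← e, map_mul, map_mul, h] at h1
  exact (hu.map g).mul_left_cancel h1

end Band

/-! ### The prime spectrum -/

/-- An `m`-ideal of a pointed monoid. -/
structure MIdeal (B : Type u) [CommMonoidWithZero B] where
  carrier : Set B
  zero_mem : 0 ∈ carrier
  mul_mem : ∀ (a : B) {b : B}, b ∈ carrier → a * b ∈ carrier

/-- A prime `m`-ideal: an `m`-ideal whose complement is a multiplicative subset. -/
structure PrimeMIdeal (B : Type u) [CommMonoidWithZero B] extends MIdeal B where
  one_mem_compl : 1 ∈ carrierᶜ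
  mul_mem_compl : ∀ {a b : B}, a ∈ carrierᶜ → b ∈ carrierᶜ → a * b ∈ carrierᶜ

namespace PrimeMIdeal

variable {B C D : Type u} [Band B] [Band C] [Band D]

/-- The complement of a prime `m`-ideal as a submonoid. -/
def primeCompl (p : PrimeMIdeal B) : Submonoid B where
  carrier := p.carrierᶜ
  one_mem' := p.one_mem_compl
  mul_mem' := p.mul_mem_compl

/-- The inverse image of a prime `m`-ideal. -/
def comap (f : BandHom B C) (q : PrimeMIdeal C) : PrimeMIdeal B where
  carrier := f ⁻¹' q.carrier
  zero_mem := by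
    change f 0 ∈ q.carrier
    rw [map_zero]
    exact q.zero_mem
  mul_mem a b hb := by
    change f (a * b) ∈ q.carrier
    rw [map_mul]
    exact q.mul_mem _ hb
  one_mem_compl := by
    change f 1 ∈ q.carrierᶜ
    rw [map_one]
    exact q.one_mem_compl
  mul_mem_compl {a b} ha hb := by
    change f (a * b) ∈ q.carrierᶜ
    rw [map_mul]
    exact q.mul_mem_compl ha hb

/-- The principal open subset `U_h = {p | h ∉ p}`. -/
def basicOpen (h : B) : Set (PrimeMIdeal B) := {p | h ∉ p.carrier}

/-- The topology generated by the principal open subsets. -/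
instance : TopologicalSpace (PrimeMIdeal B) :=
  TopologicalSpace.generateFrom (Set.range basicOpen)

theorem isOpen_basicOpen (h : B) : IsOpen (basicOpen h) :=
  TopologicalSpace.isOpen_generateFrom_of_mem ⟨h, rfl⟩

theorem continuous_comap (f : BandHom B C) : Continuous (comap f) := by
  refine continuous_generateFrom_iff.2 ?_
  rintro _ ⟨h, rfl⟩
  exact isOpen_basicOpen (f h)

/-- The localization `B_p` of a band at a prime `m`-ideal. -/
abbrev Local (p : PrimeMIdeal B) : Type u := Localization p.primeCompl

/-- The map `B_{f⁻¹(q)} → C_q` induced by a band morphism `f : B → C`. -/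
def localMap (f : BandHom B C) (q : PrimeMIdeal C) : BandHom (comap f q).Local q.Local :=
  Band.localizationLift ((Band.localizationMap q.primeCompl).comp f) (fun s ↦
    IsUnit.of_mul_eq_one (Localization.mk 1 ⟨f s, s.2⟩ : q.Local) (by
      change Localization.mk (f s) 1 * _ = _
      rw [Localization.mk_mul, mul_one, one_mul]
      exact Localization.mk_self (⟨f s, s.2⟩ : q.primeCompl)))

theorem localMap_mk (f : BandHom B C) (q : PrimeMIdeal C) (a : B) (s : (comap f q).primeCompl) :
    localMap f q (Localization.mk a s) = Localization.mk (f a) ⟨f s, s.2⟩ := by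
  have hu : IsUnit (Localization.mk (f s) 1 : q.Local) :=
    IsUnit.of_mul_eq_one (Localization.mk 1 ⟨f s, s.2⟩ : q.Local) (by
      rw [Localization.mk_mul, mul_one, one_mul]
      exact Localization.mk_self (⟨f s, s.2⟩ : q.primeCompl))
  have h1 : ∀ b, localMap f q (Localization.mk b 1) = Localization.mk (f b) 1 :=
    fun b ↦ Band.localizationLift_mk _ _ b
  refine hu.mul_left_cancel ?_
  rw [← h1, ← map_mul, Localization.mk_mul, one_mul, h1, Localization.mk_mul, one_mul]
  have e : (Localization.mk (s * a : B) s : (comap f q).Local) = Localization.mk a 1 := by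
    rw [Localization.mk_eq_mk_iff, Localization.r_iff_exists]
    exact ⟨1, by simp⟩
  rw [e, h1, Localization.mk_eq_mk_iff, Localization.r_iff_exists]
  exact ⟨1, by simp⟩

theorem localMap_id (p : PrimeMIdeal B) (x : p.Local) : localMap (BandHom.id B) p x = x := by
  induction x using Localization.induction_on with | _ x
  exact localMap_mk (BandHom.id B) p x.1 x.2

theorem localMap_comp (g : BandHom C D) (f : BandHom B C) (p : PrimeMIdeal D)
    (x : (comap f (comap g p)).Local) :
    localMap (g.comp f) p x = localMap g p (localMap f (comap g p) x) := by
  induction x using Localization.induction_on with | _ x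
  rw [localMap_mk, localMap_mk]
  exact localMap_mk (g.comp f) p x.1 x.2

theorem isUnit_mk_iff {p : PrimeMIdeal B} (a : B) (s : p.primeCompl) :
    IsUnit (Localization.mk a s : p.Local) ↔ a ∉ p.carrier := by
  constructor
  · intro h ha
    obtain ⟨y, hy⟩ := h.exists_right_inv
    induction y using Localization.induction_on with | _ y
    obtain ⟨b, t⟩ := y
    rw [Localization.mk_mul, ← Localization.mk_one, Localization.mk_eq_mk_iff,
      Localization.r_iff_exists] at hy
    obtain ⟨c, hc⟩ := hy
    have h1 : (c : B) * (a * b) ∈ p.carrier := by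
      rw [mul_comm a b, ← mul_assoc]
      exact p.mul_mem _ ha
    refine (c * (s * t) : p.primeCompl).2 ?_
    have h2 : (c : B) * (s * t) = c * (a * b) := by simpa using hc.symm
    change (c : B) * (s * t) ∈ p.carrier
    rwa [h2]
  · intro ha
    refine IsUnit.of_mul_eq_one (Localization.mk s ⟨a, ha⟩) ?_
    rw [Localization.mk_mul, ← Localization.mk_one, Localization.mk_eq_mk_iff,
      Localization.r_iff_exists]
    exact ⟨1, by simp [mul_comm]⟩

/-! ### The structure sheaf -/

/-- A family of elements `s p ∈ B_p`, for `p ∈ U`, is regular if it is locally of the form `a / f`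
with `a, f ∈ B`. -/
def IsRegular {U : Opens (PrimeMIdeal B)} (s : ∀ p : U, p.1.Local) : Prop :=
  ∀ p : U, ∃ V : Opens (PrimeMIdeal B), p.1 ∈ V ∧ ∃ hV : V ≤ U, ∃ a f : B, ∀ q : V,
    ∃ hf : f ∈ q.1.primeCompl, s ⟨q.1, hV q.2⟩ = Localization.mk a ⟨f, hf⟩

/-- The sections over `U` of the structure sheaf of the spectrum. Since `U_h` is contained in every
open subset that contains the ideal of all elements that do not divide a power of `h`, this is the
sheaf with `𝒪(U_h) = B[h⁻¹]`. -/
structure Sections (U : Opens (PrimeMIdeal B)) : Type u where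
  val : ∀ p : U, p.1.Local
  isRegular : IsRegular val

namespace Sections

variable {U V W : Opens (PrimeMIdeal B)}

theorem ext {s t : Sections U} (h : ∀ p, s.1 p = t.1 p) : s = t := by
  obtain ⟨s, _⟩ := s
  obtain ⟨t, _⟩ := t
  congr
  exact funext h

/-- The section `a / f` over an open subset on which `f` does not vanish. -/
def const (a f : B) (hf : ∀ p ∈ U, f ∉ p.carrier) : Sections U :=
  ⟨fun p ↦ Localization.mk a ⟨f, hf p.1 p.2⟩, fun p ↦
    ⟨U, p.2, le_rfl, a, f, fun q ↦ ⟨hf q.1 q.2, rfl⟩⟩⟩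

instance : Zero (Sections U) :=
  ⟨⟨fun _ ↦ 0, fun p ↦ ⟨U, p.2, le_rfl, 0, 1, fun q ↦
    ⟨q.1.primeCompl.one_mem, (Localization.mk_zero 1).symm⟩⟩⟩⟩

instance : One (Sections U) :=
  ⟨⟨fun _ ↦ 1, fun p ↦ ⟨U, p.2, le_rfl, 1, 1, fun q ↦
    ⟨q.1.primeCompl.one_mem, Localization.mk_one.symm⟩⟩⟩⟩

instance : Mul (Sections U) :=
  ⟨fun s t ↦ ⟨fun p ↦ s.1 p * t.1 p, fun p ↦ by
    obtain ⟨V, hpV, hVU, a, f, h⟩ := s.2 p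
    obtain ⟨W, hpW, hWU, b, g, h'⟩ := t.2 p
    refine ⟨V ⊓ W, ⟨hpV, hpW⟩, inf_le_left.trans hVU, a * b, f * g, fun q ↦ ?_⟩
    obtain ⟨hf, e⟩ := h ⟨q.1, q.2.1⟩
    obtain ⟨hg, e'⟩ := h' ⟨q.1, q.2.2⟩
    exact ⟨q.1.primeCompl.mul_mem hf hg, (congrArg₂ (· * ·) e e').trans (Localization.mk_mul ..)⟩⟩⟩

instance : CommMonoidWithZero (Sections U) where
  mul_assoc _ _ _ := ext fun _ ↦ mul_assoc _ _ _
  mul_comm _ _ := ext fun _ ↦ mul_comm _ _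
  one_mul _ := ext fun _ ↦ one_mul _
  mul_one _ := ext fun _ ↦ mul_one _
  zero_mul _ := ext fun _ ↦ zero_mul _
  mul_zero _ := ext fun _ ↦ mul_zero _

/-- The value of a section at a point, as a morphism of pointed monoids. -/
def eval₀ (p : U) : Sections U →*₀ p.1.Local where
  toFun s := s.1 p
  map_zero' := rfl
  map_one' := rfl
  map_mul' _ _ := rfl

/-- A formal sum of sections is null iff it is null in `B_p` for all `p ∈ U`. -/
instance : Band (Sections U) :=
  Band.initial eval₀ (fun _ _ h ↦ ext h)
    (const (Band.neg 1) 1 fun p _ ↦ p.one_mem_compl) (fun p ↦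
      ((Band.localizationMap p.1.primeCompl).map_neg 1).trans
        (congrArg Band.neg (map_one (Band.localizationMap p.1.primeCompl))))

theorem mem_nullSet_iff (x : AmbientSemiring (Sections U)) :
    x ∈ Band.nullSet (B := Sections U) ↔
      ∀ p, AmbientSemiring.map (eval₀ p) x ∈ Band.nullSet (B := p.1.Local) :=
  Submodule.mem_iInf _

/-- A family of maps into the local bands that lands in regular families. -/
def homMk₀ {E : Type*} [Band E] (f : E → Sections U) (g : ∀ p : U, BandHom E p.1.Local)
    (h : ∀ e p, (f e).1 p = g p e) : E →*₀ Sections U where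
  toFun := f
  map_zero' := ext fun p ↦ (h 0 p).trans (map_zero (g p))
  map_one' := ext fun p ↦ (h 1 p).trans (map_one (g p))
  map_mul' a b := ext fun p ↦ (h (a * b) p).trans ((map_mul (g p) a b).trans
    (congrArg₂ (· * ·) (h a p) (h b p)).symm)

/-- A family of band morphisms into the local bands that lands in regular families. -/
def homMk {E : Type*} [Band E] (f : E → Sections U) (g : ∀ p : U, BandHom E p.1.Local)
    (h : ∀ e p, (f e).1 p = g p e) : BandHom E (Sections U) where
  toMonoidWithZeroHom := homMk₀ f g h
  map_nullSet x hx := (mem_nullSet_iff _).2 fun p ↦ by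
    have e : (eval₀ p).comp (homMk₀ f g h) = (g p).toMonoidWithZeroHom :=
      MonoidWithZeroHom.ext fun e ↦ h e p
    rw [AmbientSemiring.map_map, e]
    exact (g p).map_nullSet x hx

/-- The value of a section at a point. -/
def eval (p : U) : BandHom (Sections U) p.1.Local where
  toMonoidWithZeroHom := eval₀ p
  map_nullSet x hx := (mem_nullSet_iff x).1 hx p

/-- The restriction of sections. -/
def res (h : V ≤ U) : BandHom (Sections U) (Sections V) :=
  homMk (fun s ↦ ⟨fun p ↦ s.1 ⟨p.1, h p.2⟩, fun p ↦ by
    obtain ⟨W, hpW, hWU, a, f, hs⟩ := s.2 ⟨p.1, h p.2⟩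
    exact ⟨W ⊓ V, ⟨hpW, p.2⟩, inf_le_right, a, f, fun q ↦ hs ⟨q.1, q.2.1⟩⟩⟩)
    (fun p ↦ eval ⟨p.1, h p.2⟩) (fun _ _ ↦ rfl)

/-- The canonical map `B → 𝒪(U)`. -/
def fromBand (U : Opens (PrimeMIdeal B)) : BandHom B (Sections U) :=
  homMk (fun b ↦ const b 1 fun p _ ↦ p.one_mem_compl)
    (fun p ↦ Band.localizationMap p.1.primeCompl) (fun _ _ ↦ rfl)

/-- The inverse image of an open subset under the map of spectra. -/
abbrev preimage (f : BandHom B C) (U : Opens (PrimeMIdeal B)) : Opens (PrimeMIdeal C) :=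
  Opens.comap ⟨comap f, continuous_comap f⟩ U

/-- The pullback of sections along the map of spectra. -/
def pullback (f : BandHom B C) (U : Opens (PrimeMIdeal B)) :
    BandHom (Sections U) (Sections (preimage f U)) :=
  homMk (fun s ↦ ⟨fun q ↦ localMap f q.1 (s.1 ⟨comap f q.1, q.2⟩), fun q ↦ by
    obtain ⟨W, hpW, hWU, a, g, hs⟩ := s.2 ⟨comap f q.1, q.2⟩
    refine ⟨preimage f W, hpW, fun _ h ↦ hWU h, f a, f g, fun r ↦ ?_⟩
    obtain ⟨hg, e⟩ := hs ⟨comap f r.1, r.2⟩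
    exact ⟨hg, (congrArg _ e).trans (localMap_mk f r.1 a ⟨g, hg⟩)⟩⟩)
    (fun q ↦ (localMap f q.1).comp (eval ⟨comap f q.1, q.2⟩)) (fun _ _ ↦ rfl)

end Sections

variable (B) in
/-- The prime spectrum as a topological space. -/
abbrev top : TopCat.{u} := TopCat.of (PrimeMIdeal B)

variable (B) in
/-- The structure presheaf of the spectrum of a band. -/
def structurePresheaf : TopCat.Presheaf BandCat.{u} (top B) where
  obj U := BandCat.of (Sections (B := B) U.unop)
  map i := Sections.res (B := B) i.unop.le
  map_id _ := rfl
  map_comp _ _ := rfl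

theorem structurePresheaf_isSheaf : (structurePresheaf B).IsSheaf := by
  intro E
  rw [← isSheaf_iff_isSheaf_of_type]
  refine TopCat.Presheaf.isSheaf_of_isSheafUniqueGluing_types (X := top B)
    (structurePresheaf B ⋙ coyoneda.obj (op E)) ?_
  intro ι U sf hsf
  let sf' : ∀ i, BandHom E (Sections (B := B) (U i)) := sf
  have hc : ∀ (i j : ι) (p : top B) (hi : p ∈ U i) (hj : p ∈ U j) (e : E),
      (sf' i e).1 ⟨p, hi⟩ = (sf' j e).1 ⟨p, hj⟩ := fun i j p hi hj e ↦
    congrArg (fun (k : BandHom E (Sections (B := B) (U i ⊓ U j))) ↦ (k e).1 ⟨p, hi, hj⟩) (hsf i j)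
  have hex : ∀ p : (iSup U : Opens (top B)), ∃ i, p.1 ∈ U i := fun p ↦ Opens.mem_iSup.1 p.2
  choose i hi using hex
  let s : BandHom E (Sections (B := B) (iSup U)) :=
    Sections.homMk (fun e ↦ ⟨fun p ↦ (sf' (i p) e).1 ⟨p.1, hi p⟩, fun p ↦ by
      obtain ⟨W, hpW, hWU, a, f, hs⟩ := (sf' (i p) e).2 ⟨p.1, hi p⟩
      refine ⟨W, hpW, hWU.trans (le_iSup U _), a, f, fun q ↦ ?_⟩
      obtain ⟨hf, h⟩ := hs q
      exact ⟨hf, (hc _ (i p) q.1 (hi ⟨q.1, le_iSup U (i p) (hWU q.2)⟩) (hWU q.2) e).trans h⟩⟩)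
      (fun p ↦ (Sections.eval ⟨p.1, hi p⟩).comp (sf' (i p))) (fun _ _ ↦ rfl)
  refine ⟨s, fun j ↦ ?_, fun t ht ↦ ?_⟩
  · refine BandHom.ext (B := E) (C := Sections (B := B) (U j)) fun e ↦ Sections.ext fun p ↦ ?_
    exact hc _ _ _ _ _ e
  · refine BandHom.ext (B := E) (C := Sections (B := B) (iSup U)) fun e ↦ Sections.ext fun p ↦ ?_
    exact congrArg (fun (k : BandHom E (Sections (B := B) (U (i p)))) ↦ (k e).1 ⟨p.1, hi p⟩)
      (ht (i p))

end PrimeMIdeal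

/-! ### Band spaces -/

/-- A band space: a topological space with a sheaf of bands. -/
structure BandSpace : Type (u + 1) where
  toSheafedSpace : AlgebraicGeometry.SheafedSpace.{u + 1, u, u} BandCat.{u}

namespace BandSpace

/-- A morphism of band spaces: a continuous map with a morphism of sheaves that is local, i.e. the
induced maps of stalks send non-units to non-units. -/
@[ext]
structure Hom (X Y : BandSpace.{u}) : Type u where
  toHom : X.toSheafedSpace ⟶ Y.toSheafedSpace
  isLocal : ∀ (x : X.toSheafedSpace)
    (a : Y.toSheafedSpace.presheaf.stalk (toHom.hom.base x)),
    ¬ IsUnit a → ¬ IsUnit (toHom.hom.stalkMap x a)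

theorem isLocal_of_isIso {X Y : AlgebraicGeometry.SheafedSpace.{u + 1, u, u} BandCat.{u}}
    (f : X ⟶ Y) [IsIso f] (x : X) (a : Y.presheaf.stalk (f.hom.base x)) (ha : ¬ IsUnit a) :
    ¬ IsUnit (f.hom.stalkMap x a) := by
  intro h
  let g : BandHom _ _ := inv (f.hom.stalkMap x)
  have hg : g (f.hom.stalkMap x a) = a :=
    ConcreteCategory.congr_hom (IsIso.hom_inv_id (f.hom.stalkMap x)) a
  exact ha (hg ▸ h.map g)

instance : Category BandSpace.{u} where
  Hom := Hom
  id X := ⟨𝟙 _, fun x a ha ↦ isLocal_of_isIso (𝟙 X.toSheafedSpace) x a ha⟩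
  comp f g := ⟨f.toHom ≫ g.toHom, fun x a ha ↦ by
    have := f.isLocal x _ (g.isLocal (f.toHom.hom.base x) a ha)
    have e : (f.toHom ≫ g.toHom).hom.stalkMap x = _ :=
      AlgebraicGeometry.PresheafedSpace.stalkMap.comp f.toHom.hom g.toHom.hom x
    rw [e]
    exact this⟩
  id_comp f := Hom.ext (Category.id_comp f.toHom)
  comp_id f := Hom.ext (Category.comp_id f.toHom)
  assoc f g h := Hom.ext (Category.assoc f.toHom g.toHom h.toHom)

/-- An isomorphism of sheafed spaces is an isomorphism of band spaces. -/
def isoMk {X Y : BandSpace.{u}} (e : X.toSheafedSpace ≅ Y.toSheafedSpace) : X ≅ Y where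
  hom := ⟨e.hom, isLocal_of_isIso e.hom⟩
  inv := ⟨e.inv, isLocal_of_isIso e.inv⟩
  hom_inv_id := Hom.ext e.hom_inv_id
  inv_hom_id := Hom.ext e.inv_hom_id

/-- The restriction of a band space to an open subset. -/
def restrict (X : BandSpace.{u}) (U : Opens X.toSheafedSpace) : BandSpace.{u} :=
  ⟨X.toSheafedSpace.restrict U.isOpenEmbedding⟩

end BandSpace

/-! ### The spectrum as a band space -/

namespace PrimeMIdeal

variable {B C D : Type u} [Band B] [Band C] [Band D]

variable (B) in
/-- The spectrum of a band as a sheafed space. -/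
def specSheafedSpace : AlgebraicGeometry.SheafedSpace.{u + 1, u, u} BandCat.{u} where
  carrier := top B
  presheaf := structurePresheaf B
  IsSheaf := structurePresheaf_isSheaf

/-- The morphism of sheafed spaces induced by a band morphism. -/
def specMap (f : BandHom B C) : specSheafedSpace C ⟶ specSheafedSpace B :=
  InducedCategory.homMk
    { base := TopCat.ofHom ⟨comap f, continuous_comap f⟩
      c :=
        { app := fun U ↦ Sections.pullback f U.unop
          naturality := fun _ _ _ ↦ rfl } }

/-- The map from the stalk of the structure sheaf at `p` to `B_p`. -/
def stalkToLocal (p : PrimeMIdeal B) :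
    BandHom ((structurePresheaf B).stalk p) (p.Local) :=
  let t : (structurePresheaf B).stalk p ⟶ BandCat.of p.Local :=
    colimit.desc ((OpenNhds.inclusion (X := top B) p).op ⋙ structurePresheaf B)
      { pt := BandCat.of p.Local
        ι :=
          { app := fun U ↦ Sections.eval (B := B) ⟨p, U.unop.2⟩
            naturality := fun _ _ _ ↦ rfl } }
  t

/-- The germ of a section. -/
def germ (p : PrimeMIdeal B) (U : Opens (top B)) (hp : p ∈ U) :
    BandHom (Sections (B := B) U) ((structurePresheaf B).stalk p) :=
  (structurePresheaf B).germ U p hp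

theorem stalkToLocal_germ (p : PrimeMIdeal B) (U : Opens (top B)) (hp : p ∈ U)
    (s : Sections (B := B) U) : stalkToLocal p (germ p U hp s) = s.1 ⟨p, hp⟩ :=
  ConcreteCategory.congr_hom
    (colimit.ι_desc (F := (OpenNhds.inclusion (X := top B) p).op ⋙ structurePresheaf B) _
      (op (⟨U, hp⟩ : OpenNhds (X := top B) p))) s

theorem germ_res (p : PrimeMIdeal B) {U V : Opens (top B)} (h : V ≤ U) (hp : p ∈ V)
    (s : Sections (B := B) U) : germ p V hp (Sections.res h s) = germ p U (h hp) s :=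
  ConcreteCategory.congr_hom ((structurePresheaf B).germ_res (homOfLE h) p hp) s

theorem isUnit_germ_const (p : PrimeMIdeal B) {f : B} (hf : f ∉ p.carrier) :
    IsUnit (germ p ⊤ trivial (Sections.fromBand ⊤ f)) := by
  let V : Opens (top B) := ⟨basicOpen f, isOpen_basicOpen f⟩
  have hV : V ≤ ⊤ := le_top
  rw [← germ_res p hV hf]
  refine IsUnit.map _ (IsUnit.of_mul_eq_one
    (Sections.const 1 f (fun q hq ↦ hq) : Sections (B := B) V) (Sections.ext fun q ↦ ?_))
  change Localization.mk f 1 * Localization.mk 1 _ = 1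
  rw [Localization.mk_mul, mul_one, one_mul]
  exact Localization.mk_self (⟨f, q.2⟩ : q.1.primeCompl)

/-- The map from `B_p` to the stalk of the structure sheaf at `p`. -/
def localToStalk (p : PrimeMIdeal B) :
    BandHom (p.Local) ((structurePresheaf B).stalk p) :=
  Band.localizationLift ((germ p ⊤ trivial).comp (Sections.fromBand ⊤))
    (fun s ↦ isUnit_germ_const p s.2)

theorem localToStalk_stalkToLocal (p : PrimeMIdeal B) (a : (structurePresheaf B).stalk p) :
    localToStalk p (stalkToLocal p a) = a := by
  have key : ∀ (U : Opens (top B)) (hp : p ∈ U) (s : Sections (B := B) U),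
      localToStalk p (stalkToLocal p (germ p U hp s)) = germ p U hp s := by
    intro U hp s
    obtain ⟨V, hpV, hVU, b, f, h⟩ := s.2 ⟨p, hp⟩
    obtain ⟨hf, e⟩ := h ⟨p, hpV⟩
    rw [stalkToLocal_germ, show s.1 ⟨p, hp⟩ = _ from e]
    refine (isUnit_germ_const p hf).mul_right_cancel ?_
    have e1 : ∀ c : B, localToStalk p (Localization.mk c 1) =
        germ p ⊤ trivial (Sections.fromBand ⊤ c) := fun c ↦ Band.localizationLift_mk _ _ c
    have hle : V ≤ ⊤ := le_top
    rw [← e1, ← map_mul, Localization.mk_mul, mul_one]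
    have e2 : (Localization.mk (b * f) ⟨f, hf⟩ : p.Local) = Localization.mk b 1 := by
      rw [Localization.mk_eq_mk_iff, Localization.r_iff_exists]
      exact ⟨1, by simp [mul_comm]⟩
    rw [e2, e1, e1, ← germ_res p hVU hpV s, ← germ_res p hle hpV, ← germ_res p hle hpV, ← map_mul]
    congr 1
    refine Sections.ext fun q ↦ ?_
    obtain ⟨hq, e3⟩ := h q
    change Localization.mk b 1 = s.1 ⟨q.1, hVU q.2⟩ * Localization.mk f 1
    rw [e3, Localization.mk_mul, mul_one, Localization.mk_eq_mk_iff, Localization.r_iff_exists]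
    exact ⟨1, by simp [mul_comm]⟩
  have := TopCat.Presheaf.stalk_hom_ext (structurePresheaf B) (x := p)
    (f₁ := (localToStalk p).comp (stalkToLocal p)) (f₂ := BandHom.id _)
    (fun U hp ↦ BandCat.hom_ext fun s ↦ key U hp s)
  exact congrArg (fun k : BandHom _ _ ↦ k a) this

/-- The map of stalks induced by a band morphism. -/
def stalkMap (f : BandHom B C) (q : PrimeMIdeal C) :
    BandHom ((structurePresheaf B).stalk (comap f q)) ((structurePresheaf C).stalk q) :=
  (specMap f).hom.stalkMap q

theorem stalkMap_germ (f : BandHom B C) (q : PrimeMIdeal C) (U : Opens (PrimeMIdeal B))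
    (hp : comap f q ∈ U) (hq : q ∈ Sections.preimage f U) (s : Sections U) :
    stalkMap f q (germ (comap f q) U hp s) =
      germ q (Sections.preimage f U) hq (Sections.pullback f U s) :=
  ConcreteCategory.congr_hom
    (AlgebraicGeometry.PresheafedSpace.stalkMap_germ (specMap f).hom U q hp) s

theorem stalkToLocal_comp_stalkMap (f : BandHom B C) (q : PrimeMIdeal C) :
    (stalkToLocal q).comp (stalkMap f q) = (localMap f q).comp (stalkToLocal (comap f q)) := by
  refine TopCat.Presheaf.stalk_hom_ext (structurePresheaf B) (x := comap f q)
    (Y := BandCat.of q.Local)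
    (f₁ := (stalkToLocal q).comp (stalkMap f q))
    (f₂ := (localMap f q).comp (stalkToLocal (comap f q)))
    (fun U hp ↦ BandHom.ext fun (s : Sections (B := B) U) ↦ ?_)
  change stalkToLocal q (stalkMap f q (germ (comap f q) U hp s)) =
    localMap f q (stalkToLocal (comap f q) (germ (comap f q) U hp s))
  have hq : q ∈ Sections.preimage f U := hp
  rw [stalkMap_germ f q U hp hq, stalkToLocal_germ, stalkToLocal_germ]
  rfl

theorem specMap_isLocal (f : BandHom B C) (q : PrimeMIdeal C)
    (a : (structurePresheaf B).stalk (comap f q)) (ha : ¬ IsUnit a) :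
    ¬ IsUnit (stalkMap f q a) := by
  intro h
  have h1 := h.map (stalkToLocal q)
  have e : stalkToLocal q (stalkMap f q a) = localMap f q (stalkToLocal (comap f q) a) :=
    congrArg (fun k : BandHom _ _ ↦ k a) (stalkToLocal_comp_stalkMap f q)
  rw [e] at h1
  rw [← localToStalk_stalkToLocal (comap f q) a] at ha
  refine ha (IsUnit.map _ ?_)
  generalize stalkToLocal (comap f q) a = x at h1
  induction x using Localization.induction_on with | _ x
  obtain ⟨b, s⟩ := x
  rw [localMap_mk] at h1
  exact (isUnit_mk_iff (p := comap f q) b s).2 ((isUnit_mk_iff (p := q) (f b) _).1 h1)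

end PrimeMIdeal

namespace BandSpace

/-- The spectrum of a band as a band space, functorially. -/
def spec : BandCat.{u}ᵒᵖ ⥤ BandSpace.{u} where
  obj B := ⟨PrimeMIdeal.specSheafedSpace B.unop⟩
  map {C B} f :=
    let g : BandHom B.unop C.unop := f.unop
    ⟨PrimeMIdeal.specMap g, PrimeMIdeal.specMap_isLocal g⟩
  map_id B := by
    refine Hom.ext (InducedCategory.hom_ext (AlgebraicGeometry.PresheafedSpace.hext _ _ rfl ?_))
    refine heq_of_eq (NatTrans.ext (funext fun U ↦ BandHom.ext
      fun (s : PrimeMIdeal.Sections (B := B.unop) U.unop) ↦ PrimeMIdeal.Sections.ext fun p ↦ ?_))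
    exact PrimeMIdeal.localMap_id p.1 _
  map_comp {D C B} f g := by
    refine Hom.ext (InducedCategory.hom_ext (AlgebraicGeometry.PresheafedSpace.hext _ _ rfl ?_))
    refine heq_of_eq (NatTrans.ext (funext fun U ↦ BandHom.ext
      fun (s : PrimeMIdeal.Sections (B := B.unop) U.unop) ↦ PrimeMIdeal.Sections.ext fun p ↦ ?_))
    let f' : BandHom C.unop D.unop := f.unop
    let g' : BandHom B.unop C.unop := g.unop
    exact PrimeMIdeal.localMap_comp f' g' p.1 _

end BandSpace

/-! ### Band schemes -/

/-- A band scheme: a band space in which every point has an open neighborhood isomorphic to the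
spectrum of a band. -/
structure BandScheme : Type (u + 1) extends BandSpace.{u} where
  local_affine : ∀ x : toSheafedSpace, ∃ U : Opens toSheafedSpace, x ∈ U ∧
    ∃ B : BandCat.{u}, Nonempty (toBandSpace.restrict U ≅ BandSpace.spec.obj (op B))

namespace BandScheme

/-- Morphisms of band schemes are morphisms of band spaces. -/
instance : Category BandScheme.{u} :=
  inferInstanceAs (Category (InducedCategory BandSpace.{u} BandScheme.toBandSpace))

/-- The spectrum functor from bands to band schemes. -/
def Spec : BandCat.{u}ᵒᵖ ⥤ BandScheme.{u} where
  obj B :=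
    { toBandSpace := BandSpace.spec.obj B
      local_affine := fun _ ↦ ⟨⊤, trivial, B.unop,
        ⟨BandSpace.isoMk (BandSpace.spec.obj B).toSheafedSpace.restrictTopIso⟩⟩ }
  map f := InducedCategory.homMk (BandSpace.spec.map f)
  map_id B := InducedCategory.hom_ext (BandSpace.spec.map_id B)
  map_comp f g := InducedCategory.hom_ext (BandSpace.spec.map_comp f g)

/-- An affine band scheme: one that is isomorphic to the spectrum of a band. -/
def IsAffine (X : BandScheme.{u}) : Prop := ∃ B : BandCat.{u}, Nonempty (X ≅ Spec.obj (op B))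

/-- An open immersion of band schemes: a morphism that restricts to an isomorphism onto an open
subscheme. -/
def IsOpenImmersion {X Y : BandScheme.{u}} (f : X ⟶ Y) : Prop :=
  AlgebraicGeometry.SheafedSpace.IsOpenImmersion f.hom.toHom

/-- An affine presentation `X = colim U` of a band scheme. (The diagram is automatically
commutative since open immersions are monomorphisms.) -/
structure AffinePresentation (X : BandScheme.{u}) : Type (u + 1) where
  J : Type u
  [smallCategory : SmallCategory J]
  diagram : J ⥤ BandScheme.{u}
  isAffine : ∀ j, (diagram.obj j).IsAffine
  isOpenImmersion_map : ∀ {i j : J} (f : i ⟶ j), IsOpenImmersion (diagram.map f)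
  ι : diagram ⟶ (Functor.const J).obj X
  isOpenImmersion_ι : ∀ j, IsOpenImmersion (ι.app j)
  isColimit : IsColimit (Cocone.mk X ι)

attribute [instance] AffinePresentation.smallCategory

/-- The cocone of an affine presentation. -/
def AffinePresentation.cocone {X : BandScheme.{u}} (P : AffinePresentation X) : Cocone P.diagram :=
  Cocone.mk X P.ι

/-- A functor `F` from band schemes to schemes satisfies `F(X) = colim F(U)` for every affine
presentation `X = colim U`: the image of the colimit cocone is a colimit cocone of schemes. -/
def IsCompatibleWithPresentations (F : BandScheme.{u} ⥤ AlgebraicGeometry.Scheme.{u}) : Prop :=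
  ∀ (X : BandScheme.{u}) (P : AffinePresentation X), Nonempty (IsColimit (F.mapCocone P.cocone))

end BandScheme

end

/-! Part (1) is a matter of universal properties. Ring homomorphisms `B⁺_ℤ → R` are the same as band
morphisms from `B` to `R`, where `R` is made into a band whose null sums are those that vanish in
`R`. So `universalRing` is a left adjoint and preserves all colimits, pushouts among them. The rings
`(B[h⁻¹])⁺_ℤ` and `B⁺_ℤ[[h]⁻¹]` both represent the ring maps out of `B⁺_ℤ` that invert `[h]`, so
they agree (`UniversalRing.isLocalization_away`).

For the existence in (2), the extension is constructed from its functor of points. A `LocHom S X` is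
a local morphism from a scheme `S` to a band space `X`. Into `Spec B` these are the ring
homomorphisms `B⁺_ℤ → Γ(S, ⊤)`, that is, the morphisms `S → Spec B⁺_ℤ` (`LocHom.specEquiv`,
`LocHom.toSpec_bijective`). Local morphisms form a Zariski sheaf in `S` (`isSheaf_locHomFunctor`),
and open immersions of band spaces become open immersions of functors
(`BandSpace.presheaf_isOpenImmersion`). A band scheme is covered by spectra, so its functor of
points is representable; this gives `BandScheme.toScheme` together with
`BandScheme.specToSchemeIso`.

Compatibility with presentations needs geometric information extracted from the bare colimit
property. The test object is `X` with a point `x` doubled, i.e. two copies of `X` glued outside the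
closure of `x` (`BandScheme.exists_double`). Its two inclusions of `X` differ at `x` but agree on
every open subscheme that misses `x`. Testing the colimit against it shows that the pieces of a
presentation cover `X` (`exists_mem_range`) and that two points of pieces with the same image are
joined by a zigzag in the diagram (`eqvGen_of_val_eq`). A cocone of schemes therefore agrees locally
on the overlaps of the open cover of `toScheme.obj X` by the images of the pieces
(`agreeAt_of_eqvGen`), and so it glues uniquely.

For uniqueness, every band scheme is the colimit of its nonempty affine open subschemes
(`affinePresentation`), so an isomorphism `θ` of the two functors on spectra induces isomorphisms on
all values, once `θ` is natural for every morphism between these spectra. It is, because such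
morphisms come from band morphisms (`PrimeMIdeal.exists_eq_specMap`). The key fact here and for
naturality in general is that the spectrum of a nonzero band has a closed point whose only open
neighbourhood is the whole space: global sections are just elements of the band, and every morphism
from such a spectrum to a band scheme factors through a single affine open subset. The zero band is
treated separately, since its image under either functor is empty. -/

noncomputable section

/-! ### Universal property of the universal ring, and localizations. -/

namespace UniversalRing

variable {B : Type u} [Band B]

/-- The canonical map from a band to its universal ring, as a morphism of pointed monoids. -/
def ofHom (B : Type u) [Band B] : B →*₀ UniversalRing B where
  toFun := of B
  map_zero' := Ideal.Quotient.eq_zero_iff_mem.2 (Ideal.subset_span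
    ⟨MonoidAlgebra.single 0 1, by
      change AmbientSemiring.of (0 : B) ∈ Band.nullSet
      rw [map_zero]
      exact zero_mem _, by simp⟩)
  map_one' := by
    rw [of, ← MonoidAlgebra.one_def]
    exact map_one _
  map_mul' a b := by
    rw [of, of, of]
    refine .trans ?_ (map_mul (Ideal.Quotient.mk _) _ _)
    rw [MonoidAlgebra.single_mul_single, one_mul]

@[simp] theorem of_zero : of B 0 = 0 := map_zero (ofHom B)
@[simp] theorem of_one : of B 1 = 1 := map_one (ofHom B)
@[simp] theorem of_mul (a b : B) : of B (a * b) = of B a * of B b := map_mul (ofHom B) a b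

/-- Null sums live in a quotient of `ℕ[B]`, while the universal ring is a quotient of `ℤ[B]`. Both
evaluations are ring maps out of `ℕ[B]` with the same values on generators, which lets conditions on
null sums pass from one side to the other. -/
theorem lift_mk {R : Type*} [CommRing R] (f : B →*₀ R) (x : MonoidAlgebra ℕ B) :
    AmbientSemiring.lift f (AmbientSemiring.mk x) =
      MonoidAlgebra.lift ℤ R B (f : B →* R)
        (MonoidAlgebra.mapRingHom B (Nat.castRingHom ℤ) x) := by
  have : (AmbientSemiring.lift f).comp AmbientSemiring.mk =
      ((MonoidAlgebra.lift ℤ R B (f : B →* R)).toRingHom.comp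
        (MonoidAlgebra.mapRingHom B (Nat.castRingHom ℤ))) := by
    refine MonoidAlgebra.ringHom_ext (fun r ↦ ?_) (fun b ↦ ?_)
    · have hr : (MonoidAlgebra.single (1 : B) r) = (r : MonoidAlgebra ℕ B) := by
        rw [MonoidAlgebra.natCast_def]; simp
      rw [hr, map_natCast, map_natCast]
    · refine (AmbientSemiring.lift_of f b).trans ?_
      simp
  exact DFunLike.congr_fun this x

/-- The universal property of the universal ring. -/
def lift {R : Type*} [CommRing R] (f : B →*₀ R)
    (hf : ∀ x ∈ Band.nullSet (B := B), AmbientSemiring.lift f x = 0) : UniversalRing B →+* R :=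
  Ideal.Quotient.lift _ (MonoidAlgebra.lift ℤ R B (f : B →* R)).toRingHom (by
    intro a ha
    refine (Ideal.span_le (I := RingHom.ker _)).2 ?_ ha
    rintro _ ⟨x, hx, rfl⟩
    exact (lift_mk f x).symm.trans (hf _ hx))

@[simp]
theorem lift_apply_of {R : Type*} [CommRing R] (f : B →*₀ R)
    (hf : ∀ x ∈ Band.nullSet (B := B), AmbientSemiring.lift f x = 0) (b : B) :
    lift f hf (of B b) = f b := by
  refine (Ideal.Quotient.lift_mk ..).trans ?_
  simp

/-- Null sums vanish in the universal ring. -/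
theorem lift_ofHom_eq_zero (x : AmbientSemiring B) (hx : x ∈ Band.nullSet (B := B)) :
    AmbientSemiring.lift (ofHom B) x = 0 := by
  obtain ⟨x, rfl⟩ : ∃ y, AmbientSemiring.mk y = x := Quotient.exists_rep x
  rw [lift_mk]
  let q : MonoidAlgebra ℤ B →+* UniversalRing B := Ideal.Quotient.mk _
  have h : ∀ y, MonoidAlgebra.lift ℤ (UniversalRing B) B (ofHom B : B →* UniversalRing B) y =
      q y := by
    intro y
    have : (MonoidAlgebra.lift ℤ (UniversalRing B) B
        (ofHom B : B →* UniversalRing B)).toRingHom = q := by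
      refine MonoidAlgebra.ringHom_ext (fun r ↦ ?_) (fun b ↦ ?_)
      · have hr : (MonoidAlgebra.single (1 : B) r) = (r : MonoidAlgebra ℤ B) := by
          rw [MonoidAlgebra.intCast_def]; simp
        rw [hr, map_intCast, map_intCast]
      · simp
        rfl
    exact DFunLike.congr_fun this y
  rw [h]
  exact Ideal.Quotient.eq_zero_iff_mem.2 (Ideal.subset_span ⟨x, hx, rfl⟩)

/-- The converse of the hypothesis of `lift`: evaluation through `g` factors through the evaluation
in the universal ring, where null sums are already zero. -/
theorem lift_comp_eq_zero {R : Type*} [CommRing R] (g : UniversalRing B →+* R)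
    (x : AmbientSemiring B) (hx : x ∈ Band.nullSet (B := B)) :
    AmbientSemiring.lift (g.toMonoidWithZeroHom.comp (ofHom B)) x = 0 := by
  have : AmbientSemiring.lift (g.toMonoidWithZeroHom.comp (ofHom B)) =
      g.comp (AmbientSemiring.lift (ofHom B)) :=
    AmbientSemiring.hom_ext fun b ↦ by simp
  rw [this, RingHom.comp_apply, lift_ofHom_eq_zero x hx, map_zero]

/-- A ring homomorphism on the universal ring that inverts a multiplicative subset of the band
extends to the universal ring of the localization. -/
def localizationLift {S : Submonoid B} {R : Type*} [CommRing R] (g : UniversalRing B →+* R)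
    (hg : ∀ s : S, IsUnit (g (of B s))) : UniversalRing (Localization S) →+* R :=
  lift ((Localization.monoidOf S).lift₀ (g.toMonoidWithZeroHom.comp (ofHom B)) hg) (by
    intro x hx
    -- The null set of `S⁻¹B` is generated by the images of null sums of `B`, so only these need to
    -- be killed; on them the extended map is `g`.
    refine (Ideal.span_le (I := RingHom.ker (AmbientSemiring.lift
      ((Localization.monoidOf S).lift₀ (g.toMonoidWithZeroHom.comp (ofHom B)) hg)))).2 ?_ hx
    rintro _ ⟨y, hy, rfl⟩
    change AmbientSemiring.lift _ (AmbientSemiring.map (Band.localizationMap₀ S) y) = 0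
    rw [← RingHom.comp_apply, AmbientSemiring.lift_comp_map]
    have e : ((Localization.monoidOf S).lift₀
        (g.toMonoidWithZeroHom.comp (ofHom B)) hg).comp
          (Band.localizationMap₀ S) = g.toMonoidWithZeroHom.comp (ofHom B) :=
      MonoidWithZeroHom.ext fun b ↦ (Localization.monoidOf S).lift_eq hg b
    rw [e]
    exact lift_comp_eq_zero g y hy)

@[simp]
theorem localizationLift_of_mk_one {S : Submonoid B} {R : Type*} [CommRing R]
    (g : UniversalRing B →+* R) (hg : ∀ s : S, IsUnit (g (of B s))) (b : B) :
    localizationLift g hg (of _ (Localization.mk b 1)) = g (of B b) :=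
  (lift_apply_of _ _ _).trans ((Localization.monoidOf S).lift_eq hg b)

theorem isUnit_of_mk {S : Submonoid B} (s : S) :
    IsUnit (of (Localization S) (Localization.mk s 1)) := by
  refine IsUnit.map (ofHom (Localization S)) (IsUnit.of_mul_eq_one (Localization.mk 1 s) ?_)
  rw [Localization.mk_mul, mul_one, one_mul]
  exact Localization.mk_self s

theorem of_mk_mul {S : Submonoid B} (b : B) (s : S) :
    of (Localization S) (Localization.mk b s) * of (Localization S) (Localization.mk s 1) =
      of (Localization S) (Localization.mk b 1) := by
  rw [← of_mul, Localization.mk_mul]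
  congr 1
  rw [Localization.mk_eq_mk_iff, Localization.r_iff_exists]
  exact ⟨1, by simp [mul_comm]⟩

/-- The product of `[b/s]` with the unit `[s/1]` is `[b/1]`, so the values on the classes `[b/1]`
determine all others. -/
theorem localization_hom_ext {S : Submonoid B} {R : Type*} [CommRing R]
    {f g : UniversalRing (Localization S) →+* R}
    (h : ∀ b, f (of _ (Localization.mk b 1)) = g (of _ (Localization.mk b 1))) : f = g := by
  refine hom_ext fun x ↦ ?_
  induction x using Localization.induction_on with | _ x
  obtain ⟨a, s⟩ := x
  have h1 := h a
  rw [← of_mk_mul a s, map_mul, map_mul, h] at h1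
  exact ((isUnit_of_mk s).map g).mul_right_cancel h1

/-- Each of the two rings maps to the other by its own universal property: `β` comes from
`localizationLift`, `α` from the ring localization. The composites are identities because they fix
the classes of elements of `B`. -/
theorem isLocalization_away (h : B) :
    letI := (map (Band.localizationMap (Submonoid.powers h))).toAlgebra
    IsLocalization.Away (of B h) (UniversalRing (Localization (Submonoid.powers h))) := by
  let := (map (Band.localizationMap (Submonoid.powers h))).toAlgebra
  let A := Localization.Away (of B h)
  have hu : ∀ s : Submonoid.powers h, IsUnit (algebraMap (UniversalRing B) A (of B s)) := by
    rintro ⟨_, n, rfl⟩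
    have : of B (h ^ n) = of B h ^ n := map_pow (ofHom B) h n
    dsimp only
    rw [this, map_pow]
    exact (IsLocalization.Away.algebraMap_isUnit (S := A) (of B h)).pow n
  have hv : IsUnit (map (Band.localizationMap (Submonoid.powers h)) (of B h)) := by
    rw [map_of]
    exact isUnit_of_mk (⟨h, Submonoid.mem_powers h⟩ : Submonoid.powers h)
  let β : UniversalRing (Localization (Submonoid.powers h)) →+* A :=
    localizationLift (algebraMap (UniversalRing B) A) hu
  let α : A →+* UniversalRing (Localization (Submonoid.powers h)) :=
    IsLocalization.Away.lift (of B h) hv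
  have hα : ∀ r, α (algebraMap _ A r) = map (Band.localizationMap (Submonoid.powers h)) r :=
    fun r ↦ IsLocalization.Away.lift_eq (of B h) hv r
  have hβ : ∀ b, β (map (Band.localizationMap (Submonoid.powers h)) (of B b)) =
      algebraMap _ A (of B b) := fun b ↦ by
    rw [map_of]
    exact localizationLift_of_mk_one _ hu b
  have h1 : α.comp β = RingHom.id _ := localization_hom_ext fun b ↦ by
    have := hβ b
    rw [map_of] at this
    change α (β (of _ (Band.localizationMap (Submonoid.powers h) b))) = _
    rw [this, hα, map_of]
    rfl
  have h2 : β.comp α = RingHom.id _ := by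
    refine IsLocalization.ringHom_ext (Submonoid.powers (of B h)) (hom_ext fun b ↦ ?_)
    change β (α (algebraMap _ A (of B b))) = _
    rw [hα, hβ]
    rfl
  let e : A ≃ₐ[UniversalRing B] UniversalRing (Localization (Submonoid.powers h)) :=
    AlgEquiv.ofRingEquiv (f := RingEquiv.ofRingHom α β h1 h2) hα
  exact IsLocalization.isLocalization_of_algEquiv _ e

end UniversalRing

/-! ### Rings as bands, and the adjunction. -/

/-- The band associated with a ring: a formal sum is null iff its sum in the ring is zero. -/
@[reducible]
def Band.ofRing (R : Type u) [CommRing R] : Band R where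
  nullSet := RingHom.ker (AmbientSemiring.lift (MonoidWithZeroHom.id R))
  existsUnique_neg a := ⟨-a, by simp [RingHom.mem_ker], fun b hb ↦ by
    simp only [RingHom.mem_ker, map_add, AmbientSemiring.lift_of] at hb
    exact eq_neg_of_add_eq_zero_right hb⟩

section ofRing

attribute [local instance] Band.ofRing

/-- The band morphism to a ring that corresponds to a ring homomorphism on the universal ring. -/
def UniversalRing.toBandHom {B R : Type u} [Band B] [CommRing R] (f : UniversalRing B →+* R) :
    BandHom B R where
  toMonoidWithZeroHom := f.toMonoidWithZeroHom.comp (UniversalRing.ofHom B)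
  map_nullSet x hx :=
    (DFunLike.congr_fun (AmbientSemiring.lift_comp_map (MonoidWithZeroHom.id R)
      (f.toMonoidWithZeroHom.comp (UniversalRing.ofHom B))) x).trans
      (UniversalRing.lift_comp_eq_zero f x hx)

/-- The ring homomorphism on the universal ring that corresponds to a band morphism to a ring. -/
def UniversalRing.ofBandHom {B R : Type u} [Band B] [CommRing R] (g : BandHom B R) :
    UniversalRing B →+* R :=
  UniversalRing.lift g.toMonoidWithZeroHom fun x hx ↦
    (DFunLike.congr_fun (AmbientSemiring.lift_comp_map (MonoidWithZeroHom.id R)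
      g.toMonoidWithZeroHom) x).symm.trans (g.map_nullSet x hx)

theorem UniversalRing.ofBandHom_of {B R : Type u} [Band B] [CommRing R] (g : BandHom B R)
    (b : B) : UniversalRing.ofBandHom g (UniversalRing.of B b) = g b :=
  UniversalRing.lift_apply_of _ _ b

namespace BandCat

/-- The band associated with a ring, as an object of the category of bands. -/
def ofRing (R : CommRingCat.{u}) : BandCat.{u} := BandCat.of R

/-- Ring homomorphisms from the universal ring are the same as band morphisms to the ring. -/
def homEquivOfRing (B : BandCat.{u}) (R : CommRingCat.{u}) :
    (universalRing.obj B ⟶ R) ≃ (B ⟶ ofRing R) where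
  toFun f := UniversalRing.toBandHom (B := B) (R := R) f.hom
  invFun g := CommRingCat.ofHom (UniversalRing.ofBandHom (B := B) (R := R) g)
  left_inv f := CommRingCat.hom_ext (UniversalRing.hom_ext fun b ↦
    UniversalRing.ofBandHom_of (UniversalRing.toBandHom (B := B) (R := R) f.hom) b)
  right_inv g := BandHom.ext (B := B) (C := R) (UniversalRing.ofBandHom_of (B := B) (R := R) g)

end BandCat

end ofRing

/-- The universal ring functor is a left adjoint. -/
instance : universalRing.{u}.IsLeftAdjoint :=
  (Adjunction.adjunctionOfEquivRight (F := universalRing.{u}) BandCat.homEquivOfRing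
    fun X' X Y f g ↦
      letI := Band.ofRing Y
      BandHom.ext (B := X') (C := Y) fun b ↦
        congrArg g.hom (UniversalRing.map_of (B := X') (C := X) f b)).isLeftAdjoint

end

/-! ### Local morphisms from schemes to band spaces. -/

noncomputable section

namespace BandSpace

/-- The underlying topological space of a band space. -/
abbrev pt (X : BandSpace.{u}) : TopCat.{u} := X.toSheafedSpace.carrier

/-- The band of sections over an open subset. -/
abbrev O (X : BandSpace.{u}) (V : Opens X.pt) : BandCat.{u} := X.toSheafedSpace.presheaf.obj (op V)

/-- The restriction of sections. -/
def res (X : BandSpace.{u}) {V W : Opens X.pt} (h : W ≤ V) : BandHom (X.O V) (X.O W) :=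
  X.toSheafedSpace.presheaf.map (homOfLE h).op

/-- The germ of a section. -/
def germ (X : BandSpace.{u}) (V : Opens X.pt) (x : X.pt) (hx : x ∈ V) :
    BandHom (X.O V) (X.toSheafedSpace.presheaf.stalk x) :=
  X.toSheafedSpace.presheaf.germ V x hx

theorem germ_res (X : BandSpace.{u}) {V W : Opens X.pt} (h : W ≤ V) (x : X.pt) (hx : x ∈ W)
    (s : X.O V) : X.germ W x hx (X.res h s) = X.germ V x (h hx) s :=
  ConcreteCategory.congr_hom (X.toSheafedSpace.presheaf.germ_res (homOfLE h) x hx) s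

theorem res_res (X : BandSpace.{u}) {U V W : Opens X.pt} (h : V ≤ U) (h' : W ≤ V) (s : X.O U) :
    X.res h' (X.res h s) = X.res (h'.trans h) s :=
  (ConcreteCategory.congr_hom (X.toSheafedSpace.presheaf.map_comp (homOfLE h).op
    (homOfLE h').op) s).symm

theorem res_self (X : BandSpace.{u}) {U : Opens X.pt} (h : U ≤ U) (s : X.O U) :
    X.res h s = s :=
  ConcreteCategory.congr_hom (X.toSheafedSpace.presheaf.map_id (op U)) s

variable {X Y Z : BandSpace.{u}}

/-- The underlying continuous map of a morphism of band spaces. -/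
abbrev Hom.base (g : X ⟶ Y) : X.pt ⟶ Y.pt := (BandSpace.Hom.toHom g).hom.base

/-- The inverse image of an open subset. -/
abbrev Hom.preimage (g : X ⟶ Y) (V : Opens Y.pt) : Opens X.pt := (Opens.map (Hom.base g)).obj V

/-- The pullback of sections. -/
def Hom.app (g : X ⟶ Y) (V : Opens Y.pt) : BandHom (Y.O V) (X.O (Hom.preimage g V)) :=
  (BandSpace.Hom.toHom g).hom.c.app (op V)

theorem Hom.app_res (g : X ⟶ Y) {V W : Opens Y.pt} (h : W ≤ V) (s : Y.O V) :
    Hom.app g W (Y.res h s) =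
      X.res (show Hom.preimage g W ≤ Hom.preimage g V from fun _ hx ↦ h hx) (Hom.app g V s) :=
  ConcreteCategory.congr_hom ((BandSpace.Hom.toHom g).hom.c.naturality (homOfLE h).op) s

/-- This is locality of the stalk map in contrapositive form, stated for germs of sections so that
stalks of `Y` never have to be mentioned in the data of a `LocHom`. -/
theorem Hom.isUnit_germ (g : X ⟶ Y) (V : Opens Y.pt) (x : X.pt)
    (hx : Hom.base g x ∈ V) (s : Y.O V)
    (h : IsUnit (X.germ (Hom.preimage g V) x hx (Hom.app g V s))) :
    IsUnit (Y.germ V (Hom.base g x) hx s) := by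
  by_contra hn
  refine (BandSpace.Hom.isLocal g) x _ hn ?_
  have e : (BandSpace.Hom.toHom g).hom.stalkMap x (Y.germ V (Hom.base g x) hx s) =
      X.germ (Hom.preimage g V) x hx (Hom.app g V s) :=
    ConcreteCategory.congr_hom
      (AlgebraicGeometry.PresheafedSpace.stalkMap_germ (BandSpace.Hom.toHom g).hom V x hx) s
  rw [e]
  exact h

end BandSpace

open AlgebraicGeometry UniversalRing

/-- A local morphism from a scheme `S` to a band space `X`, i.e. a continuous map together with
local maps from the sections of `X` to the stalks of `S` that send sections to sections. -/
structure LocHom (S : Scheme.{u}) (X : BandSpace.{u}) where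
  base : S → X.pt
  continuous : Continuous base
  -- A ring homomorphism out of the universal ring encodes multiplicativity and the vanishing of
  -- null sums in a single datum. Values are taken in stalks, with `coherent` requiring them to come
  -- locally from sections; this makes composition and gluing pointwise constructions.
  γ : ∀ (x : S) (V : Opens X.pt), base x ∈ V → (UniversalRing (X.O V) →+* S.presheaf.stalk x)
  γ_res : ∀ (x : S) (V W : Opens X.pt) (h : W ≤ V) (hx : base x ∈ W) (s : X.O V),
    γ x W hx (of _ (X.res h s)) = γ x V (h hx) (of _ s)
  isLocal : ∀ (x : S) (V : Opens X.pt) (hx : base x ∈ V) (s : X.O V),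
    IsUnit (γ x V hx (of _ s)) → IsUnit (X.germ V (base x) hx s)
  coherent : ∀ (V : Opens X.pt) (s : X.O V) (x : S), base x ∈ V → ∃ W : S.Opens, x ∈ W ∧
    ∃ t : Γ(S, W), ∀ (y : S) (hy : y ∈ W), ∃ hy' : base y ∈ V,
      S.presheaf.germ W y hy t = γ y V hy' (of _ s)

namespace LocHom

variable {S S' S'' : Scheme.{u}} {X Y Z : BandSpace.{u}}

/-- The two membership proofs are separate because they concern different base maps, which are
identified only inside the proof. -/
theorem ext {ξ η : LocHom S X} (hb : ∀ x, ξ.base x = η.base x)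
    (h : ∀ x V hx hx' s, ξ.γ x V hx (of _ s) = η.γ x V hx' (of _ s)) : ξ = η := by
  obtain ⟨b, c, γ, _, _, _⟩ := ξ
  obtain ⟨b', c', γ', _, _, _⟩ := η
  obtain rfl : b = b' := funext hb
  obtain rfl : γ = γ' := by
    funext x V hx
    exact UniversalRing.hom_ext fun s ↦ h x V hx hx s
  rfl

/-- Restriction to a smaller neighbourhood of the image point does not change the value of `γ`, and
units are sent to units. -/
theorem isUnit_iff (ξ : LocHom S X) (x : S) (V : Opens X.pt) (hx : ξ.base x ∈ V) (s : X.O V)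
    {W : Opens X.pt} (hW : ξ.base x ∈ W) (h : W ≤ V) (hu : IsUnit (X.res h s)) :
    IsUnit (ξ.γ x V hx (of _ s)) := by
  rw [← ξ.γ_res x V W h hW]
  exact (hu.map (ofHom _)).map _

/-- The inverse image of an open subset. -/
def preimage (ξ : LocHom S X) (V : Opens X.pt) : S.Opens :=
  ⟨ξ.base ⁻¹' V, V.2.preimage ξ.continuous⟩

/-- Composition with a morphism of schemes. -/
def precomp (h : S' ⟶ S) (ξ : LocHom S X) : LocHom S' X where
  base x := ξ.base (h x)
  continuous := ξ.continuous.comp h.continuous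
  γ x V hx := (h.stalkMap x).hom.comp (ξ.γ (h x) V hx)
  γ_res x V W hW hx s := congrArg (h.stalkMap x).hom (ξ.γ_res (h x) V W hW hx s)
  isLocal x V hx s hs := ξ.isLocal (h x) V hx s (isUnit_of_map_unit (h.stalkMap x).hom _ hs)
  coherent V s x hx := by
    obtain ⟨W, hxW, t, ht⟩ := ξ.coherent V s (h x) hx
    refine ⟨h ⁻¹ᵁ W, hxW, h.app W t, fun y hy ↦ ?_⟩
    obtain ⟨hy', e⟩ := ht (h y) hy
    refine ⟨hy', ?_⟩
    rw [RingHom.comp_apply, ← e]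
    exact (Scheme.Hom.germ_stalkMap_apply h W y hy t).symm

/-- Composition with a morphism of band spaces. -/
def postcomp (ξ : LocHom S X) (g : X ⟶ Y) : LocHom S Y where
  base x := BandSpace.Hom.base g (ξ.base x)
  continuous := (BandSpace.Hom.base g).hom.continuous.comp ξ.continuous
  γ x V hx := (ξ.γ x (BandSpace.Hom.preimage g V) hx).comp
    (UniversalRing.map (BandSpace.Hom.app g V))
  γ_res x V W hW hx s := by
    rw [RingHom.comp_apply, RingHom.comp_apply, map_of, map_of, BandSpace.Hom.app_res]
    exact ξ.γ_res x (BandSpace.Hom.preimage g V) (BandSpace.Hom.preimage g W) _ hx _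
  isLocal x V hx s hs := by
    rw [RingHom.comp_apply, map_of] at hs
    exact BandSpace.Hom.isUnit_germ g V _ hx s (ξ.isLocal x _ hx _ hs)
  coherent V s x hx := by
    obtain ⟨W, hxW, t, ht⟩ := ξ.coherent _ (BandSpace.Hom.app g V s) x hx
    refine ⟨W, hxW, t, fun y hy ↦ ?_⟩
    obtain ⟨hy', e⟩ := ht y hy
    exact ⟨hy', by rw [RingHom.comp_apply, map_of, e]⟩

theorem precomp_γ (h : S' ⟶ S) (ξ : LocHom S X) (x : S') (V hx s) :
    (precomp h ξ).γ x V hx (of _ s) = (h.stalkMap x).hom (ξ.γ (h x) V hx (of _ s)) := rfl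

theorem postcomp_γ (ξ : LocHom S X) (g : X ⟶ Y) (x : S) (V hx s) :
    (postcomp ξ g).γ x V hx (of _ s) =
      ξ.γ x (BandSpace.Hom.preimage g V) hx (of _ (BandSpace.Hom.app g V s)) :=
  congrArg (ξ.γ x (BandSpace.Hom.preimage g V) hx) (map_of (BandSpace.Hom.app g V) s)

theorem precomp_id (ξ : LocHom S X) : precomp (𝟙 S) ξ = ξ :=
  ext (fun _ ↦ rfl) fun x V hx _ s ↦ by
    rw [precomp_γ, Scheme.Hom.stalkMap_id]
    rfl

theorem precomp_comp (h' : S'' ⟶ S') (h : S' ⟶ S) (ξ : LocHom S X) :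
    precomp (h' ≫ h) ξ = precomp h' (precomp h ξ) :=
  ext (fun _ ↦ rfl) fun x V hx _ s ↦
    DFunLike.congr_fun (CommRingCat.hom_ext_iff.1 (Scheme.Hom.stalkMap_comp h' h x))
      (ξ.γ (h (h' x)) V hx (of _ s))

theorem postcomp_id (ξ : LocHom S X) : postcomp ξ (𝟙 X) = ξ :=
  ext (fun _ ↦ rfl) fun x V hx _ s ↦ by
    rw [postcomp_γ]
    rfl

theorem postcomp_comp (ξ : LocHom S X) (g : X ⟶ Y) (g' : Y ⟶ Z) :
    postcomp ξ (g ≫ g') = postcomp (postcomp ξ g) g' :=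
  ext (fun _ ↦ rfl) fun x V hx hx' s ↦
    (postcomp_γ ξ (g ≫ g') x V hx s).trans ((postcomp_γ (postcomp ξ g) g' x V hx' s).trans
      (postcomp_γ ξ g x (BandSpace.Hom.preimage g' V) hx' (BandSpace.Hom.app g' V s))).symm

theorem postcomp_precomp (h : S' ⟶ S) (ξ : LocHom S X) (g : X ⟶ Y) :
    postcomp (precomp h ξ) g = precomp h (postcomp ξ g) :=
  ext (fun _ ↦ rfl) fun x V hx hx' s ↦
    (postcomp_γ (precomp h ξ) g x V hx s).trans
      (congrArg (h.stalkMap x).hom (postcomp_γ ξ g (h x) V hx' s).symm)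

end LocHom

/-- The functor of local morphisms from schemes to band spaces. -/
def locHomFunctor : BandSpace.{u} ⥤ Scheme.{u}ᵒᵖ ⥤ Type u where
  obj X :=
    { obj := fun S ↦ LocHom S.unop X
      map := fun h ↦ ↾ (fun ξ ↦ LocHom.precomp h.unop ξ)
      map_id := fun S ↦ by
        ext ξ
        exact LocHom.precomp_id ξ
      map_comp := fun h h' ↦ by
        ext ξ
        exact LocHom.precomp_comp h'.unop h.unop ξ }
  map g :=
    { app := fun S ↦ ↾ (fun ξ ↦ LocHom.postcomp ξ g)
      naturality := fun S S' h ↦ by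
        ext ξ
        exact LocHom.postcomp_precomp h.unop ξ g }
  map_id X := by
    ext S ξ
    exact LocHom.postcomp_id ξ
  map_comp g g' := by
    ext S ξ
    exact LocHom.postcomp_comp ξ g g'

end

/-! ### Local morphisms to the spectrum of a band. -/

noncomputable section

open AlgebraicGeometry UniversalRing

/-- A family of elements of the stalks of a scheme that is locally given by sections is given by a
global section. -/
theorem exists_section_of_germs (S : Scheme.{u}) (e : ∀ x : S, S.presheaf.stalk x)
    (he : ∀ x : S, ∃ W : S.Opens, x ∈ W ∧ ∃ t : Γ(S, W), ∀ (y : S) (hy : y ∈ W),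
      S.presheaf.germ W y hy t = e y) :
    ∃ t : Γ(S, ⊤), ∀ x : S, S.presheaf.germ ⊤ x trivial t = e x := by
  choose W hW t ht using he
  obtain ⟨s, hs, -⟩ := TopCat.Sheaf.existsUnique_gluing' S.sheaf W ⊤ (fun i ↦ homOfLE le_top)
    (fun x _ ↦ Opens.mem_iSup.2 ⟨x, hW x⟩) t (fun i j ↦
      TopCat.Presheaf.section_ext S.sheaf _ _ _ fun y hy ↦ by
        refine (S.presheaf.germ_res_apply _ y hy _).trans
          (.trans ?_ (S.presheaf.germ_res_apply _ y hy _).symm)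
        exact (ht i y hy.1).trans (ht j y hy.2).symm)
  refine ⟨s, fun x ↦ ?_⟩
  rw [← ht x x (hW x), ← hs x]
  exact (S.presheaf.germ_res_apply (homOfLE le_top) x (hW x) s).symm

theorem section_ext_top {S : Scheme.{u}} {s t : Γ(S, ⊤)}
    (h : ∀ x : S, S.presheaf.germ ⊤ x trivial s = S.presheaf.germ ⊤ x trivial t) : s = t :=
  TopCat.Presheaf.section_ext S.sheaf _ _ _ fun x _ ↦ h x

namespace PrimeMIdeal

variable {B : Type u} [Band B]

theorem ext_carrier {p q : PrimeMIdeal B} (h : p.carrier = q.carrier) : p = q := by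
  obtain ⟨⟨p, _, _⟩, _, _⟩ := p
  obtain ⟨⟨q, _, _⟩, _, _⟩ := q
  dsimp only at h
  subst h
  rfl

/-- `stalkToLocal` preserves units, and its left inverse `localToStalk` carries them back. -/
theorem isUnit_germ_iff (p : PrimeMIdeal B) (U : Opens (top B)) (hp : p ∈ U)
    (s : Sections (B := B) U) : IsUnit (germ p U hp s) ↔ IsUnit (s.1 ⟨p, hp⟩) := by
  constructor
  · intro h
    rw [← stalkToLocal_germ]
    exact h.map _
  · intro h
    rw [← localToStalk_stalkToLocal p (germ p U hp s), stalkToLocal_germ]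
    exact h.map _

theorem isUnit_germ_fromBand_iff (p : PrimeMIdeal B) (U : Opens (top B)) (hp : p ∈ U) (b : B) :
    IsUnit (germ p U hp (Sections.fromBand U b)) ↔ b ∉ p.carrier := by
  rw [isUnit_germ_iff]
  exact isUnit_mk_iff b 1

end PrimeMIdeal

namespace LocHom

variable {S S' : Scheme.{u}} {B : Type u} [Band B]

/-- The spectrum of a band as a band space. -/
abbrev specOf (B : Type u) [Band B] : BandSpace.{u} := BandSpace.spec.obj (op (BandCat.of B))

section ofRingHom

variable (ψ : UniversalRing B →+* Γ(S, ⊤))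

/-- The composition of a ring homomorphism to the global sections with the germ map. -/
def germHom (x : S) : UniversalRing B →+* S.presheaf.stalk x :=
  (S.presheaf.germ ⊤ x trivial).hom.comp ψ

/-- The prime `m`-ideal of elements that are not invertible at a given point. -/
def idealAt (x : S) : PrimeMIdeal B where
  carrier := {b | ¬ IsUnit (germHom ψ x (of B b))}
  zero_mem := by
    rw [Set.mem_ofPred_eq, of_zero, map_zero]
    exact not_isUnit_zero
  mul_mem a b hb h := by
    rw [of_mul, map_mul] at h
    exact hb (isUnit_of_mul_isUnit_right h)
  one_mem_compl := by simp
  mul_mem_compl {a b} ha hb := by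
    simp only [Set.mem_compl_iff, Set.mem_ofPred_eq, not_not] at ha hb ⊢
    rw [of_mul, map_mul]
    exact ha.mul hb

theorem notMem_idealAt (x : S) (b : B) :
    b ∉ (idealAt ψ x).carrier ↔ IsUnit (germHom ψ x (of B b)) := not_not

/-- The condition `b ∉ idealAt ψ x` says that the germ of `ψ [b]` at `x` is invertible, which is an
open condition. This gives continuity on the generating open subsets. -/
theorem preimage_idealAt (b : B) :
    idealAt ψ ⁻¹' PrimeMIdeal.basicOpen b = S.basicOpen (ψ (of B b)) := by
  ext x
  exact (notMem_idealAt ψ x b).trans (S.mem_basicOpen_top (ψ (of B b)) x).symm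

theorem continuous_idealAt : Continuous (idealAt ψ) := by
  refine continuous_generateFrom_iff.2 ?_
  rintro _ ⟨b, rfl⟩
  rw [preimage_idealAt]
  exact (S.basicOpen (ψ (of B b))).2

/-- The map from the local band to the stalk. -/
def localAt (x : S) : UniversalRing (idealAt ψ x).Local →+* S.presheaf.stalk x :=
  UniversalRing.localizationLift (germHom ψ x) fun s ↦ (notMem_idealAt ψ x s).1 s.2

theorem localAt_mk_one (x : S) (b : B) :
    localAt ψ x (of _ (Localization.mk b 1)) = germHom ψ x (of B b) :=
  localizationLift_of_mk_one _ _ _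

theorem localAt_mk (x : S) (b : B) (s : (idealAt ψ x).primeCompl) :
    localAt ψ x (of _ (Localization.mk b s)) * germHom ψ x (of B s) = germHom ψ x (of B b) := by
  rw [← localAt_mk_one, ← localAt_mk_one, ← map_mul, of_mk_mul]

/-- `localAt` is local by the choice of the ideal: if `b/s` has invertible image, so does `b`, and
then `b` lies outside `idealAt ψ x`. -/
theorem isUnit_of_isUnit_localAt (x : S) (c : (idealAt ψ x).Local)
    (h : IsUnit (localAt ψ x (of _ c))) : IsUnit c := by
  induction c using Localization.induction_on with | _ c
  obtain ⟨b, s⟩ := c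
  rw [PrimeMIdeal.isUnit_mk_iff, notMem_idealAt, ← localAt_mk ψ x b s]
  exact h.mul ((notMem_idealAt ψ x s).1 s.2)

/-- The map from the sections of the structure sheaf to the stalk. -/
def sectionsAt (x : S) (V : Opens (PrimeMIdeal B)) (hx : idealAt ψ x ∈ V) :
    UniversalRing (PrimeMIdeal.Sections V) →+* S.presheaf.stalk x :=
  (localAt ψ x).comp (UniversalRing.map (PrimeMIdeal.Sections.eval ⟨idealAt ψ x, hx⟩))

theorem sectionsAt_of (x : S) (V : Opens (PrimeMIdeal B)) (hx : idealAt ψ x ∈ V)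
    (s : PrimeMIdeal.Sections V) :
    sectionsAt ψ x V hx (of _ s) = localAt ψ x (of _ (s.1 ⟨idealAt ψ x, hx⟩)) :=
  congrArg (localAt ψ x) (map_of (PrimeMIdeal.Sections.eval ⟨idealAt ψ x, hx⟩) s)

/-- The local morphism to the spectrum of a band that corresponds to a ring homomorphism. -/
def ofRingHom : LocHom S (specOf B) where
  base := idealAt ψ
  continuous := continuous_idealAt ψ
  γ x V hx := sectionsAt ψ x V hx
  γ_res x V W h hx s := (sectionsAt_of ψ x W hx _).trans (sectionsAt_of ψ x V (h hx) s).symm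
  isLocal x V hx s h := (PrimeMIdeal.isUnit_germ_iff _ V hx s).2
    (isUnit_of_isUnit_localAt ψ x _ ((sectionsAt_of ψ x V hx s) ▸ h))
  coherent V s x hx := by
    -- Where `s` is the fraction `a / f`, the germs of `ψ [f]` are units, so `ψ [f]` has an inverse
    -- `v` on the preimage `W`. The section wanted is `ψ [a] * v`, and its germs are compared after
    -- multiplication with the germ of `ψ [f]`.
    obtain ⟨V', hV', hle, a, f, h⟩ := s.2 ⟨idealAt ψ x, hx⟩
    let W : S.Opens := ⟨idealAt ψ ⁻¹' V', V'.2.preimage (continuous_idealAt ψ)⟩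
    have hW : W ≤ S.basicOpen (ψ (of B f)) := fun y hy ↦ by
      obtain ⟨hf, -⟩ := h ⟨idealAt ψ y, hy⟩
      exact (S.mem_basicOpen_top _ y).2 ((notMem_idealAt ψ y f).1 hf)
    have hu : IsUnit (S.presheaf.map (homOfLE (le_top : W ≤ ⊤)).op (ψ (of B f))) := by
      have h1 := (RingedSpace.isUnit_res_basicOpen S.toRingedSpace (ψ (of B f))).map
        (S.presheaf.map (homOfLE hW).op).hom
      have h2 := ConcreteCategory.congr_hom (S.presheaf.map_comp
        (homOfLE (S.basicOpen_le (ψ (of B f)))).op (homOfLE hW).op) (ψ (of B f))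
      rw [← op_comp, homOfLE_comp] at h2
      exact h2 ▸ h1
    obtain ⟨v, hv⟩ := hu.exists_left_inv
    refine ⟨W, hV', S.presheaf.map (homOfLE (le_top : W ≤ ⊤)).op (ψ (of B a)) * v,
      fun y hy ↦ ⟨hle hy, ?_⟩⟩
    obtain ⟨hf, e⟩ := h ⟨idealAt ψ y, hy⟩
    refine Eq.trans ?_ (sectionsAt_of ψ y V (hle hy) s).symm
    have e' := localAt_mk ψ y a ⟨f, hf⟩
    rw [← e] at e'
    refine ((notMem_idealAt ψ y f).1 hf).mul_right_cancel ?_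
    rw [e']
    have g1 : ∀ c, S.presheaf.germ W y hy (S.presheaf.map (homOfLE (le_top : W ≤ ⊤)).op
        (ψ (of B c))) = germHom ψ y (of B c) := fun c ↦
      S.presheaf.germ_res_apply (homOfLE (le_top : W ≤ ⊤)) y hy _
    rw [← g1, ← g1, ← map_mul, mul_assoc, hv, mul_one]

theorem ofRingHom_γ (x : S) (V hx) (s : PrimeMIdeal.Sections (B := B) V) :
    (ofRingHom ψ).γ x V hx (of _ s) = localAt ψ x (of _ (s.1 ⟨idealAt ψ x, hx⟩)) :=
  sectionsAt_of ψ x V hx s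

end ofRingHom

section toRingHom

variable (ξ : LocHom S (specOf B))

/-- The germs of the pullbacks of elements of the band. -/
def stalkHom (x : S) : UniversalRing B →+* S.presheaf.stalk x :=
  (ξ.γ x ⊤ trivial).comp (UniversalRing.map (PrimeMIdeal.Sections.fromBand ⊤))

theorem stalkHom_of (x : S) (b : B) : stalkHom ξ x (of B b) =
    ξ.γ x ⊤ trivial (of _ (PrimeMIdeal.Sections.fromBand ⊤ b)) :=
  congrArg (ξ.γ x ⊤ trivial) (map_of (PrimeMIdeal.Sections.fromBand ⊤) b)

/-- The field `coherent` provides local sections with the prescribed germs, and these glue. -/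
theorem exists_global (b : B) : ∃ t : Γ(S, ⊤), ∀ x : S,
    S.presheaf.germ ⊤ x trivial t = stalkHom ξ x (of B b) := by
  refine exists_section_of_germs S _ fun x ↦ ?_
  obtain ⟨W, hW, t, ht⟩ := ξ.coherent ⊤ (PrimeMIdeal.Sections.fromBand ⊤ b) x trivial
  refine ⟨W, hW, t, fun y hy ↦ ?_⟩
  obtain ⟨_, e⟩ := ht y hy
  rw [stalkHom_of]
  exact e

/-- The global section that is the pullback of an element of the band. -/
def global (b : B) : Γ(S, ⊤) := (exists_global ξ b).choose

theorem germ_global (b : B) (x : S) :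
    S.presheaf.germ ⊤ x trivial (global ξ b) = stalkHom ξ x (of B b) :=
  (exists_global ξ b).choose_spec x

/-- The pullback of elements of the band as a morphism of pointed monoids. -/
def globalHom : B →*₀ Γ(S, ⊤) where
  toFun := global ξ
  map_zero' := section_ext_top fun x ↦ by rw [germ_global, of_zero, map_zero, map_zero]
  map_one' := section_ext_top fun x ↦ by rw [germ_global, of_one, map_one, map_one]
  map_mul' a b := section_ext_top fun x ↦ by
    rw [germ_global, of_mul, map_mul, map_mul, germ_global, germ_global]

/-- The ring homomorphism that corresponds to a local morphism to the spectrum of a band. -/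
def toRingHom : UniversalRing B →+* Γ(S, ⊤) :=
  lift (globalHom ξ) fun y hy ↦ section_ext_top fun x ↦ by
    -- The image of a null sum vanishes in every stalk, since there the evaluation factors through
    -- the universal ring.
    have h : (S.presheaf.germ ⊤ x trivial).hom.comp (AmbientSemiring.lift (globalHom ξ)) =
        AmbientSemiring.lift ((stalkHom ξ x).toMonoidWithZeroHom.comp (ofHom B)) := by
      refine AmbientSemiring.hom_ext fun b ↦ ?_
      rw [RingHom.comp_apply, AmbientSemiring.lift_of, AmbientSemiring.lift_of]
      exact germ_global ξ b x
    refine (DFunLike.congr_fun h y).trans ?_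
    rw [lift_comp_eq_zero _ y hy, map_zero]

theorem toRingHom_of (b : B) : toRingHom ξ (of B b) = global ξ b := lift_apply_of _ _ b

theorem germHom_toRingHom (x : S) : germHom (toRingHom ξ) x = stalkHom ξ x :=
  UniversalRing.hom_ext fun b ↦ by
    rw [germHom, RingHom.comp_apply, toRingHom_of]
    exact germ_global ξ b x

end toRingHom

/-- The image of a point as a prime `m`-ideal. -/
abbrev point (ξ : LocHom S (specOf B)) (x : S) : PrimeMIdeal B := ξ.base x

/-- The image point is recovered from the stalk maps. If `b` does not vanish there, it is invertible
on the principal open subset of `b`, hence so is its value; the converse is the locality of `ξ`. -/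
theorem notMem_point_iff (ξ : LocHom S (specOf B)) (x : S) (b : B) :
    b ∉ (point ξ x).carrier ↔ IsUnit (stalkHom ξ x (of B b)) := by
  rw [stalkHom_of]
  constructor
  · intro h
    let V : Opens (PrimeMIdeal B) := ⟨PrimeMIdeal.basicOpen b, PrimeMIdeal.isOpen_basicOpen b⟩
    refine isUnit_iff ξ x ⊤ trivial _ (W := V) h le_top
      (IsUnit.of_mul_eq_one (PrimeMIdeal.Sections.const 1 b (fun q hq ↦ hq) :
        PrimeMIdeal.Sections (B := B) V) (PrimeMIdeal.Sections.ext fun q ↦ ?_))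
    change Localization.mk b 1 * Localization.mk 1 _ = 1
    rw [Localization.mk_mul, mul_one, one_mul]
    exact Localization.mk_self (⟨b, q.2⟩ : q.1.primeCompl)
  · intro h
    exact (PrimeMIdeal.isUnit_germ_fromBand_iff (ξ.base x) ⊤ trivial b).1 (ξ.isLocal x ⊤ _ _ h)

/-- The base maps agree by `notMem_point_iff`. A section is locally a fraction `a / f` and `f` goes
to a unit in the stalk, so the value of the section is determined by those of `a` and `f`. -/
theorem spec_ext {ξ η : LocHom S (specOf B)}
    (h : ∀ x b, stalkHom ξ x (of B b) = stalkHom η x (of B b)) : ξ = η := by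
  have hb : ∀ x, point ξ x = point η x := fun x ↦ PrimeMIdeal.ext_carrier (by
    ext b
    rw [← not_iff_not]
    refine (notMem_point_iff ξ x b).trans (.trans ?_ (notMem_point_iff η x b).symm)
    rw [h])
  refine LocHom.ext hb fun x V hx hx' (s : PrimeMIdeal.Sections (B := B) V) ↦ ?_
  obtain ⟨V', hV', hle, a, f, e⟩ := s.2 ⟨ξ.base x, hx⟩
  have hle' : V' ≤ (⊤ : Opens (PrimeMIdeal B)) := le_top
  have e' : (PrimeMIdeal.Sections.res hle s) *
      (PrimeMIdeal.Sections.res hle' (PrimeMIdeal.Sections.fromBand ⊤ f)) =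
      PrimeMIdeal.Sections.res hle' (PrimeMIdeal.Sections.fromBand ⊤ a) := by
    refine PrimeMIdeal.Sections.ext fun q ↦ ?_
    obtain ⟨hf, e'⟩ := e q
    change s.1 ⟨q.1, hle q.2⟩ * Localization.mk f 1 = Localization.mk a 1
    rw [e', Localization.mk_mul, mul_one, Localization.mk_eq_mk_iff, Localization.r_iff_exists]
    exact ⟨1, by simp [mul_comm]⟩
  have key : ∀ (ζ : LocHom S (specOf B)) (hζ : point ζ x ∈ V'),
      ζ.γ x V (hle hζ) (of _ s) * stalkHom ζ x (of B f) = stalkHom ζ x (of B a) := by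
    intro ζ hζ
    have r : ∀ c, ζ.γ x V' hζ (of _ (PrimeMIdeal.Sections.res hle'
        (PrimeMIdeal.Sections.fromBand ⊤ c))) = stalkHom ζ x (of B c) := fun c ↦
      (ζ.γ_res x ⊤ V' hle' hζ _).trans (stalkHom_of ζ x c).symm
    rw [← r, ← r, ← e']
    refine (congrArg (· * _) (ζ.γ_res x V V' hle hζ s).symm).trans
      ((map_mul (ζ.γ x V' hζ) _ _).symm.trans (congrArg (ζ.γ x V' hζ) ?_))
    exact (of_mul _ _).symm
  have hf : IsUnit (stalkHom ξ x (of B f)) := by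
    obtain ⟨hf, -⟩ := e ⟨ξ.base x, hV'⟩
    exact (notMem_point_iff ξ x f).1 hf
  have hη : point η x ∈ V' := (hb x) ▸ hV'
  refine hf.mul_right_cancel ((key ξ hV').trans ?_)
  rw [h, h]
  exact (key η hη).symm

/-- Local morphisms to the spectrum of a band are the same as ring homomorphisms from its universal
ring to the global sections. -/
def specEquiv : LocHom S (specOf B) ≃ (UniversalRing B →+* Γ(S, ⊤)) where
  toFun := toRingHom
  invFun := ofRingHom
  left_inv ξ := spec_ext fun x b ↦ by
    rw [stalkHom_of]
    refine (ofRingHom_γ _ _ _ _ _).trans ((localAt_mk_one (toRingHom ξ) x b).trans ?_)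
    rw [germHom_toRingHom]
  right_inv ψ := UniversalRing.hom_ext fun b ↦ section_ext_top fun x ↦ by
    rw [toRingHom_of, germ_global, stalkHom_of]
    exact (ofRingHom_γ _ _ _ _ _).trans (localAt_mk_one ψ x b)

theorem toRingHom_precomp (h : S' ⟶ S) (ξ : LocHom S (specOf B)) :
    toRingHom (precomp h ξ) = h.appTop.hom.comp (toRingHom ξ) :=
  UniversalRing.hom_ext fun b ↦ section_ext_top fun x ↦ by
    rw [toRingHom_of, germ_global, RingHom.comp_apply, toRingHom_of, stalkHom_of]
    refine (congrArg (h.stalkMap x).hom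
      ((germ_global ξ b (h x)).trans (stalkHom_of ξ (h x) b)).symm).trans ?_
    exact Scheme.Hom.germ_stalkMap_apply h ⊤ x trivial _

theorem toRingHom_postcomp {B C : BandCat.{u}} (f : B ⟶ C)
    (ξ : LocHom S (BandSpace.spec.obj (op C))) :
    toRingHom (B := B) (postcomp ξ (BandSpace.spec.map f.op)) =
      (toRingHom (B := C) ξ).comp (UniversalRing.map (B := B) (C := C) f) :=
  UniversalRing.hom_ext fun b ↦ section_ext_top fun x ↦ by
    rw [toRingHom_of, germ_global, RingHom.comp_apply, map_of, toRingHom_of, germ_global,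
      stalkHom_of, stalkHom_of]
    refine (postcomp_γ ξ _ x ⊤ trivial _).trans (congrArg (ξ.γ x ⊤ trivial)
      (congrArg (of _) (PrimeMIdeal.Sections.ext fun q ↦ ?_)))
    exact Band.localizationLift_mk _ _ b

end LocHom

end

/-! ### Zariski descent for local morphisms. -/

noncomputable section

open AlgebraicGeometry UniversalRing

/-- This moves a section from a chart to its open image without changing germs; it is used for the
coherence of glued morphisms. -/
theorem germ_appIso_inv {S' S : Scheme.{u}} (f : S' ⟶ S) [IsOpenImmersion f] (W : S'.Opens)
    (t : Γ(S', W)) (y : S') (hy : y ∈ W) (hy' : f y ∈ f ''ᵁ W) :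
    (f.stalkMap y).hom (S.presheaf.germ (f ''ᵁ W) (f y) hy' ((f.appIso W).inv t)) =
      S'.presheaf.germ W y hy t := by
  refine (Scheme.Hom.germ_stalkMap_apply f (f ''ᵁ W) y hy' _).trans ?_
  have h := ConcreteCategory.congr_hom (f.appIso_inv_app W) t
  rw [ConcreteCategory.comp_apply] at h
  rw [h]
  exact S'.presheaf.germ_res_apply _ y hy' t

/-- Specialization maps between equal points serve as the transport of stalks in the gluing below.
-/
theorem isUnit_stalkSpecializes {S : Scheme.{u}} {x y : S} (h : x = y) (a : S.presheaf.stalk y) :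
    IsUnit ((S.presheaf.stalkSpecializes (specializes_of_eq h)).hom a) ↔ IsUnit a := by
  subst h
  rw [TopCat.Presheaf.stalkSpecializes_refl]
  rfl

namespace LocHom

variable {S : Scheme.{u}} {X : BandSpace.{u}}

theorem γ_of_eq {ξ η : LocHom S X} (h : ξ = η) (x : S) (V : Opens X.pt) (hx : ξ.base x ∈ V)
    (hx' : η.base x ∈ V) (s : X.O V) : ξ.γ x V hx (of _ s) = η.γ x V hx' (of _ s) := by
  subst h
  rfl

variable (𝓤 : S.OpenCover) (ξ : ∀ i, LocHom (𝓤.X i) X)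

/-- The maps to the stalks of `S` of a family of local morphisms on an open cover. -/
def stalkOn (i : 𝓤.I₀) (y : 𝓤.X i) (V : Opens X.pt) (hy : (ξ i).base y ∈ V) :
    UniversalRing (X.O V) →+* S.presheaf.stalk (𝓤.f i y) :=
  (inv ((𝓤.f i).stalkMap y)).hom.comp ((ξ i).γ y V hy)

theorem stalkMap_stalkOn (i : 𝓤.I₀) (y : 𝓤.X i) (V : Opens X.pt) (hy : (ξ i).base y ∈ V)
    (r) : ((𝓤.f i).stalkMap y).hom (stalkOn 𝓤 ξ i y V hy r) = (ξ i).γ y V hy r :=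
  ConcreteCategory.congr_hom (IsIso.inv_hom_id ((𝓤.f i).stalkMap y)) ((ξ i).γ y V hy r)

variable {ξ} (hξ : ∀ i j, precomp (pullback.fst (𝓤.f i) (𝓤.f j)) (ξ i) =
  precomp (pullback.snd (𝓤.f i) (𝓤.f j)) (ξ j))

include hξ

/-- A pair of points with the same image comes from a point of the fibre product of the charts,
where `hξ` applies. -/
theorem base_eq_of_cover (i j : 𝓤.I₀) (y : 𝓤.X i) (z : 𝓤.X j) (h : 𝓤.f i y = 𝓤.f j z) :
    (ξ i).base y = (ξ j).base z := by
  obtain ⟨w, rfl, rfl⟩ := Scheme.Pullback.exists_preimage_pullback y z h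
  exact congrArg (fun ζ : LocHom _ X ↦ ζ.base w) (hξ i j)

/-- The stalk map from `S` to the fibre product of the two charts is an isomorphism, so the equality
may be tested at a point `w` of the fibre product over `y` and `z`; there it is the compatibility
`hξ`. -/
theorem stalkOn_eq (i j : 𝓤.I₀) (y : 𝓤.X i) (z : 𝓤.X j) (h : 𝓤.f i y = 𝓤.f j z)
    (V : Opens X.pt) (hy : (ξ i).base y ∈ V) (hz : (ξ j).base z ∈ V) (s : X.O V) :
    (S.presheaf.stalkSpecializes (specializes_of_eq h.symm)).hom
      (stalkOn 𝓤 ξ i y V hy (of _ s)) = stalkOn 𝓤 ξ j z V hz (of _ s) := by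
  obtain ⟨w, rfl, rfl⟩ := Scheme.Pullback.exists_preimage_pullback y z h
  let p := pullback.fst (𝓤.f i) (𝓤.f j)
  let q := pullback.snd (𝓤.f i) (𝓤.f j)
  have hinj : Function.Injective ((q ≫ 𝓤.f j).stalkMap w).hom :=
    ((ConcreteCategory.isIso_iff_bijective _).1
      (inferInstance : IsIso ((q ≫ 𝓤.f j).stalkMap w))).1
  apply hinj
  have e1 : ((q ≫ 𝓤.f j).stalkMap w).hom (stalkOn 𝓤 ξ j (q w) V hz (of _ s)) =
      (q.stalkMap w).hom ((ξ j).γ (q w) V hz (of _ s)) :=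
    (ConcreteCategory.congr_hom (Scheme.Hom.stalkMap_comp q (𝓤.f j) w) _).trans
      (congrArg (q.stalkMap w).hom (stalkMap_stalkOn 𝓤 ξ j (q w) V hz _))
  have e2 : ((p ≫ 𝓤.f i).stalkMap w).hom (stalkOn 𝓤 ξ i (p w) V hy (of _ s)) =
      (p.stalkMap w).hom ((ξ i).γ (p w) V hy (of _ s)) :=
    (ConcreteCategory.congr_hom (Scheme.Hom.stalkMap_comp p (𝓤.f i) w) _).trans
      (congrArg (p.stalkMap w).hom (stalkMap_stalkOn 𝓤 ξ i (p w) V hy _))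
  have e3 : (p.stalkMap w).hom ((ξ i).γ (p w) V hy (of _ s)) =
      (q.stalkMap w).hom ((ξ j).γ (q w) V hz (of _ s)) :=
    γ_of_eq (hξ i j) w V hy hz s
  have e4 := ConcreteCategory.congr_hom (Scheme.Hom.stalkMap_congr_hom (p ≫ 𝓤.f i) (q ≫ 𝓤.f j)
    pullback.condition w) (stalkOn 𝓤 ξ i (p w) V hy (of _ s))
  exact e4.symm.trans (e2.trans (e3.trans e1.symm))

omit hξ in
theorem exists_idx (x : S) : ∃ (i : 𝓤.I₀) (y : 𝓤.X i), 𝓤.f i y = x :=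
  ⟨𝓤.idx x, 𝓤.covers x⟩

/-- The chart that contains a given point. -/
def chart (x : S) : 𝓤.I₀ := (exists_idx 𝓤 x).choose

/-- The preimage of a given point in its chart. -/
def chartPoint (x : S) : 𝓤.X (chart 𝓤 x) := (exists_idx 𝓤 x).choose_spec.choose

omit hξ in
theorem chart_spec (x : S) : 𝓤.f (chart 𝓤 x) (chartPoint 𝓤 x) = x :=
  (exists_idx 𝓤 x).choose_spec.choose_spec

/-- The glued map to the stalks. -/
def glueγ (ξ : ∀ i, LocHom (𝓤.X i) X) (x : S) (V : Opens X.pt)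
    (hx : (ξ (chart 𝓤 x)).base (chartPoint 𝓤 x) ∈ V) :
    UniversalRing (X.O V) →+* S.presheaf.stalk x :=
  (S.presheaf.stalkSpecializes (specializes_of_eq (chart_spec 𝓤 x).symm)).hom.comp
    (stalkOn 𝓤 ξ _ (chartPoint 𝓤 x) V hx)

/-- The glued map is defined with a chosen chart at each point; by `stalkOn_eq` it can be computed
in any other chart. -/
theorem glueγ_of (i : 𝓤.I₀) (y : 𝓤.X i) (V : Opens X.pt) (hx) (hy : (ξ i).base y ∈ V)
    (s : X.O V) :
    glueγ 𝓤 ξ (𝓤.f i y) V hx (of _ s) = stalkOn 𝓤 ξ i y V hy (of _ s) :=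
  stalkOn_eq 𝓤 hξ _ i _ y (chart_spec 𝓤 (𝓤.f i y)) V hx hy s

/-- The gluing of local morphisms on an open cover. -/
def glue : LocHom S X where
  base x := (ξ (chart 𝓤 x)).base (chartPoint 𝓤 x)
  continuous := by
    refine continuous_iff_continuousAt.2 fun x ↦ ?_
    obtain ⟨i, y, rfl⟩ := exists_idx 𝓤 x
    rw [← (𝓤.f i).isOpenEmbedding.continuousAt_iff]
    have : (fun x ↦ (ξ (chart 𝓤 x)).base (chartPoint 𝓤 x)) ∘ 𝓤.f i = (ξ i).base :=
      funext fun z ↦ base_eq_of_cover 𝓤 hξ _ i _ z (chart_spec 𝓤 (𝓤.f i z))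
    rw [this]
    exact (ξ i).continuous.continuousAt
  γ := glueγ 𝓤 ξ
  γ_res x V W h hx s := congrArg
    (S.presheaf.stalkSpecializes (specializes_of_eq (chart_spec 𝓤 x).symm)).hom
    (congrArg (inv ((𝓤.f (chart 𝓤 x)).stalkMap (chartPoint 𝓤 x))).hom
      ((ξ (chart 𝓤 x)).γ_res (chartPoint 𝓤 x) V W h hx s))
  isLocal x V hx s h := by
    have h1 := (isUnit_stalkSpecializes (chart_spec 𝓤 x).symm _).1 h
    refine (ξ (chart 𝓤 x)).isLocal _ V hx s ?_
    rw [← stalkMap_stalkOn]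
    exact h1.map _
  coherent V s x hx := by
    obtain ⟨i, y, rfl⟩ := exists_idx 𝓤 x
    have hb := fun z ↦ base_eq_of_cover 𝓤 hξ _ i _ z (chart_spec 𝓤 (𝓤.f i z))
    obtain ⟨W, hyW, t, ht⟩ := (ξ i).coherent V s y (hb y ▸ hx)
    refine ⟨𝓤.f i ''ᵁ W, ⟨y, hyW, rfl⟩, ((𝓤.f i).appIso W).inv t, ?_⟩
    rintro _ ⟨z, hz, rfl⟩
    obtain ⟨hz', e⟩ := ht z hz
    refine ⟨(hb z).symm ▸ hz', ?_⟩
    refine Eq.trans ?_ (glueγ_of 𝓤 hξ i z V _ hz' s).symm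
    have hinj : Function.Injective ((𝓤.f i).stalkMap z).hom :=
      ((ConcreteCategory.isIso_iff_bijective _).1
        (inferInstance : IsIso ((𝓤.f i).stalkMap z))).1
    apply hinj
    exact (germ_appIso_inv (𝓤.f i) W t z hz _).trans
      (e.trans (stalkMap_stalkOn 𝓤 ξ i z V hz' _).symm)

theorem precomp_glue (i : 𝓤.I₀) : precomp (𝓤.f i) (glue 𝓤 hξ) = ξ i :=
  LocHom.ext (fun y ↦ base_eq_of_cover 𝓤 hξ _ i _ y (chart_spec 𝓤 (𝓤.f i y)))
    fun y V hy hy' s ↦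
      (congrArg ((𝓤.f i).stalkMap y).hom (glueγ_of 𝓤 hξ i y V hy hy' s)).trans
        (stalkMap_stalkOn 𝓤 ξ i y V hy' _)

omit hξ in
theorem cover_ext {ζ ζ' : LocHom S X} (h : ∀ i, precomp (𝓤.f i) ζ = precomp (𝓤.f i) ζ') :
    ζ = ζ' := by
  refine LocHom.ext (fun x ↦ ?_) (fun x V hx hx' s ↦ ?_)
  · obtain ⟨i, y, rfl⟩ := exists_idx 𝓤 x
    exact congrArg (fun ζ : LocHom _ X ↦ ζ.base y) (h i)
  · obtain ⟨i, y, rfl⟩ := exists_idx 𝓤 x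
    have hinj : Function.Injective ((𝓤.f i).stalkMap y).hom :=
      ((ConcreteCategory.isIso_iff_bijective _).1
        (inferInstance : IsIso ((𝓤.f i).stalkMap y))).1
    exact hinj (γ_of_eq (h i) y V hx hx' s)

end LocHom

/-- Local morphisms to a band space form a sheaf for the Zariski topology. -/
theorem isSheaf_locHomFunctor (X : BandSpace.{u}) :
    Presheaf.IsSheaf Scheme.zariskiTopology.{u} (locHomFunctor.obj X) := by
  rw [isSheaf_iff_isSheaf_of_type]
  -- The sheaf condition needs to be checked only on open covers, because these are stable under
  -- base change.
  refine (Precoverage.isSheaf_toGrothendieck_iff_of_isStableUnderBaseChange _).2 ?_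
  rintro S R hR x hx
  obtain ⟨(𝓤 : Scheme.OpenCover S), rfl⟩ := Scheme.exists_cover_of_mem_pretopology hR
  have hξ : ∀ i j, LocHom.precomp (pullback.fst (𝓤.f i) (𝓤.f j)) (x (𝓤.f i) (.mk i)) =
      LocHom.precomp (pullback.snd (𝓤.f i) (𝓤.f j)) (x (𝓤.f j) (.mk j)) := fun i j ↦
    hx (pullback.fst (𝓤.f i) (𝓤.f j)) (pullback.snd (𝓤.f i) (𝓤.f j)) (.mk i) (.mk j)
      pullback.condition
  refine ⟨LocHom.glue 𝓤 (ξ := fun i ↦ x (𝓤.f i) (.mk i)) hξ, ?_, ?_⟩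
  · rintro Y f ⟨i⟩
    exact LocHom.precomp_glue 𝓤 (ξ := fun i ↦ x (𝓤.f i) (.mk i)) hξ i
  · intro ζ hζ
    refine LocHom.cover_ext 𝓤 fun i ↦ ?_
    exact (hζ (𝓤.f i) (.mk i)).trans
      (LocHom.precomp_glue 𝓤 (ξ := fun i ↦ x (𝓤.f i) (.mk i)) hξ i).symm

end

/-! ### Open immersions of band spaces and lifting along them. -/

noncomputable section

open AlgebraicGeometry UniversalRing

namespace BandSpace

variable {X Y Z : BandSpace.{u}}

/-- An open immersion of band spaces. -/
abbrev IsOpenImm (g : X ⟶ Y) : Prop := SheafedSpace.IsOpenImmersion (BandSpace.Hom.toHom g)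

theorem isLocal_of_isOpenImmersion {X Y : SheafedSpace.{u + 1, u, u} BandCat.{u}}
    (f : X ⟶ Y) [SheafedSpace.IsOpenImmersion f] (x : X) (a : Y.presheaf.stalk (f.hom.base x))
    (ha : ¬ IsUnit a) : ¬ IsUnit (f.hom.stalkMap x a) := by
  intro h
  have hi : IsIso (f.hom.stalkMap x) := SheafedSpace.IsOpenImmersion.stalk_iso f x
  let g : BandHom _ _ := inv (f.hom.stalkMap x)
  have hg : g (f.hom.stalkMap x a) = a :=
    ConcreteCategory.congr_hom (IsIso.hom_inv_id (f.hom.stalkMap x)) a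
  exact ha (hg ▸ h.map g)

/-- An open immersion of sheafed spaces as a morphism of band spaces. -/
def homOfOpenImm (f : X.toSheafedSpace ⟶ Y.toSheafedSpace) [SheafedSpace.IsOpenImmersion f] :
    X ⟶ Y :=
  ⟨f, isLocal_of_isOpenImmersion f⟩

section

variable (g : X ⟶ Y) [hg : IsOpenImm g]

theorem isOpenEmbedding_base : Topology.IsOpenEmbedding (Hom.base g) := hg.base_open

/-- The image of an open subset under an open immersion. -/
def image (V : Opens X.pt) : Opens Y.pt := hg.base_open.functor.obj V

theorem mem_image (V : Opens X.pt) (x : X.pt) : Hom.base g x ∈ image g V ↔ x ∈ V :=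
  (isOpenEmbedding_base g).injective.mem_set_image

theorem image_mono {V W : Opens X.pt} (h : W ≤ V) : image g W ≤ image g V :=
  Set.image_mono h

/-- The transport of sections along an open immersion. -/
def push (V : Opens X.pt) : BandHom (X.O V) (Y.O (image g V)) :=
  SheafedSpace.IsOpenImmersion.invApp (BandSpace.Hom.toHom g) V

theorem push_res {V W : Opens X.pt} (h : W ≤ V) (s : X.O V) :
    push g W (X.res h s) = Y.res (image_mono g h) (push g V s) :=
  ConcreteCategory.congr_hom (SheafedSpace.IsOpenImmersion.inv_naturality
    (BandSpace.Hom.toHom g) (homOfLE h).op) s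

theorem preimage_image (V : Opens X.pt) : Hom.preimage g (image g V) = V :=
  Opens.ext (Set.preimage_image_eq _ (isOpenEmbedding_base g).injective)

theorem image_preimage_le (V : Opens Y.pt) : image g (Hom.preimage g V) ≤ V :=
  Set.image_preimage_subset _ _

theorem app_push (V : Opens X.pt) (s : X.O V) :
    Hom.app g (image g V) (push g V s) = X.res (preimage_image g V).le s :=
  ConcreteCategory.congr_hom (SheafedSpace.IsOpenImmersion.invApp_app
    (BandSpace.Hom.toHom g) V) s

theorem push_app (V : Opens Y.pt) (s : Y.O V) :
    push g (Hom.preimage g V) (Hom.app g V s) = Y.res (image_preimage_le g V) s :=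
  ConcreteCategory.congr_hom (SheafedSpace.IsOpenImmersion.app_invApp
    (BandSpace.Hom.toHom g) V) s

/-- The stalk map of `g` sends the germ of `push g V s` to the germ of `s`. The point `y` is kept
apart from `Hom.base g x` because a lifted point maps to the original one only up to a proof. -/
theorem isUnit_germ_of_push (V : Opens X.pt) (x : X.pt) (hx : x ∈ V) (y : Y.pt)
    (h : Hom.base g x = y) (hy : y ∈ image g V) (s : X.O V)
    (hu : IsUnit (Y.germ (image g V) y hy (push g V s))) : IsUnit (X.germ V x hx s) := by
  subst h
  have e : (BandSpace.Hom.toHom g).hom.stalkMap x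
      (Y.germ (image g V) (Hom.base g x) hy (push g V s)) =
      X.germ (Hom.preimage g (image g V)) x hy (Hom.app g (image g V) (push g V s)) :=
    ConcreteCategory.congr_hom (PresheafedSpace.stalkMap_germ (BandSpace.Hom.toHom g).hom
      (image g V) x hy) (push g V s)
  rw [app_push] at e
  rw [← e.trans (X.germ_res (preimage_image g V).le x hy s)]
  let t : BandHom _ _ := (BandSpace.Hom.toHom g).hom.stalkMap x
  exact hu.map t

end

end BandSpace

open BandSpace

namespace LocHom

variable {S : Scheme.{u}} {X Y : BandSpace.{u}} (g : X ⟶ Y)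

/-- The preimage of a point under an open immersion. -/
def liftBase (ξ : LocHom S Y) (hξ : ∀ x, ξ.base x ∈ Set.range (Hom.base g)) (x : S) : X.pt :=
  (hξ x).choose

theorem base_liftBase (ξ : LocHom S Y) (hξ : ∀ x, ξ.base x ∈ Set.range (Hom.base g)) (x : S) :
    Hom.base g (liftBase g ξ hξ x) = ξ.base x := (hξ x).choose_spec

variable [IsOpenImm g]

theorem mem_image_of_liftBase {ξ : LocHom S Y} {hξ : ∀ x, ξ.base x ∈ Set.range (Hom.base g)} {x : S}
    {V : Opens X.pt} (h : liftBase g ξ hξ x ∈ V) : ξ.base x ∈ image g V :=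
  base_liftBase g ξ hξ x ▸ (mem_image g V _).2 h

/-- The lift of the maps to the stalks. -/
def liftγ (ξ : LocHom S Y) (hξ : ∀ x, ξ.base x ∈ Set.range (Hom.base g)) (x : S)
    (V : Opens X.pt) (hx : liftBase g ξ hξ x ∈ V) : UniversalRing (X.O V) →+* S.presheaf.stalk x :=
  (ξ.γ x (image g V) (mem_image_of_liftBase g hx)).comp (UniversalRing.map (push g V))

theorem liftγ_of (ξ : LocHom S Y) (hξ : ∀ x, ξ.base x ∈ Set.range (Hom.base g)) (x : S)
    (V : Opens X.pt) (hx : liftBase g ξ hξ x ∈ V) (s : X.O V) :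
    liftγ g ξ hξ x V hx (of _ s) =
      ξ.γ x (image g V) (mem_image_of_liftBase g hx) (of _ (push g V s)) :=
  congrArg (ξ.γ x (image g V) (mem_image_of_liftBase g hx)) (map_of (push g V) s)

/-- The lift of a local morphism along an open immersion. -/
def liftOpen (ξ : LocHom S Y) (hξ : ∀ x, ξ.base x ∈ Set.range (Hom.base g)) : LocHom S X where
  base := liftBase g ξ hξ
  continuous := by
    rw [(isOpenEmbedding_base g).isInducing.continuous_iff]
    have : Hom.base g ∘ liftBase g ξ hξ = ξ.base := funext (base_liftBase g ξ hξ)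
    rw [this]
    exact ξ.continuous
  γ := liftγ g ξ hξ
  γ_res x V W h hx s := by
    rw [liftγ_of, liftγ_of, push_res]
    exact ξ.γ_res x _ _ _ _ _
  isLocal x V hx s h := by
    rw [liftγ_of] at h
    exact isUnit_germ_of_push g V _ hx _ (base_liftBase g ξ hξ x) _ s (ξ.isLocal x _ _ _ h)
  coherent V s x hx := by
    obtain ⟨W, hW, t, ht⟩ := ξ.coherent (image g V) (push g V s) x (mem_image_of_liftBase g hx)
    refine ⟨W, hW, t, fun y hy ↦ ?_⟩
    obtain ⟨hy', e⟩ := ht y hy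
    rw [← base_liftBase g ξ hξ y, mem_image] at hy'
    exact ⟨hy', by rw [liftγ_of, e]⟩

theorem postcomp_liftOpen (ξ : LocHom S Y) (hξ : ∀ x, ξ.base x ∈ Set.range (Hom.base g)) :
    postcomp (liftOpen g ξ hξ) g = ξ :=
  LocHom.ext (base_liftBase g ξ hξ) fun x V hx hx' s ↦
    (postcomp_γ (liftOpen g ξ hξ) g x V hx s).trans ((liftγ_of g ξ hξ x _ hx _).trans (by
      rw [push_app]
      exact ξ.γ_res x _ _ _ _ _))

/-- Pushing a section forward along `g` and pulling it back is a restriction, so `ξ` can be read off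
from its composition with `g`. This makes composition with an open immersion injective. -/
theorem γ_eq_postcomp (ξ : LocHom S X) (x : S) (V : Opens X.pt) (hx : ξ.base x ∈ V) (s : X.O V) :
    ξ.γ x V hx (of _ s) =
      (postcomp ξ g).γ x (image g V) ((mem_image g V _).2 hx) (of _ (push g V s)) := by
  refine Eq.trans ?_ (postcomp_γ ξ g x (image g V) ((mem_image g V _).2 hx) _).symm
  rw [app_push]
  exact (ξ.γ_res x V (Hom.preimage g (image g V)) (preimage_image g V).le
    ((mem_image g V _).2 hx) s).symm

theorem postcomp_injective : Function.Injective fun ξ : LocHom S X ↦ postcomp ξ g := by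
  intro ξ η h
  replace h : postcomp ξ g = postcomp η g := h
  refine LocHom.ext (fun x ↦ (isOpenEmbedding_base g).injective
    (congrArg (fun ζ : LocHom S Y ↦ ζ.base x) h)) fun x V hx hx' s ↦ ?_
  rw [γ_eq_postcomp g, γ_eq_postcomp g]
  exact γ_of_eq h x _ _ _ _

end LocHom

namespace BandScheme

/-- The forgetful functor from band schemes to band spaces. -/
def forgetToBandSpace : BandScheme.{u} ⥤ BandSpace.{u} where
  obj X := X.toBandSpace
  map f := f.hom
  map_id _ := rfl
  map_comp _ _ := rfl

/-- Every point of a band scheme is contained in an affine open subscheme. -/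
theorem exists_affine (X : BandScheme.{u}) (x : X.toBandSpace.pt) :
    ∃ (B : BandCat.{u}) (i : Spec.obj (op B) ⟶ X), IsOpenImmersion i ∧
      x ∈ Set.range (Hom.base i.hom) := by
  obtain ⟨U, hx, B, ⟨e⟩⟩ := X.local_affine x
  have hr := SheafedSpace.IsOpenImmersion.ofRestrict X.toSheafedSpace U.isOpenEmbedding
  let r : X.toBandSpace.restrict U ⟶ X.toBandSpace :=
    ⟨X.toSheafedSpace.ofRestrict U.isOpenEmbedding, @isLocal_of_isOpenImmersion _ _ _ hr⟩
  have he : IsOpenImm e.inv :=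
    let e' : (spec.obj (op B)).toSheafedSpace ≅ (X.toBandSpace.restrict U).toSheafedSpace :=
      { hom := BandSpace.Hom.toHom e.inv
        inv := BandSpace.Hom.toHom e.hom
        hom_inv_id := congrArg BandSpace.Hom.toHom e.inv_hom_id
        inv_hom_id := congrArg BandSpace.Hom.toHom e.hom_inv_id }
    @SheafedSpace.IsOpenImmersion.of_isIso _ _ _ _ (BandSpace.Hom.toHom e.inv) e'.isIso_hom
  refine ⟨B, InducedCategory.homMk (e.inv ≫ r),
    @SheafedSpace.IsOpenImmersion.comp _ _ _ _ _ (BandSpace.Hom.toHom e.inv)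
      (BandSpace.Hom.toHom r) he hr, ?_⟩
  refine ⟨Hom.base e.hom ⟨x, hx⟩, ?_⟩
  have h1 : Hom.base (e.hom ≫ e.inv ≫ r) ⟨x, hx⟩ = x := by
    rw [Iso.hom_inv_id_assoc]
    rfl
  exact h1

end BandScheme

end

/-! ### Representability of the functor of points of a band scheme. -/

noncomputable section

open AlgebraicGeometry UniversalRing BandSpace

/-- The morphism to `Spec B⁺` corresponding to a local morphism to `Spec B`. -/
def LocHom.toSpec (S : Scheme.{u}) (B : BandCat.{u}) (ξ : LocHom S (spec.obj (op B))) :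
    S ⟶ AlgebraicGeometry.Spec (CommRingCat.of (UniversalRing B)) :=
  S.toSpecΓ ≫ AlgebraicGeometry.Spec.map
    (CommRingCat.ofHom (LocHom.toRingHom (S := S) (B := B) ξ))

/-- The map is the composite of `LocHom.specEquiv` with the adjunction between global sections and
spectra. -/
theorem LocHom.toSpec_bijective (S : Scheme.{u}) (B : BandCat.{u}) :
    Function.Bijective (LocHom.toSpec S B) := by
  let e : LocHom S (spec.obj (op B)) ≃
      (S ⟶ AlgebraicGeometry.Spec (CommRingCat.of (UniversalRing B))) :=
    (LocHom.specEquiv (S := S) (B := B)).trans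
      ((ConcreteCategory.homEquiv (C := CommRingCat.{u}) (X := CommRingCat.of (UniversalRing B))
        (Y := Γ(S, ⊤))).symm.trans
      (Quiver.Hom.opEquiv.trans (ΓSpec.adjunction.homEquiv S
        (op (CommRingCat.of (UniversalRing B))))))
  convert e.bijective using 1
  funext ξ
  exact (ΓSpec.adjunction.homEquiv_unit (X := S)
    (Y := op (CommRingCat.of (UniversalRing B)))
    (f := (CommRingCat.ofHom (LocHom.toRingHom (S := S) (B := B) ξ)).op)).symm

theorem LocHom.toSpec_precomp {S S' : Scheme.{u}} (h : S' ⟶ S) (B : BandCat.{u})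
    (ξ : LocHom S (spec.obj (op B))) :
    LocHom.toSpec S' B (LocHom.precomp h ξ) = h ≫ LocHom.toSpec S B ξ := by
  unfold LocHom.toSpec
  rw [← Category.assoc, Scheme.toSpecΓ_naturality, Category.assoc,
    ← AlgebraicGeometry.Spec.map_comp]
  congr 2
  refine CommRingCat.hom_ext ?_
  exact LocHom.toRingHom_precomp (B := B) h ξ

theorem LocHom.toSpec_postcomp {S : Scheme.{u}} {B C : BandCat.{u}} (f : B ⟶ C)
    (ξ : LocHom S (spec.obj (op C))) :
    LocHom.toSpec S B (LocHom.postcomp ξ (spec.map f.op)) =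
      LocHom.toSpec S C ξ ≫ AlgebraicGeometry.Spec.map (universalRing.map f) := by
  have h : CommRingCat.ofHom (LocHom.toRingHom (S := S) (B := B)
      (LocHom.postcomp ξ (spec.map f.op))) = universalRing.map f ≫
        CommRingCat.ofHom (LocHom.toRingHom (S := S) (B := C) ξ) :=
    CommRingCat.hom_ext (LocHom.toRingHom_postcomp f ξ)
  exact (congrArg (fun a ↦ S.toSpecΓ ≫ AlgebraicGeometry.Spec.map a) h).trans
    ((congrArg (S.toSpecΓ ≫ ·) (AlgebraicGeometry.Spec.map_comp _ _)).trans
      (Category.assoc _ _ _).symm)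

/-- The functor of points of a band scheme on schemes. -/
def BandScheme.points : BandScheme.{u} ⥤ Scheme.{u}ᵒᵖ ⥤ Type u :=
  BandScheme.forgetToBandSpace ⋙ locHomFunctor

/-- The functor of points of `Spec B` is represented by `Spec B⁺`. -/
def BandScheme.pointsSpecIso : BandScheme.Spec.{u} ⋙ BandScheme.points ≅
    (universalRing.op ⋙ Scheme.Spec) ⋙ yoneda :=
  NatIso.ofComponents (fun B ↦ NatIso.ofComponents
      (fun S ↦ (Equiv.ofBijective _ (LocHom.toSpec_bijective S.unop B.unop)).toIso)
      (fun {S S'} h ↦ by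
        ext ξ
        exact LocHom.toSpec_precomp h.unop B.unop ξ))
    (fun {C B} f ↦ by
      ext S ξ
      exact LocHom.toSpec_postcomp f.unop ξ)

/-- An open immersion of band spaces induces an open immersion of functors of points. -/
theorem BandSpace.presheaf_isOpenImmersion {X Y : BandSpace.{u}} (g : X ⟶ Y) [IsOpenImm g] :
    IsOpenImmersion.presheaf (locHomFunctor.map g) := by
  refine MorphismProperty.relative.of_exists fun S ζ ↦ ?_
  let ξ : LocHom S Y := yonedaEquiv ζ
  have hζ : ∀ (T : Schemeᵒᵖ) (h : T.unop ⟶ S), ζ.app T h = LocHom.precomp h ξ := fun T h ↦ by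
    have := ConcreteCategory.congr_hom (ζ.naturality h.op) (𝟙 S)
    refine Eq.trans (congrArg (ζ.app T) ?_) this
    exact (Category.comp_id h).symm
  -- The fibre product of `S` with `X` over `Y` is the open subscheme `U` of points that `ξ` sends
  -- into the image of `g`; its projection to `X` is the lift `η` of the restriction of `ξ`.
  let V : Opens Y.pt := ⟨Set.range (Hom.base g), (isOpenEmbedding_base g).isOpen_range⟩
  let U : S.Opens := ξ.preimage V
  have hU : ∀ x : U.toScheme, (LocHom.precomp U.ι ξ).base x ∈ Set.range (Hom.base g) :=
    fun x ↦ x.2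
  let η : LocHom U X := LocHom.liftOpen g (LocHom.precomp U.ι ξ) hU
  have hη : LocHom.postcomp η g = LocHom.precomp U.ι ξ := LocHom.postcomp_liftOpen g _ hU
  let ζ' : yoneda.obj U.toScheme ⟶ locHomFunctor.obj X := yonedaEquiv.symm η
  have hζ' : ∀ (T : Schemeᵒᵖ) (h : T.unop ⟶ U), ζ'.app T h = LocHom.precomp h η := fun T h ↦ rfl
  refine ⟨U, ζ', U.ι, IsPullback.of_forall_isPullback_app fun T ↦
    (Types.isPullback_iff _ _ _ _).2 ⟨?_, ?_, ?_⟩, inferInstance⟩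
  · ext h
    refine Eq.trans ?_ (hζ T (h ≫ U.ι)).symm
    refine (congrArg (fun a ↦ LocHom.postcomp a g) (hζ' T h)).trans ?_
    refine (LocHom.postcomp_precomp h η g).trans ?_
    rw [hη, LocHom.precomp_comp]
  · rintro h h' ⟨-, e⟩
    exact (cancel_mono U.ι).1 e
  · intro (α : LocHom T.unop X) (h : T.unop ⟶ S) e
    have e' : LocHom.postcomp α g = LocHom.precomp h ξ := e.trans (hζ T h)
    have hr : Set.range h ⊆ Set.range U.ι := by
      rintro _ ⟨x, rfl⟩
      rw [Scheme.Opens.range_ι]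
      change ξ.base (h x) ∈ Set.range (Hom.base g)
      exact ⟨α.base x, congrArg (fun a : LocHom T.unop Y ↦ a.base x) e'⟩
    refine ⟨IsOpenImmersion.lift U.ι h hr, ?_, IsOpenImmersion.lift_fac U.ι h hr⟩
    refine (hζ' T _).trans (LocHom.postcomp_injective g ?_)
    refine (LocHom.postcomp_precomp _ η g).trans ?_
    rw [hη, ← LocHom.precomp_comp, IsOpenImmersion.lift_fac]
    exact e'.symm

namespace BandScheme

/-- The functor of points of a band scheme is represented by a scheme. -/
theorem points_mem_essImage (X : BandScheme.{u}) : yoneda.essImage (points.obj X) := by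
  choose B i hi hx using exists_affine X
  obtain ⟨R, ⟨e⟩⟩ : ∃ R : X.toBandSpace.pt → Scheme.{u},
      Nonempty (∀ x, yoneda.obj (R x) ≅ points.obj (Spec.obj (op (B x)))) :=
    ⟨_, ⟨fun x ↦ (pointsSpecIso.app (op (B x))).symm⟩⟩
  let f : ∀ x : X.toBandSpace.pt, yoneda.obj (R x) ⟶ points.obj X := fun x ↦
    (e x).hom ≫ points.map (i x)
  have hf : ∀ x, AlgebraicGeometry.IsOpenImmersion.presheaf (f x) := fun x ↦ by
    have : IsOpenImm (i x).hom := hi x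
    exact (MorphismProperty.cancel_left_of_respectsIso _ _ _).2
      (BandSpace.presheaf_isOpenImmersion (i x).hom)
  have h1 : ∀ x, (e x).inv ≫ Sigma.ι (fun x ↦ yoneda.obj (R x)) x ≫ Limits.Sigma.desc f =
      points.map (i x) := fun x ↦ by
    rw [Sigma.ι_desc, Iso.inv_hom_id_assoc]
  -- A local morphism `ξ` from `S` lifts to the affine charts over the preimages of their images,
  -- and these preimages cover `S`.
  have hs : Presheaf.IsLocallySurjective Scheme.zariskiTopology (Limits.Sigma.desc f) := by
    refine ⟨fun {S} (ξ : LocHom S X.toBandSpace) ↦ ?_⟩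
    let V : X.toBandSpace.pt → Opens X.toBandSpace.pt := fun x ↦
      ⟨Set.range (Hom.base (i x).hom),
        (@isOpenEmbedding_base _ _ (i x).hom (hi x)).isOpen_range⟩
    let U : X.toBandSpace.pt → S.Opens := fun x ↦ ξ.preimage (V x)
    have hU : iSup U = ⊤ := by
      refine top_le_iff.1 fun s _ ↦ ?_
      exact Opens.mem_iSup.2 ⟨ξ.base s, hx (ξ.base s)⟩
    refine Scheme.mem_grothendieckTopology_iff.2 ⟨S.openCoverOfIsOpenCover U hU, ?_⟩
    rintro _ _ ⟨x⟩
    let x' : X.toBandSpace.pt := x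
    have hi' : IsOpenImm (i x').hom := hi x'
    let η : LocHom (U x') (spec.obj (op (B x'))) :=
      @LocHom.liftOpen _ _ _ (i x').hom hi' (LocHom.precomp (U x').ι ξ) fun y ↦ y.2
    have hη : LocHom.postcomp η (i x').hom = LocHom.precomp (U x').ι ξ :=
      @LocHom.postcomp_liftOpen _ _ _ (i x').hom hi' _ _
    refine ⟨(Sigma.ι (fun x ↦ yoneda.obj (R x)) x').app _
        ((e x').inv.app (op (U x').toScheme) η), ?_⟩
    have h2 := ConcreteCategory.congr_hom (congr_app (h1 x') (op (U x').toScheme)) η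
    exact h2.trans hη
  obtain ⟨Y, ⟨r⟩⟩ := Scheme.LocalRepresentability.isRepresentable
    (F := ⟨points.obj X, isSheaf_locHomFunctor X.toBandSpace⟩) hf
  exact ⟨Y, ⟨Functor.representableByEquiv r⟩⟩

/-- The extension of the universal ring functor to band schemes. -/
def toScheme : BandScheme.{u} ⥤ Scheme.{u} :=
  Functor.essImage.liftFunctor points yoneda points_mem_essImage

/-- The scheme associated to a band scheme represents its functor of points. -/
def toSchemeIso : toScheme.{u} ⋙ yoneda ≅ points :=
  Functor.essImage.liftFunctorCompIso points yoneda points_mem_essImage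

/-- The scheme associated to `Spec B` is `Spec B⁺`. -/
def specToSchemeIso : Spec.{u} ⋙ toScheme ≅ universalRing.op ⋙ Scheme.Spec :=
  (Yoneda.fullyFaithful.whiskeringRight _).preimageIso
    (Functor.associator _ _ _ ≪≫ Functor.isoWhiskerLeft Spec toSchemeIso ≪≫ pointsSpecIso)

end BandScheme

end

/-! ### Limits of bands, doubled points, and the geometry of presentations. -/

noncomputable section

open AlgebraicGeometry UniversalRing BandSpace

namespace BandCat

variable {J : Type u} [SmallCategory J] (F : J ⥤ BandCat.{u})

/-- The compatible families of a diagram of bands. -/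
def CompatibleFamily : Type u :=
  {x : ∀ j, F.obj j // ∀ ⦃i j : J⦄ (f : i ⟶ j), F.map f (x i) = x j}

namespace CompatibleFamily

variable {F}

theorem ext {x y : CompatibleFamily F} (h : ∀ j, x.1 j = y.1 j) : x = y := Subtype.ext (funext h)

instance : CommMonoidWithZero (CompatibleFamily F) where
  mul x y := ⟨fun j ↦ x.1 j * y.1 j, fun i j f ↦ by rw [map_mul, x.2, y.2]⟩
  one := ⟨fun j ↦ 1, fun i j f ↦ map_one _⟩
  zero := ⟨fun j ↦ 0, fun i j f ↦ map_zero _⟩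
  mul_assoc x y z := ext fun j ↦ mul_assoc _ _ _
  one_mul x := ext fun j ↦ one_mul _
  mul_one x := ext fun j ↦ mul_one _
  mul_comm x y := ext fun j ↦ mul_comm _ _
  zero_mul x := ext fun j ↦ zero_mul _
  mul_zero x := ext fun j ↦ mul_zero _

/-- The projections of compatible families, as morphisms of pointed monoids. -/
def proj₀ (j : J) : CompatibleFamily F →*₀ F.obj j where
  toFun x := x.1 j
  map_zero' := rfl
  map_one' := rfl
  map_mul' _ _ := rfl

instance : Band (CompatibleFamily F) :=
  Band.initial proj₀ (fun _ _ h ↦ ext h)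
    ⟨fun _ ↦ Band.neg 1, fun i j f ↦
      let t : BandHom (F.obj i) (F.obj j) := F.map f
      (BandHom.map_neg t 1).trans (congrArg Band.neg (map_one t))⟩ (fun _ ↦ rfl)

theorem mem_nullSet_iff (x : AmbientSemiring (CompatibleFamily F)) :
    x ∈ Band.nullSet (B := CompatibleFamily F) ↔
      ∀ j, AmbientSemiring.map (proj₀ j) x ∈ Band.nullSet (B := F.obj j) :=
  Submodule.mem_iInf _

/-- The projections of compatible families. -/
def proj (j : J) : BandHom (CompatibleFamily F) (F.obj j) where
  toMonoidWithZeroHom := proj₀ j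
  map_nullSet x hx := (mem_nullSet_iff x).1 hx j

/-- The component of a cone, as a band morphism. -/
abbrev coneApp (s : Cone F) (j : J) : BandHom s.pt (F.obj j) := s.π.app j

/-- The morphism to the compatible families induced by a cone. -/
def lift (s : Cone F) : BandHom s.pt (CompatibleFamily F) where
  toFun b := ⟨fun j ↦ s.π.app j b, fun i j f ↦ ConcreteCategory.congr_hom (s.w f) b⟩
  map_zero' := ext fun j ↦ map_zero (coneApp s j)
  map_one' := ext fun j ↦ map_one (coneApp s j)
  map_mul' a b := ext fun j ↦ map_mul (coneApp s j) a b
  map_nullSet x hx := (mem_nullSet_iff _).2 fun j ↦ by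
    rw [AmbientSemiring.map_map]
    exact (coneApp s j).map_nullSet x hx

end CompatibleFamily

/-- The cone of compatible families. -/
def limitCone : Cone F where
  pt := BandCat.of (CompatibleFamily F)
  π :=
    { app := fun j ↦ CompatibleFamily.proj j
      naturality := fun _ _ f ↦ BandCat.hom_ext fun x ↦ (x.2 f).symm }

/-- The cone of compatible families is a limit cone. -/
def limitConeIsLimit : IsLimit (limitCone F) where
  lift s := CompatibleFamily.lift s
  fac _ _ := rfl
  uniq _ _ h := BandCat.hom_ext fun b ↦ CompatibleFamily.ext fun j ↦
    ConcreteCategory.congr_hom (h j) b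

/-- Limits of bands are required for gluing sheafed spaces of bands. -/
instance : HasLimits BandCat.{u} :=
  ⟨fun _ _ ↦ ⟨fun F ↦ ⟨⟨limitCone F, limitConeIsLimit F⟩⟩⟩⟩

end BandCat

namespace AlgebraicGeometry.SheafedSpace

variable {C : Type (u + 1)} [Category.{u} C]

/-- The lift of a morphism along an open immersion. -/
def IsOpenImmersion.lift {X Y Z : SheafedSpace.{u + 1, u, u} C} (f : X ⟶ Z) (g : Y ⟶ Z)
    [H : SheafedSpace.IsOpenImmersion f] (h : Set.range g.hom.base ⊆ Set.range f.hom.base) :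
    Y ⟶ X :=
  InducedCategory.homMk (PresheafedSpace.IsOpenImmersion.lift f.hom g.hom h)

theorem IsOpenImmersion.lift_fac {X Y Z : SheafedSpace.{u + 1, u, u} C} (f : X ⟶ Z) (g : Y ⟶ Z)
    [H : SheafedSpace.IsOpenImmersion f] (h : Set.range g.hom.base ⊆ Set.range f.hom.base) :
    IsOpenImmersion.lift f g h ≫ f = g :=
  InducedCategory.hom_ext (PresheafedSpace.IsOpenImmersion.lift_fac f.hom g.hom h)

variable {J : Type u} (X : SheafedSpace.{u + 1, u, u} C) (W : J → J → Opens X)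

/-- The inclusion of an open subspace. -/
abbrev openι (U : Opens X) : X.restrict U.isOpenEmbedding ⟶ X := X.ofRestrict U.isOpenEmbedding

theorem range_openι (U : Opens X) : Set.range (X.openι U).hom.base = U := Subtype.range_coe

section

variable {X W} (hself : ∀ i, W i i = ⊤) (hsymm : ∀ i j, W i j = W j i)
  (hinf : ∀ i j k, W i j ⊓ W i k ≤ W j k)

include hsymm in
theorem range_openι_subset (i j : J) :
    Set.range (X.openι (W i j)).hom.base ⊆ Set.range (X.openι (W j i)).hom.base := by
  rw [range_openι, range_openι, hsymm]

theorem range_pullback_subset (i j k : J) :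
    Set.range (pullback.fst (X.openι (W i j)) (X.openι (W i k)) ≫ X.openι (W i j)).hom.base ⊆
      (W i j ⊓ W i k : Opens X) := by
  have h1 : ∀ {Y Y' : SheafedSpace.{u + 1, u, u} C} (p : Y ⟶ Y') (q : Y' ⟶ X),
      Set.range (p ≫ q).hom.base ⊆ Set.range q.hom.base := by
    rintro Y Y' p q _ ⟨x, rfl⟩
    exact ⟨p.hom.base x, rfl⟩
  refine Set.subset_inter ?_ ?_
  · exact (h1 _ _).trans (range_openι X _).subset
  · rw [pullback.condition]
    exact (h1 _ _).trans (range_openι X _).subset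

/-- Gluing data for copies of a sheafed space along open subspaces. -/
def selfGlueData [HasLimits C] : SheafedSpace.GlueData.{u, u + 1} C where
  J := J
  U _ := X
  V ij := X.restrict (W ij.1 ij.2).isOpenEmbedding
  f i j := X.openι (W i j)
  f_id i := by
    have : Epi (X.openι (W i i)).hom.base := by
      rw [TopCat.epi_iff_surjective, ← Set.range_eq_univ, range_openι, hself]
      rfl
    exact SheafedSpace.IsOpenImmersion.to_iso _
  t i j := IsOpenImmersion.lift (X.openι (W j i)) (X.openι (W i j)) (range_openι_subset hsymm i j)
  t_id i := by
    -- All transition maps commute with the inclusions into the common space `X`, which are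
    -- monomorphisms. Here and in the remaining fields, identities are checked after composing with
    -- these inclusions.
    rw [← cancel_mono (X.openι (W i i)), IsOpenImmersion.lift_fac, Category.id_comp]
  t' i j k := pullback.lift
    (IsOpenImmersion.lift (X.openι (W j k)) (pullback.fst _ _ ≫ X.openι (W i j)) (by
      rw [range_openι]
      exact (range_pullback_subset i j k).trans (hinf i j k)))
    (IsOpenImmersion.lift (X.openι (W j i)) (pullback.fst _ _ ≫ X.openι (W i j)) (by
      rw [range_openι, ← hsymm i j]
      exact (range_pullback_subset i j k).trans Set.inter_subset_left))
    (by rw [IsOpenImmersion.lift_fac, IsOpenImmersion.lift_fac])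
  t_fac i j k := by
    rw [pullback.lift_snd, ← cancel_mono (X.openι (W j i)), Category.assoc,
      IsOpenImmersion.lift_fac, IsOpenImmersion.lift_fac]
  cocycle i j k := by
    refine pullback.hom_ext ?_ ?_
    · rw [← cancel_mono (X.openι (W i j))]
      simp only [Category.assoc, pullback.lift_fst, IsOpenImmersion.lift_fac, Category.id_comp,
        pullback.lift_fst_assoc]
    · rw [← cancel_mono (X.openι (W i k))]
      simp only [Category.assoc, pullback.lift_snd, IsOpenImmersion.lift_fac, Category.id_comp,
        pullback.lift_fst_assoc]
      exact pullback.condition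
  f_open i j := inferInstance

end

/-- Forgetting to topological spaces commutes with gluing, and in a glued topological space points
of two pieces are identified only through their overlap. -/
theorem GlueData.exists_of_ι_eq [HasLimits C] (D : SheafedSpace.GlueData.{u, u + 1} C) (i j : D.J)
    (x : D.U i) (y : D.U j) (h : (D.ι i).hom.base x = (D.ι j).hom.base y) :
    ∃ z : D.V (i, j), (D.f i j).hom.base z = x ∧ (D.t i j ≫ D.f j i).hom.base z = y := by
  let E : TopCat.GlueData :=
    { toGlueData := D.toGlueData.mapGlueData (SheafedSpace.forget C)
      f_open := fun i j ↦ (D.f_open i j).base_open }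
  have h1 : ∀ k (z : D.U k), (D.toGlueData.gluedIso (SheafedSpace.forget C)).hom
      ((D.ι k).hom.base z) = E.ι k z := fun k z ↦
    ConcreteCategory.congr_hom (D.toGlueData.ι_gluedIso_hom (SheafedSpace.forget C) k) z
  have h2 : E.ι i x = E.ι j y := by rw [← h1, ← h1, h]
  exact (E.ι_eq_iff_rel i j x y).1 h2

end AlgebraicGeometry.SheafedSpace

namespace BandScheme

/-- A band space that is covered by open immersions from spectra is a band scheme. -/
def ofCover (T : BandSpace.{u}) (h : ∀ t : T.pt, ∃ (B : BandCat.{u}) (i : spec.obj (op B) ⟶ T),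
    IsOpenImm i ∧ t ∈ Set.range (Hom.base i)) : BandScheme.{u} where
  toBandSpace := T
  local_affine t := by
    obtain ⟨B, i, hi, ht⟩ := h t
    let V : Opens T.pt := ⟨Set.range (Hom.base i), hi.base_open.isOpen_range⟩
    exact ⟨V, ht, B, ⟨(BandSpace.isoMk (SheafedSpace.isoMk
      (@PresheafedSpace.IsOpenImmersion.isoOfRangeEq _ _ _ _ _ (BandSpace.Hom.toHom i).hom
        hi (T.toSheafedSpace.openι V).hom
        (SheafedSpace.IsOpenImmersion.ofRestrict T.toSheafedSpace V.isOpenEmbedding)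
        (SheafedSpace.range_openι T.toSheafedSpace V).symm))).symm⟩⟩

/-- A band scheme with a doubled point: there are two morphisms to another band scheme that are
different at a given point and agree on every open subscheme that does not contain this point. -/
theorem exists_double (X : BandScheme.{u}) (x : X.toBandSpace.pt) :
    ∃ (T : BandScheme.{u}) (a b : X ⟶ T), Hom.base a.hom x ≠ Hom.base b.hom x ∧
      ∀ (Y : BandScheme.{u}) (f : Y ⟶ X), IsOpenImmersion f → x ∉ Set.range (Hom.base f.hom) →
        f ≫ a = f ≫ b := by
  -- An open subset that misses `x` is disjoint from the closure of `x`, so `O` is the largest open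
  -- subset without `x` and is the right locus for gluing the two copies.
  let O : Opens X.toBandSpace.pt := ⟨(closure {x})ᶜ, isClosed_closure.isOpen_compl⟩
  let W : ULift.{u} Bool → ULift.{u} Bool → Opens X.toBandSpace.pt := fun i j ↦
    if i = j then ⊤ else O
  have hW : ∀ i j, i ≠ j → W i j = O := fun i j h ↦ if_neg h
  have hself : ∀ i, W i i = ⊤ := fun i ↦ if_pos rfl
  have hsymm : ∀ i j, W i j = W j i := fun i j ↦ by
    by_cases h : i = j
    · rw [h]
    · rw [hW i j h, hW j i (Ne.symm h)]
  have hinf : ∀ i j k, W i j ⊓ W i k ≤ W j k := fun i j k ↦ by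
    by_cases h : i = j
    · rw [h]; exact inf_le_right
    · by_cases h' : j = k
      · rw [h', hself]; exact le_top
      · rw [hW i j h, hW j k h']; exact inf_le_left
  let D := SheafedSpace.selfGlueData (X := X.toSheafedSpace) hself hsymm hinf
  let T : BandSpace.{u} := ⟨D.glued⟩
  have hD : ∀ i, SheafedSpace.IsOpenImmersion (D.ι i) := fun i ↦ inferInstance
  let c : ULift.{u} Bool → (X.toBandSpace ⟶ T) := fun i ↦
    @homOfOpenImm X.toBandSpace T (D.ι i) (hD i)
  let T' : BandScheme.{u} := ofCover T fun t ↦ by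
    obtain ⟨i, y, rfl⟩ := D.ι_jointly_surjective t
    obtain ⟨B, k, hk, z, hz⟩ := exists_affine X y
    refine ⟨B, k.hom ≫ c i, @SheafedSpace.IsOpenImmersion.comp _ _ _ _ _ _ _ hk (hD i), z, ?_⟩
    exact congrArg (Hom.base (c i)) hz
  let i0 : ULift.{u} Bool := ⟨false⟩
  let i1 : ULift.{u} Bool := ⟨true⟩
  have h01 : W i0 i1 = O := hW _ _ (by simp [i0, i1])
  refine ⟨T', InducedCategory.homMk (c i0), InducedCategory.homMk (c i1), ?_, ?_⟩
  · intro h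
    -- If the two copies of `x` coincided, `x` would lie in the overlap `O`, but it belongs to its
    -- own closure.
    obtain ⟨z, hz, -⟩ := D.exists_of_ι_eq i0 i1 x x h
    have hx : x ∈ W i0 i1 := hz ▸ z.2
    rw [h01] at hx
    exact hx (subset_closure rfl)
  · intro Y f hf hx
    have hr : Set.range (Hom.base f.hom) ⊆ W i0 i1 := by
      rw [h01]
      rintro _ ⟨y, rfl⟩ hy
      have ho : IsOpen (Set.range (Hom.base f.hom)) :=
        (@isOpenEmbedding_base _ _ f.hom hf).isOpen_range
      obtain ⟨w, hw, hw'⟩ := mem_closure_iff.1 hy _ ho ⟨y, rfl⟩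
      rw [Set.mem_singleton_iff] at hw'
      exact hx (hw' ▸ hw)
    -- The morphism `f` factors through the overlap, on which the two inclusions agree.
    let l := @SheafedSpace.IsOpenImmersion.lift _ _ _ _ _ (X.toSheafedSpace.openι (W i0 i1))
      (BandSpace.Hom.toHom f.hom) (D.f_open i0 i1)
      (hr.trans (SheafedSpace.range_openι _ _).symm.subset)
    have hl : l ≫ D.f i0 i1 = BandSpace.Hom.toHom f.hom :=
      @SheafedSpace.IsOpenImmersion.lift_fac _ _ _ _ _ _ _ (D.f_open i0 i1) _
    have h2 : D.t i0 i1 ≫ D.f i1 i0 = D.f i0 i1 :=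
      @SheafedSpace.IsOpenImmersion.lift_fac _ _ _ _ _ _ _ (D.f_open i1 i0) _
    have h3 : D.f i0 i1 ≫ D.ι i0 = D.f i0 i1 ≫ D.ι i1 :=
      (D.glue_condition i0 i1).symm.trans
        ((Category.assoc _ _ _).symm.trans (congrArg (· ≫ D.ι i1) h2))
    refine InducedCategory.hom_ext (BandSpace.Hom.ext ?_)
    change BandSpace.Hom.toHom f.hom ≫ D.ι i0 = BandSpace.Hom.toHom f.hom ≫ D.ι i1
    refine (congrArg (· ≫ D.ι i0) hl).symm.trans (Eq.trans ?_ (congrArg (· ≫ D.ι i1) hl))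
    exact (Category.assoc _ _ _).trans ((congrArg (l ≫ ·) h3).trans (Category.assoc _ _ _).symm)

namespace AffinePresentation

variable {X : BandScheme.{u}} (P : AffinePresentation X)

/-- The morphisms of the cocone of a presentation cover the band scheme. -/
theorem exists_mem_range (x : X.toBandSpace.pt) :
    ∃ j, x ∈ Set.range (Hom.base (P.ι.app j).hom) := by
  by_contra! h
  obtain ⟨T, a, b, hne, hab⟩ := exists_double X x
  refine hne (congrArg (fun c : X ⟶ T ↦ Hom.base c.hom x) (P.isColimit.hom_ext fun j ↦ ?_))
  exact hab _ (P.ι.app j) (P.isOpenImmersion_ι j) (h j)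

/-- The points of the diagram of a presentation. -/
abbrev Point := Σ j, (P.diagram.obj j).toBandSpace.pt

/-- The image of a point of the diagram. -/
def Point.val (p : P.Point) : X.toBandSpace.pt := Hom.base (P.ι.app p.1).hom p.2

/-- The identification of points along the diagram. -/
def Point.Step (p q : P.Point) : Prop :=
  ∃ f : p.1 ⟶ q.1, Hom.base (P.diagram.map f).hom p.2 = q.2

theorem Point.val_map {i j : P.J} (f : i ⟶ j) (u : (P.diagram.obj i).toBandSpace.pt) :
    Point.val P ⟨j, Hom.base (P.diagram.map f).hom u⟩ = Point.val P ⟨i, u⟩ :=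
  congrArg (fun c : P.diagram.obj i ⟶ X ↦ Hom.base c.hom u) (P.cocone.w f)

theorem ι_base_injective (j : P.J) : Function.Injective (Hom.base (P.ι.app j).hom) :=
  (@isOpenEmbedding_base _ _ (P.ι.app j).hom (P.isOpenImmersion_ι j)).injective

open Classical in
/-- Points with the same image are connected along the diagram. -/
theorem eqvGen_of_val_eq (p q : P.Point) (h : Point.val P p = Point.val P q) :
    Relation.EqvGen (Point.Step P) p q := by
  obtain ⟨T, a, b, hne, hab⟩ := exists_double X (Point.val P p)
  -- `cond k` says that the point of the `k`-th piece over the given image, of which there is at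
  -- most one, is connected with `p`; it holds vacuously if there is none. Mapping the pieces with
  -- `cond k` by `a` and the others by `b` gives a cocone. If `q` were not connected with `p`, its
  -- descent would take both values at their common image.
  let cond : P.J → Prop := fun k ↦ ∀ w, Point.val P ⟨k, w⟩ = Point.val P p →
    Relation.EqvGen (Point.Step P) ⟨k, w⟩ p
  have hcond : ∀ k w, Point.val P ⟨k, w⟩ = Point.val P p →
      (cond k ↔ Relation.EqvGen (Point.Step P) ⟨k, w⟩ p) := fun k w hw ↦
    ⟨fun h ↦ h w hw, fun h w' hw' ↦ by
      have e : w' = w := P.ι_base_injective k (hw'.trans hw.symm)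
      rw [e]
      exact h⟩
  let t : ∀ k, P.diagram.obj k ⟶ T := fun k ↦ P.ι.app k ≫ if cond k then a else b
  have ht : ∀ (k l : P.J) (f : k ⟶ l), P.diagram.map f ≫ t l = t k := by
    intro k l f
    have hw : P.diagram.map f ≫ P.ι.app l = P.ι.app k := P.cocone.w f
    have e : P.diagram.map f ≫ t l = P.ι.app k ≫ if cond l then a else b := by
      rw [← Category.assoc, hw]
    rw [e]
    -- If the `k`-th piece contains the point, its image in the `l`-th piece is connected with it
    -- and both pieces make the same choice. Otherwise `a` and `b` agree on the `k`-th piece, so the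
    -- choice is immaterial.
    by_cases hx : Point.val P p ∈ Set.range (Hom.base (P.ι.app k).hom)
    · obtain ⟨w, hw⟩ := hx
      have h1 : cond l ↔ cond k := by
        rw [hcond k w hw, hcond l _ ((Point.val_map P f w).trans hw)]
        have hs : Relation.EqvGen (Point.Step P) ⟨k, w⟩
          ⟨l, Hom.base (P.diagram.map f).hom w⟩ := .rel _ _ ⟨f, rfl⟩
        exact ⟨fun h ↦ hs.trans _ _ _ h, fun h ↦ (hs.symm _ _).trans _ _ _ h⟩
      simp only [h1, t]
    · have := hab _ (P.ι.app k) (P.isOpenImmersion_ι k) hx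
      simp only [t]
      split_ifs <;> simp only [this]
  let s : Cocone P.diagram := ⟨T,
    { app := t
      naturality := fun k l f ↦ (ht k l f).trans (Category.comp_id _).symm }⟩
  have hd : ∀ r : P.Point, Hom.base (P.isColimit.desc s).hom (Point.val P r) =
      Hom.base (t r.1).hom r.2 := fun r ↦
    congrArg (fun c : P.diagram.obj r.1 ⟶ T ↦ Hom.base c.hom r.2) (P.isColimit.fac s r.1)
  have htval : ∀ r : P.Point, Hom.base (t r.1).hom r.2 =
      Hom.base (if cond r.1 then a else b).hom (Point.val P r) := fun r ↦ rfl
  have hp : cond p.1 := (hcond p.1 p.2 rfl).2 (.refl _)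
  by_contra hn
  have hq : ¬ cond q.1 := fun hc ↦ hn (((hcond q.1 q.2 h.symm).1 hc).symm _ _)
  have e1 := (hd p).trans (htval p)
  have e2 := (hd q).trans (htval q)
  rw [if_pos hp] at e1
  rw [if_neg hq, ← h] at e2
  exact hne (e1.symm.trans e2)

end AffinePresentation

end BandScheme

end

/-! ### Compatibility of the extension with affine presentations. -/

noncomputable section

open AlgebraicGeometry UniversalRing BandSpace

namespace BandScheme

section

variable {S S' : Scheme.{u}} {X Y : BandScheme.{u}}

/-- The local morphism corresponding to a morphism to the scheme associated to a band scheme. -/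
def toLocHom (f : S ⟶ toScheme.obj X) : LocHom S X.toBandSpace :=
  (toSchemeIso.app X).hom.app (op S) f

theorem toLocHom_bijective : Function.Bijective (toLocHom (S := S) (X := X)) :=
  (((toSchemeIso.app X).app (op S)).toEquiv).bijective

theorem toLocHom_comp (h : S' ⟶ S) (f : S ⟶ toScheme.obj X) :
    toLocHom (h ≫ f) = LocHom.precomp h (toLocHom f) :=
  ConcreteCategory.congr_hom ((toSchemeIso.app X).hom.naturality h.op) f

theorem toLocHom_map (f : S ⟶ toScheme.obj X) (g : X ⟶ Y) :
    toLocHom (f ≫ toScheme.map g) = LocHom.postcomp (toLocHom f) g.hom :=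
  ConcreteCategory.congr_hom (congr_app (toSchemeIso.hom.naturality g) (op S)) f

/-- The underlying map of the corresponding local morphism. -/
def pointMap (f : S ⟶ toScheme.obj X) (s : S) : X.toBandSpace.pt := (toLocHom f).base s

theorem pointMap_comp (h : S' ⟶ S) (f : S ⟶ toScheme.obj X) (s : S') :
    pointMap (h ≫ f) s = pointMap f (h s) :=
  congrArg (fun ξ : LocHom S' X.toBandSpace ↦ ξ.base s) (toLocHom_comp h f)

theorem pointMap_map (f : S ⟶ toScheme.obj X) (g : X ⟶ Y) (s : S) :
    pointMap (f ≫ toScheme.map g) s = Hom.base g.hom (pointMap f s) :=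
  congrArg (fun ξ : LocHom S Y.toBandSpace ↦ ξ.base s) (toLocHom_map f g)

theorem continuous_pointMap (f : S ⟶ toScheme.obj X) : Continuous (pointMap f) :=
  (toLocHom f).continuous

/-- Under `toSchemeIso` the morphism becomes the map of functors of points, which is a relative open
immersion; for a morphism between representable functors this means being an open immersion. -/
theorem isOpenImmersion_toScheme_map (g : X ⟶ Y) (hg : IsOpenImmersion g) :
    AlgebraicGeometry.IsOpenImmersion (toScheme.map g) := by
  have : IsOpenImm g.hom := hg
  have h1 : AlgebraicGeometry.IsOpenImmersion.presheaf (points.map g) :=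
    BandSpace.presheaf_isOpenImmersion g.hom
  have h2 : AlgebraicGeometry.IsOpenImmersion.presheaf (yoneda.map (toScheme.map g)) :=
    ((MorphismProperty.arrow_mk_iso_iff _
      (((Functor.mapArrowFunctor _ _).mapIso toSchemeIso).app (Arrow.mk g))).2 h1)
  exact MorphismProperty.of_relative_map h2

/-- A morphism with image in an open subscheme lifts. -/
theorem exists_lift (g : X ⟶ Y) (hg : IsOpenImmersion g) (f : S ⟶ toScheme.obj Y)
    (h : ∀ s, pointMap f s ∈ Set.range (Hom.base g.hom)) :
    ∃ f' : S ⟶ toScheme.obj X, f' ≫ toScheme.map g = f := by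
  have : IsOpenImm g.hom := hg
  obtain ⟨f', hf'⟩ := toLocHom_bijective.2 (LocHom.liftOpen g.hom (toLocHom f) h)
  refine ⟨f', toLocHom_bijective.1 ?_⟩
  rw [toLocHom_map, hf']
  exact LocHom.postcomp_liftOpen g.hom (toLocHom f) h

/-- A morphism lifts to an open subscheme in a neighbourhood of a point with image in it. -/
theorem exists_lift_nhds (g : X ⟶ Y) (hg : IsOpenImmersion g) (f : S ⟶ toScheme.obj Y) (s : S)
    (h : pointMap f s ∈ Set.range (Hom.base g.hom)) :
    ∃ U : S.Opens, s ∈ U ∧ ∃ f' : U.toScheme ⟶ toScheme.obj X, f' ≫ toScheme.map g = U.ι ≫ f := by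
  have ho : IsOpen (Set.range (Hom.base g.hom)) :=
    (@isOpenEmbedding_base _ _ g.hom hg).isOpen_range
  refine ⟨⟨_, ho.preimage (continuous_pointMap f)⟩, h, exists_lift g hg _ fun x ↦ ?_⟩
  rw [pointMap_comp]
  exact x.2

end

section

variable {X : BandScheme.{u}} (P : AffinePresentation X)

/-- Morphisms from the schemes of a presentation agree locally at two given points. -/
def AgreeAt (s : Cocone (P.diagram ⋙ toScheme)) (p q : P.Point) : Prop :=
  AffinePresentation.Point.val P p = AffinePresentation.Point.val P q ∧
  ∀ (W : Scheme.{u}) (a : W ⟶ toScheme.obj (P.diagram.obj p.1))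
    (b : W ⟶ toScheme.obj (P.diagram.obj q.1)) (w : W),
    a ≫ toScheme.map (P.ι.app p.1) = b ≫ toScheme.map (P.ι.app q.1) →
    pointMap a w = p.2 → pointMap b w = q.2 →
    ∃ U : W.Opens, w ∈ U ∧ U.ι ≫ a ≫ s.ι.app p.1 = U.ι ≫ b ≫ s.ι.app q.1

/-- Induction along the zigzag. For a single arrow, `b` is `a` followed by the transition map, since
the maps to `toScheme.obj X` are monomorphisms, and the cocone identity applies. Agreement is only
local because the transitive case needs a map to the middle piece, which exists only near the given
point. -/
theorem agreeAt_of_eqvGen (s : Cocone (P.diagram ⋙ toScheme)) (p q : P.Point)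
    (h : Relation.EqvGen (AffinePresentation.Point.Step P) p q) : AgreeAt P s p q := by
  have hmono : ∀ j, Mono (toScheme.map (P.ι.app j)) := fun j ↦
    have := isOpenImmersion_toScheme_map _ (P.isOpenImmersion_ι j)
    inferInstance
  induction h with
  | rel p q h =>
    obtain ⟨i, u⟩ := p
    obtain ⟨j, v⟩ := q
    obtain ⟨f, hf⟩ := h
    change i ⟶ j at f
    change Hom.base (P.diagram.map f).hom u = v at hf
    subst hf
    refine ⟨(AffinePresentation.Point.val_map P f u).symm, fun W a b w hab _ _ ↦ ⟨⊤, trivial, ?_⟩⟩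
    have h1 : P.diagram.map f ≫ P.ι.app j = P.ι.app i := P.cocone.w f
    have h2 : a ≫ toScheme.map (P.diagram.map f) = b := by
      rw [← cancel_mono (toScheme.map (P.ι.app j)), Category.assoc, ← Functor.map_comp, h1]
      exact hab
    have h3 : toScheme.map (P.diagram.map f) ≫ s.ι.app j = s.ι.app i := s.w f
    rw [← h2, Category.assoc, h3]
  | refl p =>
    refine ⟨rfl, fun W a b w hab _ _ ↦ ⟨⊤, trivial, ?_⟩⟩
    have := hmono p.1
    rw [(cancel_mono _).1 hab]
  | symm p q _ ih =>
    refine ⟨ih.1.symm, fun W a b w hab ha hb ↦ ?_⟩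
    obtain ⟨U, hU, e⟩ := ih.2 W b a w hab.symm hb ha
    exact ⟨U, hU, e.symm⟩
  | trans p q r _ _ ih ih' =>
    refine ⟨ih.1.trans ih'.1, fun W a c w hac ha hc ↦ ?_⟩
    have hq : pointMap (a ≫ toScheme.map (P.ι.app p.1)) w = AffinePresentation.Point.val P q := by
      rw [pointMap_map, ha]
      exact ih.1
    -- The image of `w` in `X` is that of the middle point `q`, so near `w` the common map to
    -- `toScheme.obj X` lifts to a map `b` into the middle piece, and both induction hypotheses
    -- apply to it.
    obtain ⟨U, hU, b, hb⟩ := exists_lift_nhds _ (P.isOpenImmersion_ι q.1) _ w ⟨q.2, hq.symm⟩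
    let w' : U.toScheme := ⟨w, hU⟩
    have hbw : pointMap b w' = q.2 := by
      refine P.ι_base_injective q.1 ?_
      rw [← pointMap_map, hb, pointMap_comp]
      exact hq
    obtain ⟨V, hV, e⟩ := ih.2 U (U.ι ≫ a) b w' (by rw [hb, Category.assoc])
      (by rw [pointMap_comp]; exact ha) hbw
    obtain ⟨V', hV', e'⟩ := ih'.2 U b (U.ι ≫ c) w' (by rw [hb, hac, Category.assoc])
      hbw (by rw [pointMap_comp]; exact hc)
    refine ⟨U.ι ''ᵁ (V ⊓ V'), ⟨w', ⟨hV, hV'⟩, rfl⟩, ?_⟩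
    have k : ∀ {Z : Scheme.{u}} {f g : U.toScheme ⟶ Z}, V.ι ≫ f = V.ι ≫ g →
        (V ⊓ V').ι ≫ f = (V ⊓ V').ι ≫ g := fun h ↦ by
      rw [← Scheme.homOfLE_ι _ (inf_le_left : V ⊓ V' ≤ V), Category.assoc, h, Category.assoc]
    have k' : ∀ {Z : Scheme.{u}} {f g : U.toScheme ⟶ Z}, V'.ι ≫ f = V'.ι ≫ g →
        (V ⊓ V').ι ≫ f = (V ⊓ V').ι ≫ g := fun h ↦ by
      rw [← Scheme.homOfLE_ι _ (inf_le_right : V ⊓ V' ≤ V'), Category.assoc, h, Category.assoc]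
    have e1 := (k e).trans (k' e')
    simp only [Category.assoc] at e1
    have hι : ((U.ι.isoImage (V ⊓ V')).hom ≫ (U.ι ''ᵁ (V ⊓ V')).ι) = (V ⊓ V').ι ≫ U.ι :=
      Scheme.Hom.isoImage_hom_ι U.ι (V ⊓ V')
    rw [← cancel_epi (U.ι.isoImage (V ⊓ V')).hom, ← Category.assoc, hι,
      ← Category.assoc _ _ (c ≫ _),
      hι, Category.assoc, Category.assoc]
    exact e1

/-- The open cover of the scheme of a band scheme induced by a presentation. -/
def AffinePresentation.openCover : (toScheme.obj X).OpenCover where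
  I₀ := P.J
  X j := toScheme.obj (P.diagram.obj j)
  f j := toScheme.map (P.ι.app j)
  mem₀ := by
    rw [Scheme.presieve₀_mem_precoverage_iff]
    refine ⟨fun y ↦ ?_, fun j ↦ isOpenImmersion_toScheme_map _ (P.isOpenImmersion_ι j)⟩
    obtain ⟨j, hj⟩ := P.exists_mem_range (pointMap (𝟙 (toScheme.obj X)) y)
    obtain ⟨U, hU, f, hf⟩ := exists_lift_nhds _ (P.isOpenImmersion_ι j) _ y hj
    refine ⟨j, f (⟨y, hU⟩ : U.toScheme), ?_⟩
    let y' : U.toScheme := ⟨y, hU⟩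
    refine (Scheme.Hom.comp_apply f _ y').symm.trans ?_
    rw [hf, Category.comp_id]
    rfl

/-- The associated scheme is compatible with affine presentations. -/
theorem isCompatibleWithPresentations_toScheme : IsCompatibleWithPresentations toScheme.{u} := by
  intro X P
  have hglue : ∀ (s : Cocone (P.diagram ⋙ toScheme)) (i j : P.J),
      pullback.fst (toScheme.map (P.ι.app i)) (toScheme.map (P.ι.app j)) ≫ s.ι.app i =
        pullback.snd _ _ ≫ s.ι.app j := fun s i j ↦ by
    -- It suffices to have agreement near each point `w` of the overlap. The two projections of `w`
    -- give points of the pieces with the same image in `X`, which are therefore joined by a zigzag.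
    refine Scheme.hom_ext_of_forall _ _ fun w ↦ ?_
    refine (agreeAt_of_eqvGen P s ⟨i, pointMap (pullback.fst _ _) w⟩
      ⟨j, pointMap (pullback.snd _ _) w⟩ (P.eqvGen_of_val_eq _ _ ?_)).2 _ _ _ w
      pullback.condition rfl rfl
    refine (pointMap_map _ _ w).symm.trans (Eq.trans ?_ (pointMap_map _ _ w))
    rw [pullback.condition]
  exact ⟨
    { desc := fun s ↦ Scheme.Cover.glueMorphisms P.openCover s.ι.app (hglue s)
      fac := fun s j ↦ Scheme.Cover.ι_glueMorphisms P.openCover s.ι.app (hglue s) j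
      uniq := fun s m hm ↦ Scheme.Cover.hom_ext P.openCover _ _ fun j ↦
        (hm j).trans (Scheme.Cover.ι_glueMorphisms P.openCover s.ι.app (hglue s) j).symm }⟩

end

end BandScheme

end

/-! ### Gluing sections of band spaces along open immersions. -/

noncomputable section

open AlgebraicGeometry

namespace BandSpace

variable {X Y Z T : BandSpace.{u}}

section Sheaf

variable {E : Type u} [Band E] {ι : Type u} (U : ι → Opens X.pt) (V : Opens X.pt)

/-- The sheaf of morphisms from a band to the sections of a band space. -/
def homSheaf (X : BandSpace.{u}) (E : Type u) [Band E] : TopCat.Sheaf (Type u) X.pt :=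
  ⟨X.toSheafedSpace.presheaf ⋙ coyoneda.obj (op (BandCat.of E)), by
    have := X.toSheafedSpace.IsSheaf (BandCat.of E)
    rwa [← isSheaf_iff_isSheaf_of_type] at this⟩

theorem hom_ext_of_cover (hU : ∀ i, U i ≤ V) (hV : V ≤ iSup U) {s t : BandHom E (X.O V)}
    (h : ∀ i e, X.res (hU i) (s e) = X.res (hU i) (t e)) : s = t :=
  (X.homSheaf E).eq_of_locally_eq' U V (fun i ↦ homOfLE (hU i)) hV s t
    fun i ↦ BandHom.ext fun e ↦ h i e

theorem exists_hom_of_cover (hU : ∀ i, U i ≤ V) (hV : V ≤ iSup U) (s : ∀ i, BandHom E (X.O (U i)))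
    (h : ∀ i j e, X.res inf_le_left (s i e) = X.res (inf_le_right : U i ⊓ U j ≤ U j) (s j e)) :
    ∃ t : BandHom E (X.O V), ∀ i e, X.res (hU i) (t e) = s i e := by
  obtain ⟨t, ht, -⟩ := (X.homSheaf E).existsUnique_gluing' U V (fun i ↦ homOfLE (hU i)) hV s
    fun i j ↦ BandHom.ext fun e ↦ h i j e
  exact ⟨t, fun i e ↦ congrArg (fun k : BandHom E (X.O (U i)) ↦ k e) (ht i)⟩

end Sheaf

theorem Hom.comp_app (a : X ⟶ Y) (g : Y ⟶ Z) (V : Opens Z.pt) (s : Z.O V) :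
    Hom.app (a ≫ g) V s = Hom.app a (Hom.preimage g V) (Hom.app g V s) := rfl

/-- Comparing over a common open subset `W` avoids transporting sections along the equality of the
two preimages. -/
theorem Hom.app_of_eq {g g' : X ⟶ Y} (h : g = g') (V : Opens Y.pt) (W : Opens X.pt)
    (hW : W ≤ Hom.preimage g V) (hW' : W ≤ Hom.preimage g' V) (s : Y.O V) :
    X.res hW (Hom.app g V s) = X.res hW' (Hom.app g' V s) := by
  subst h
  rfl

/-- Morphisms of band spaces are equal if they agree on points and sections. -/
theorem Hom.ext_of_app {g g' : X ⟶ Y} (hb : ∀ x, Hom.base g x = Hom.base g' x)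
    (hs : ∀ (V : Opens Y.pt) (h : Hom.preimage g' V ≤ Hom.preimage g V) (s : Y.O V),
      X.res h (Hom.app g V s) = Hom.app g' V s) : g = g' := by
  obtain ⟨⟨⟨b, c⟩⟩, l⟩ := g
  obtain ⟨⟨⟨b', c'⟩⟩, l'⟩ := g'
  obtain rfl : b = b' := TopCat.hom_ext (ContinuousMap.ext hb)
  obtain rfl : c = c' := NatTrans.ext (funext fun V ↦ BandCat.hom_ext fun s ↦
    (X.res_self le_rfl _).symm.trans (hs V.unop le_rfl s))
  rfl

section Local

/-- A morphism of sheafed spaces whose composition with a morphism of band spaces along an open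
immersion is local is itself local. -/
theorem isLocal_of_comp_openImm {X Y Z : SheafedSpace.{u + 1, u, u} BandCat.{u}} (l : X ⟶ Y)
    (f : Y ⟶ Z) [SheafedSpace.IsOpenImmersion f] (x : X)
    (hl : ∀ a : Z.presheaf.stalk ((l ≫ f).hom.base x), ¬ IsUnit a →
      ¬ IsUnit ((l ≫ f).hom.stalkMap x a)) (a : Y.presheaf.stalk (l.hom.base x))
    (ha : ¬ IsUnit a) : ¬ IsUnit (l.hom.stalkMap x a) := by
  have hi : IsIso (f.hom.stalkMap (l.hom.base x)) := SheafedSpace.IsOpenImmersion.stalk_iso f _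
  let k : BandHom _ _ := f.hom.stalkMap (l.hom.base x)
  let k' : BandHom _ _ := inv (f.hom.stalkMap (l.hom.base x))
  have hk : k (k' a) = a :=
    ConcreteCategory.congr_hom (IsIso.inv_hom_id (f.hom.stalkMap (l.hom.base x))) a
  have h1 : ¬ IsUnit (k' a) := fun h ↦ ha (hk ▸ h.map k)
  have h2 := hl (k' a) h1
  have e : (l ≫ f).hom.stalkMap x = f.hom.stalkMap (l.hom.base x) ≫ l.hom.stalkMap x :=
    PresheafedSpace.stalkMap.comp l.hom f.hom x
  rw [e] at h2
  rw [← hk]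
  exact h2

/-- The lift of a morphism of band spaces along an open immersion. -/
def liftHom (f : X ⟶ Z) [hf : IsOpenImm f] (g : Y ⟶ Z)
    (h : Set.range (Hom.base g) ⊆ Set.range (Hom.base f)) : Y ⟶ X where
  toHom := SheafedSpace.IsOpenImmersion.lift (BandSpace.Hom.toHom f) (BandSpace.Hom.toHom g) h
  isLocal x a ha := by
    refine isLocal_of_comp_openImm _ (BandSpace.Hom.toHom f) x ?_ a ha
    rw [SheafedSpace.IsOpenImmersion.lift_fac]
    exact BandSpace.Hom.isLocal g x

theorem liftHom_fac (f : X ⟶ Z) [hf : IsOpenImm f] (g : Y ⟶ Z)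
    (h : Set.range (Hom.base g) ⊆ Set.range (Hom.base f)) : liftHom f g h ≫ f = g :=
  BandSpace.Hom.ext (SheafedSpace.IsOpenImmersion.lift_fac _ _ h)

/-- The lift is the inverse of one projection of the fibre product, an isomorphism by the inclusion
of ranges, followed by the other projection, a base change of the open immersion `g`. -/
theorem isOpenImm_liftHom (f : X ⟶ Z) [hf : IsOpenImm f] (g : Y ⟶ Z) [hg : IsOpenImm g]
    (h : Set.range (Hom.base g) ⊆ Set.range (Hom.base f)) : IsOpenImm (liftHom f g h) := by
  change PresheafedSpace.IsOpenImmersion (PresheafedSpace.IsOpenImmersion.lift _ _ h)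
  unfold PresheafedSpace.IsOpenImmersion.lift
  have := PresheafedSpace.IsOpenImmersion.pullback_snd_isIso_of_range_subset
    (BandSpace.Hom.toHom f).hom (BandSpace.Hom.toHom g).hom h
  infer_instance

end Local

section Glue

variable {ι : Type u} {U : ι → BandSpace.{u}} (g : ∀ i, U i ⟶ X) [hg : ∀ i, IsOpenImm (g i)]

theorem res_image_preimage (i : ι) (V : Opens X.pt) (s : X.O V) :
    X.res (image_preimage_le (g i) V) s = push (g i) _ (Hom.app (g i) V s) :=
  (push_app (g i) V s).symm

variable {g}

theorem iSup_image_preimage (V : Opens X.pt) (hV : ∀ x ∈ V, ∃ i, x ∈ Set.range (Hom.base (g i))) :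
    V ≤ ⨆ i, image (g i) (Hom.preimage (g i) V) := fun x hx ↦ by
  obtain ⟨i, y, rfl⟩ := hV x hx
  exact Opens.mem_iSup.2 ⟨i, y, hx, rfl⟩

/-- Morphisms from a band to the sections over an open subset are determined by their pullbacks
along open immersions that cover it. -/
theorem hom_ext_of_openImm {E : Type u} [Band E] (V : Opens X.pt)
    (hV : ∀ x ∈ V, ∃ i, x ∈ Set.range (Hom.base (g i))) {s t : BandHom E (X.O V)}
    (h : ∀ i e, Hom.app (g i) V (s e) = Hom.app (g i) V (t e)) : s = t := by
  refine hom_ext_of_cover (fun i ↦ image (g i) (Hom.preimage (g i) V)) V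
    (fun i ↦ image_preimage_le (g i) V) (iSup_image_preimage V hV) fun i e ↦ ?_
  rw [res_image_preimage, res_image_preimage, h]

/-- Open immersions form a basis of a cover if their overlaps are covered by members. -/
def IsBasicCover (g : ∀ i, U i ⟶ X) : Prop :=
  (∀ x, ∃ i, x ∈ Set.range (Hom.base (g i))) ∧
  ∀ (i j : ι) (x : X.pt), x ∈ Set.range (Hom.base (g i)) → x ∈ Set.range (Hom.base (g j)) →
    ∃ (k : ι) (a : U k ⟶ U i) (b : U k ⟶ U j), a ≫ g i = g k ∧ b ≫ g j = g k ∧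
      x ∈ Set.range (Hom.base (g k))

/-- Compatible families of sections over the members of a basic cover glue. -/
theorem exists_hom_of_openImm (hc : IsBasicCover g) {E : Type u} [Band E] (V : Opens X.pt)
    (r : ∀ i, BandHom E ((U i).O (Hom.preimage (g i) V)))
    (hr : ∀ (i k : ι) (a : U k ⟶ U i) (_ : a ≫ g i = g k)
      (hle : Hom.preimage (g k) V ≤ Hom.preimage a (Hom.preimage (g i) V)) (e : E),
      (U k).res hle (Hom.app a _ (r i e)) = r k e) :
    ∃ s : BandHom E (X.O V), ∀ i e, Hom.app (g i) V (s e) = r i e := by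
  -- The given sections are transported to open subsets of `X`. By `key`, the pullback of `σ i` to a
  -- piece lying over the `i`-th one is the section given on that piece, independently of `i`.
  let σ : ∀ i, BandHom E (X.O (image (g i) (Hom.preimage (g i) V))) := fun i ↦
    (push (g i) _).comp (r i)
  have key : ∀ (i k : ι) (a : U k ⟶ U i) (h : a ≫ g i = g k) (W : Opens X.pt)
      (hW : W ≤ image (g i) (Hom.preimage (g i) V)) (hW' : Hom.preimage (g k) W ≤
        Hom.preimage (g k) V) (e : E),
      Hom.app (g k) W (X.res hW (σ i e)) = (U k).res hW' (r k e) := by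
    intro i k a h W hW hW' e
    have h1 : Hom.preimage (g k) W ≤
        Hom.preimage (a ≫ g i) (image (g i) (Hom.preimage (g i) V)) := by
      rw [h]
      exact fun y hy ↦ hW hy
    have h2 : Hom.preimage (g k) V ≤ Hom.preimage a (Hom.preimage (g i) V) := by
      rw [← h]
      exact le_rfl
    rw [Hom.app_res, Hom.app_of_eq h.symm _ _ _ h1, Hom.comp_app, ← hr i k a h h2, res_res]
    have h3 : Hom.app (g i) (image (g i) (Hom.preimage (g i) V)) (σ i e) =
        (U i).res (preimage_image (g i) _).le (r i e) := app_push (g i) _ _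
    rw [h3, Hom.app_res]
    exact res_res _ _ _ _
  obtain ⟨s, hs⟩ := exists_hom_of_cover (fun i ↦ image (g i) (Hom.preimage (g i) V)) V
    (fun i ↦ image_preimage_le (g i) V) (iSup_image_preimage V fun x _ ↦ hc.1 x) σ
    fun i j e ↦ by
      -- The overlap of the `i`-th and `j`-th pieces is covered by the pieces that lie over both,
      -- and on each of these `σ i` and `σ j` have the same pullback.
      let ι' : Type u := {k : ι // (∃ a : U k ⟶ U i, a ≫ g i = g k) ∧
        ∃ b : U k ⟶ U j, b ≫ g j = g k}
      let W : Opens X.pt := image (g i) (Hom.preimage (g i) V) ⊓ image (g j) (Hom.preimage (g j) V)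
      have hi : W ≤ image (g i) (Hom.preimage (g i) V) := inf_le_left
      have hj : W ≤ image (g j) (Hom.preimage (g j) V) := inf_le_right
      refine congrArg (fun k : BandHom E (X.O W) ↦ k e) (hom_ext_of_openImm
        (g := fun k : ι' ↦ g k.1) W (fun x hx ↦ ?_) (s := (X.res hi).comp (σ i))
        (t := (X.res hj).comp (σ j)) ?_)
      · obtain ⟨⟨y, -, hy⟩, ⟨z, -, hz⟩⟩ := hx
        obtain ⟨k, a, b, ha, hb, hk⟩ := hc.2 i j x ⟨y, hy⟩ ⟨z, hz⟩
        exact ⟨⟨k, ⟨a, ha⟩, ⟨b, hb⟩⟩, hk⟩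
      · rintro ⟨k, ⟨a, ha⟩, ⟨b, hb⟩⟩ e
        have hk : Hom.preimage (g k) W ≤ Hom.preimage (g k) V :=
          fun y hy ↦ image_preimage_le (g i) V (hi hy)
        exact (key i k a ha W hi hk e).trans (key j k b hb W hj hk e).symm
  refine ⟨s, fun i e ↦ ?_⟩
  have h1 : X.res (image_preimage_le (g i) V) (s e) = σ i e := hs i e
  have h2 := congrArg (Hom.app (g i) (image (g i) (Hom.preimage (g i) V))) h1
  have h3 : Hom.app (g i) (image (g i) (Hom.preimage (g i) V)) (σ i e) =
      (U i).res (preimage_image (g i) _).le (r i e) := app_push (g i) _ _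
  rw [h3, Hom.app_res] at h2
  have h4 := congrArg ((U i).res (preimage_image (g i) (Hom.preimage (g i) V)).ge) h2
  rw [res_res, res_res, res_self] at h4
  exact h4.trans (res_self _ _ _)

end Glue

end BandSpace

end

/-! ### Gluing morphisms of band spaces. -/

noncomputable section

open AlgebraicGeometry

namespace BandSpace

variable {X T : BandSpace.{u}} {ι : Type u} {U : ι → BandSpace.{u}} {g : ∀ i, U i ⟶ X}
  [hg : ∀ i, IsOpenImm (g i)]

/-- Morphisms are determined by their restrictions to a cover by open immersions. -/
theorem Hom.ext_of_openImm (hc : ∀ x, ∃ i, x ∈ Set.range (Hom.base (g i))) {f f' : X ⟶ T}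
    (h : ∀ i, g i ≫ f = g i ≫ f') : f = f' := by
  have hb : ∀ x, Hom.base f x = Hom.base f' x := fun x ↦ by
    obtain ⟨i, y, rfl⟩ := hc x
    exact congrArg (fun k : U i ⟶ T ↦ Hom.base k y) (h i)
  refine Hom.ext_of_app hb fun V hV s ↦ ?_
  refine congrArg (fun k : BandHom (T.O V) (X.O (Hom.preimage f' V)) ↦ k s)
    (hom_ext_of_openImm (g := g) (s := (X.res hV).comp (Hom.app f V)) (t := Hom.app f' V)
      _ (fun x _ ↦ hc x) fun i e ↦ ?_)
  refine (Hom.app_res (g i) hV _).trans ?_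
  have h1 : Hom.preimage (g i) (Hom.preimage f' V) ≤ Hom.preimage (g i ≫ f) V :=
    fun y hy ↦ hV hy
  exact (Hom.app_of_eq (h i) V _ h1 le_rfl e).trans (res_self _ _ _)

variable (hc : IsBasicCover g) (f : ∀ i, U i ⟶ T)
  (hf : ∀ (i k : ι) (a : U k ⟶ U i), a ≫ g i = g k → a ≫ f i = f k)

include hc hf in
-- Both points come from one point of a piece over the `i`-th and the `j`-th, because the pieces
-- inject into `X`; there `f i` and `f j` both restrict to `f k`.
theorem base_eq_of_basicCover (i j : ι) (y : (U i).pt) (z : (U j).pt)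
    (h : Hom.base (g i) y = Hom.base (g j) z) : Hom.base (f i) y = Hom.base (f j) z := by
  obtain ⟨k, a, b, ha, hb, w, hw⟩ := hc.2 i j _ ⟨y, rfl⟩ ⟨z, h.symm⟩
  have h1 : Hom.base a w = y := (isOpenEmbedding_base (g i)).injective
    ((congrArg (fun k : U _ ⟶ X ↦ Hom.base k w) ha).trans hw)
  have h2 : Hom.base b w = z := (isOpenEmbedding_base (g j)).injective
    ((congrArg (fun k : U _ ⟶ X ↦ Hom.base k w) hb).trans (hw.trans h))
  rw [← h1, ← h2]
  exact congrArg (fun k : U _ ⟶ T ↦ Hom.base k w) ((hf i k a ha).trans (hf j k b hb).symm)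

/-- The underlying map of the glued morphism. -/
def glueBaseFun (x : X.pt) : T.pt :=
  Hom.base (f (hc.1 x).choose) (hc.1 x).choose_spec.choose

include hf in
theorem glueBaseFun_base (i : ι) (y : (U i).pt) :
    glueBaseFun hc f (Hom.base (g i) y) = Hom.base (f i) y :=
  base_eq_of_basicCover hc f hf _ _ _ _ (hc.1 (Hom.base (g i) y)).choose_spec.choose_spec

include hf in
theorem continuous_glueBaseFun : Continuous (glueBaseFun hc f) := by
  refine ⟨fun W hW ↦ ?_⟩
  have e : glueBaseFun hc f ⁻¹' W = ⋃ i, Hom.base (g i) '' (Hom.base (f i) ⁻¹' W) := by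
    ext x
    obtain ⟨i, y, rfl⟩ := hc.1 x
    constructor
    · intro hx
      refine Set.mem_iUnion.2 ⟨i, y, ?_, rfl⟩
      rw [Set.mem_preimage, ← glueBaseFun_base hc f hf]
      exact hx
    · intro hx
      obtain ⟨j, z, hz, e⟩ := Set.mem_iUnion.1 hx
      rw [Set.mem_preimage, ← e, glueBaseFun_base hc f hf]
      exact hz
  rw [e]
  exact isOpen_iUnion fun i ↦ (isOpenEmbedding_base (g i)).isOpenMap _
    (hW.preimage (Hom.base (f i)).hom.continuous)

/-- The continuous map underlying the glued morphism. -/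
def glueBase : X.pt ⟶ T.pt := TopCat.ofHom ⟨glueBaseFun hc f, continuous_glueBaseFun hc f hf⟩

theorem preimage_glueBase (i : ι) (V : Opens T.pt) :
    Hom.preimage (g i) ((Opens.map (glueBase hc f hf)).obj V) = Hom.preimage (f i) V := by
  ext y
  change glueBaseFun hc f (Hom.base (g i) y) ∈ V ↔ Hom.base (f i) y ∈ V
  rw [glueBaseFun_base hc f hf]

theorem exists_glueApp (V : Opens T.pt) :
    ∃ s : BandHom (T.O V) (X.O ((Opens.map (glueBase hc f hf)).obj V)), ∀ i e,
      Hom.app (g i) _ (s e) = (U i).res (preimage_glueBase hc f hf i V).le (Hom.app (f i) V e) := by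
  refine exists_hom_of_openImm hc _
    (fun i ↦ ((U i).res (preimage_glueBase hc f hf i V).le).comp (Hom.app (f i) V)) ?_
  intro i k a h hle e
  refine (congrArg ((U k).res hle) (Hom.app_res a _ _)).trans ((res_res _ _ _ _).trans ?_)
  exact Hom.app_of_eq (hf i k a h) V _ _ _ e

/-- The pullback of sections along the glued morphism. -/
def glueApp (V : Opens T.pt) :
    BandHom (T.O V) (X.O ((Opens.map (glueBase hc f hf)).obj V)) :=
  (exists_glueApp hc f hf V).choose

theorem app_glueApp (V : Opens T.pt) (i : ι) (e : T.O V) :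
    Hom.app (g i) _ (glueApp hc f hf V e) =
      (U i).res (preimage_glueBase hc f hf i V).le (Hom.app (f i) V e) :=
  (exists_glueApp hc f hf V).choose_spec i e

theorem glueApp_res {V W : Opens T.pt} (h : W ≤ V) (e : T.O V) :
    glueApp hc f hf W (T.res h e) =
      X.res (show (Opens.map (glueBase hc f hf)).obj W ≤ (Opens.map (glueBase hc f hf)).obj V from
        fun _ hx ↦ h hx) (glueApp hc f hf V e) := by
  let W' := (Opens.map (glueBase hc f hf)).obj W
  have hW : W' ≤ (Opens.map (glueBase hc f hf)).obj V := fun _ hx ↦ h hx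
  refine congrArg (fun k : BandHom (T.O V) (X.O W') ↦ k e) (hom_ext_of_openImm (g := g)
    (s := (glueApp hc f hf W).comp (T.res h)) (t := (X.res hW).comp (glueApp hc f hf V))
    W' (fun x _ ↦ hc.1 x) fun i e ↦ ?_)
  refine (app_glueApp hc f hf W i _).trans (Eq.trans ?_ (Hom.app_res (g i) hW _).symm)
  have hW' : Hom.preimage (g i) W' ≤
      Hom.preimage (g i) ((Opens.map (glueBase hc f hf)).obj V) := fun _ hx ↦ hW hx
  exact ((congrArg ((U i).res _) (Hom.app_res (f i) h e)).trans (res_res _ _ _ _)).trans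
    ((congrArg ((U i).res hW') (app_glueApp hc f hf V i e)).trans (res_res _ _ _ _)).symm

/-- The glued morphism of sheafed spaces. -/
def glueSheafedHom : X.toSheafedSpace ⟶ T.toSheafedSpace :=
  InducedCategory.homMk
    { base := glueBase hc f hf
      c :=
        { app := fun V ↦ glueApp hc f hf V.unop
          naturality := fun _ _ i ↦ BandCat.hom_ext fun e ↦ glueApp_res hc f hf i.unop.le e } }

theorem comp_glueSheafedHom (i : ι) :
    BandSpace.Hom.toHom (g i) ≫ glueSheafedHom hc f hf = BandSpace.Hom.toHom (f i) := by
  refine InducedCategory.hom_ext (PresheafedSpace.Hom.ext _ _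
    (TopCat.hom_ext (ContinuousMap.ext (glueBaseFun_base hc f hf i))) ?_)
  refine NatTrans.ext (funext fun V ↦ BandCat.hom_ext fun e ↦ ?_)
  have h1 : Hom.app (g i) _ (glueApp hc f hf V.unop e) =
      (U i).res (preimage_glueBase hc f hf i V.unop).le (Hom.app (f i) V.unop e) :=
    app_glueApp hc f hf V.unop i e
  have h2 := congrArg ((U i).res (preimage_glueBase hc f hf i V.unop).ge) h1
  exact h2.trans ((res_res _ _ _ _).trans (res_self _ _ _))

/-- Morphisms on the members of a basic cover that are compatible with the transition maps glue. -/
theorem exists_glueHom (hc : IsBasicCover g) (f : ∀ i, U i ⟶ T)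
    (hf : ∀ (i k : ι) (a : U k ⟶ U i), a ≫ g i = g k → a ≫ f i = f k) :
    ∃ h : X ⟶ T, ∀ i, g i ≫ h = f i := by
  refine ⟨⟨glueSheafedHom hc f hf, fun x a ha hu ↦ ?_⟩, fun i ↦
    BandSpace.Hom.ext (comp_glueSheafedHom hc f hf i)⟩
  obtain ⟨i, y, rfl⟩ := hc.1 x
  -- Locality is inherited from `f i`: its stalk map factors through that of the glued morphism, so
  -- an element becoming a unit under the latter would become one under the former.
  have h1 : ∀ a, ¬ IsUnit a →
      ¬ IsUnit ((BandSpace.Hom.toHom (g i) ≫ glueSheafedHom hc f hf).hom.stalkMap y a) := by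
    rw [comp_glueSheafedHom hc f hf i]
    exact BandSpace.Hom.isLocal (f i) y
  have e : (BandSpace.Hom.toHom (g i) ≫ glueSheafedHom hc f hf).hom.stalkMap y =
      (glueSheafedHom hc f hf).hom.stalkMap (Hom.base (g i) y) ≫
        (BandSpace.Hom.toHom (g i)).hom.stalkMap y :=
    PresheafedSpace.stalkMap.comp (BandSpace.Hom.toHom (g i)).hom (glueSheafedHom hc f hf).hom y
  have h2 := h1 a ha
  rw [e] at h2
  let k : BandHom _ _ := (BandSpace.Hom.toHom (g i)).hom.stalkMap y
  exact h2 (hu.map k)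

end BandSpace

end

/-! ### The closed point of a spectrum, and morphisms between spectra. -/

noncomputable section

open AlgebraicGeometry

namespace PrimeMIdeal

variable {B C : Type u} [Band B] [Band C]

theorem zero_ne_isUnit (p : PrimeMIdeal B) : ¬ IsUnit (0 : B) := fun h ↦ by
  obtain ⟨c, hc⟩ := h.exists_right_inv
  rw [zero_mul] at hc
  exact p.one_mem_compl (hc ▸ p.zero_mem)

theorem notMem_of_isUnit (p : PrimeMIdeal B) {b : B} (h : IsUnit b) : b ∉ p.carrier := fun hb ↦ by
  obtain ⟨c, hc⟩ := h.exists_left_inv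
  exact p.one_mem_compl (hc ▸ p.mul_mem c hb)

/-- The closed point of the spectrum, i.e. the ideal of all non-units. -/
def closedPoint (h : ¬ IsUnit (0 : B)) : PrimeMIdeal B where
  carrier := {b | ¬ IsUnit b}
  zero_mem := h
  mul_mem _ _ hb hab := hb (isUnit_of_mul_isUnit_right hab)
  one_mem_compl h := h isUnit_one
  mul_mem_compl ha hb h := h ((not_not.1 ha).mul (not_not.1 hb))

theorem notMem_closedPoint (h : ¬ IsUnit (0 : B)) (b : B) :
    b ∉ (closedPoint h).carrier ↔ IsUnit b := not_not

/-- The only open subset that contains the closed point is the whole spectrum. -/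
theorem mem_of_closedPoint_mem (h : ¬ IsUnit (0 : B)) (U : Opens (PrimeMIdeal B))
    (hU : closedPoint h ∈ U) (p : PrimeMIdeal B) : p ∈ U := by
  have key : ∀ s : Set (PrimeMIdeal B), TopologicalSpace.GenerateOpen (Set.range basicOpen) s →
      closedPoint h ∈ s → p ∈ s := by
    intro s hs
    induction hs with
    | basic s hs =>
      obtain ⟨b, rfl⟩ := hs
      exact fun hb ↦ p.notMem_of_isUnit ((notMem_closedPoint h b).1 hb)
    | univ => exact fun _ ↦ trivial
    | inter s t _ _ hs ht => exact fun hm ↦ ⟨hs hm.1, ht hm.2⟩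
    | sUnion S _ ih => exact fun ⟨s, hs, hm⟩ ↦ ⟨s, hs, ih s hs hm⟩
  exact key U U.2 hU

section

variable (h : ¬ IsUnit (0 : B))

/-- The local band at the closed point is the band itself. -/
def closedLocal : BandHom (closedPoint h).Local B :=
  Band.localizationLift (BandHom.id B) fun s ↦ (notMem_closedPoint h s).1 s.2

theorem closedLocal_mk (b : B) : closedLocal h (Localization.mk b 1) = b :=
  Band.localizationLift_mk _ _ b

/-- The element of the band that corresponds to a section. -/
def toBand (U : Opens (PrimeMIdeal B)) (hU : closedPoint h ∈ U) : BandHom (Sections U) B :=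
  (closedLocal h).comp (Sections.eval ⟨closedPoint h, hU⟩)

theorem isUnit_mk_one {p : PrimeMIdeal B} {f : B} (hf : f ∉ p.carrier) :
    IsUnit (Localization.mk f 1 : p.Local) := (isUnit_mk_iff f 1).2 hf

theorem mk_mul_mk_one {p : PrimeMIdeal B} (a : B) (f : p.primeCompl) :
    (Localization.mk a f : p.Local) * Localization.mk (f : B) 1 = Localization.mk a 1 := by
  rw [Localization.mk_mul, mul_one, Localization.mk_eq_mk_iff, Localization.r_iff_exists]
  exact ⟨1, by simp [mul_comm]⟩

/-- A section is a fraction `a / f` near the closed point. Such a neighbourhood is the whole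
spectrum, and `f` is a unit of `B`, so the section is everywhere given by the single element `a *
f⁻¹`. -/
theorem eq_toBand (U : Opens (PrimeMIdeal B)) (hU : closedPoint h ∈ U) (s : Sections U) (p : U) :
    s.1 p = Localization.mk (toBand h U hU s) 1 := by
  obtain ⟨W, hm, hWU, a, f, hs⟩ := s.2 ⟨closedPoint h, hU⟩
  obtain ⟨hf, e⟩ := hs ⟨closedPoint h, hm⟩
  obtain ⟨hf', e'⟩ := hs ⟨p.1, mem_of_closedPoint_mem h W hm p.1⟩
  have h1 : toBand h U hU s * f = a := by
    have h2 := congrArg (closedLocal h) (mk_mul_mk_one a (⟨f, hf⟩ : (closedPoint h).primeCompl))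
    rw [map_mul, closedLocal_mk, closedLocal_mk, ← e] at h2
    exact h2
  refine (isUnit_mk_one hf').mul_right_cancel ?_
  refine (congrArg (· * _) e').trans ((mk_mul_mk_one a ⟨f, hf'⟩).trans ?_)
  rw [Localization.mk_mul, one_mul, h1]

end

open BandSpace in
/-- Every morphism between spectra of bands comes from a band morphism. -/
theorem exists_eq_specMap {B C : BandCat.{u}} (p : PrimeMIdeal C)
    (g : spec.obj (op C) ⟶ spec.obj (op B)) : ∃ f : B ⟶ C, spec.map f.op = g := by
  have h0 : ¬ IsUnit (0 : C) := p.zero_ne_isUnit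
  -- The band morphism is read off from global sections, which over `Spec C` are elements of `C` by
  -- `eq_toBand`.
  let f : BandHom B C := (toBand h0 ⊤ trivial).comp
    ((Hom.app g ⊤).comp (Sections.fromBand (B := B) ⊤))
  have hf : ∀ (W : Opens (PrimeMIdeal B)) (b : B) (q : PrimeMIdeal C)
      (hq : q ∈ Hom.preimage g W), (Hom.app g W (Sections.fromBand W b)).1 ⟨q, hq⟩ =
        (Localization.mk (f b) 1 : q.Local) := by
    intro W b q hq
    have h1 := Hom.app_res g (le_top : W ≤ ⊤) (Sections.fromBand (B := B) ⊤ b)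
    have h2 : (Hom.app g W (Sections.fromBand W b)).1 ⟨q, hq⟩ =
        (Hom.app g ⊤ (Sections.fromBand (B := B) ⊤ b)).1 ⟨q, trivial⟩ :=
      congrArg (fun k : Sections (B := C) (Hom.preimage g W) ↦ k.1 ⟨q, hq⟩) h1
    exact h2.trans (eq_toBand (B := C) h0 ⊤ trivial _ ⟨q, trivial⟩)
  -- Nonvanishing of `b` at the image of `q` means that its germ is a unit. By locality of `g` this
  -- is equivalent to invertibility of the pulled back germ, which is `f b` in the local band at
  -- `q`.
  have hbase : ∀ (q : PrimeMIdeal C) (b : B),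
      b ∉ (Hom.base g q : PrimeMIdeal B).carrier ↔ f b ∉ q.carrier := by
    intro q b
    rw [← isUnit_germ_fromBand_iff (Hom.base g q : PrimeMIdeal B) ⊤ trivial b]
    have h1 : IsUnit (germ q ⊤ trivial (Hom.app g ⊤ (Sections.fromBand (B := B) ⊤ b))) ↔
        f b ∉ q.carrier := by
      refine (isUnit_germ_iff q ⊤ trivial _).trans ?_
      exact (Eq.to_iff (congrArg IsUnit (hf ⊤ b q trivial))).trans (isUnit_mk_iff (f b) 1)
    rw [← h1]
    constructor
    · intro hu
      let t : BandHom _ _ := (BandSpace.Hom.toHom g).hom.stalkMap q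
      have e : t (germ (Hom.base g q : PrimeMIdeal B) ⊤ trivial (Sections.fromBand ⊤ b)) =
          germ q ⊤ trivial (Hom.app g ⊤ (Sections.fromBand (B := B) ⊤ b)) :=
        ConcreteCategory.congr_hom
          (PresheafedSpace.stalkMap_germ (BandSpace.Hom.toHom g).hom ⊤ q trivial)
          (Sections.fromBand (B := B) ⊤ b)
      exact e ▸ hu.map t
    · exact Hom.isUnit_germ g ⊤ q trivial (Sections.fromBand (B := B) ⊤ b)
  have hb : ∀ q : PrimeMIdeal C, comap f q = Hom.base g q := fun q ↦ ext_carrier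
    (Set.ext fun b ↦ not_iff_not.1 (hbase q b).symm)
  refine ⟨f, Hom.ext_of_app hb fun V hV s ↦ Sections.ext fun q ↦ ?_⟩
  obtain ⟨q, hq⟩ := q
  -- Locally `s` is the fraction `a / t`. Both pullbacks are determined by `a` and `t`, so they are
  -- compared after multiplication with the image of `t`, which is a unit.
  obtain ⟨W, hqW, hWV, a, t, hs⟩ := s.2 ⟨Hom.base g q, hq⟩
  have hqW' : q ∈ Hom.preimage g W := hqW
  have hqf : comap f q ∈ W := (hb q).symm ▸ hqW
  obtain ⟨ht, e⟩ := hs ⟨comap f q, hqf⟩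
  have hft : f t ∉ q.carrier := ht
  refine (isUnit_mk_one hft).mul_right_cancel ?_
  have h1 : localMap f q (s.1 ⟨comap f q, hWV hqf⟩) * Localization.mk (f t) 1 =
      (Localization.mk (f a) 1 : q.Local) := by
    rw [e, localMap_mk]
    exact mk_mul_mk_one (p := q) (f a) ⟨f t, hft⟩
  refine h1.trans ?_
  have h2 : Sections.res hWV s * Sections.fromBand W t = Sections.fromBand W a :=
    Sections.ext fun r ↦ by
      obtain ⟨hr, e⟩ := hs r
      exact (congrArg (· * _) e).trans (mk_mul_mk_one a ⟨t, hr⟩)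
  have h3 := congrArg (fun k : Sections (B := C) (Hom.preimage g W) ↦ k.1 ⟨q, hqW'⟩)
    (congrArg (Hom.app g W) h2)
  have h4 : (Hom.app g W (Sections.res hWV s)).1 ⟨q, hqW'⟩ = (Hom.app g V s).1 ⟨q, hq⟩ :=
    congrArg (fun k : Sections (B := C) (Hom.preimage g W) ↦ k.1 ⟨q, hqW'⟩)
      (Hom.app_res g hWV s)
  have h5 : Hom.app g W (Sections.res hWV s * Sections.fromBand W t) =
      Hom.app g W (Sections.res hWV s) * Hom.app g W (Sections.fromBand W t) := map_mul _ _ _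
  rw [h5] at h3
  have h6 : (Hom.app g W (Sections.res hWV s)).1 ⟨q, hqW'⟩ *
      (Hom.app g W (Sections.fromBand W t)).1 ⟨q, hqW'⟩ =
        (Hom.app g W (Sections.fromBand W a)).1 ⟨q, hqW'⟩ := h3
  rw [h4, hf, hf] at h6
  exact h6.symm

end PrimeMIdeal

end

/-! ### Principal open subschemes. -/

noncomputable section

open AlgebraicGeometry

/-- A bijective band morphism that reflects null sums is an isomorphism. -/
theorem BandCat.isIso_of_bijective {B C : BandCat.{u}} (f : B ⟶ C) (hf : Function.Bijective f)
    (hn : ∀ x, AmbientSemiring.map (BandHom.toMonoidWithZeroHom (B := B) (C := C) f) x ∈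
      Band.nullSet (B := C) → x ∈ Band.nullSet (B := B)) : IsIso f := by
  let f' : BandHom B C := f
  let e : B ≃ C := Equiv.ofBijective f hf
  have he : ∀ c, f' (e.symm c) = c := e.apply_symm_apply
  let g₀ : C →*₀ B :=
    { toFun := e.symm
      map_zero' := hf.1 ((he 0).trans (map_zero f').symm)
      map_one' := hf.1 ((he 1).trans (map_one f').symm)
      map_mul' := fun a b ↦ hf.1 ((he (a * b)).trans
        ((congrArg₂ (· * ·) (he a) (he b)).symm.trans (map_mul f' _ _).symm)) }
  have hfg : f'.toMonoidWithZeroHom.comp g₀ = MonoidWithZeroHom.id C :=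
    MonoidWithZeroHom.ext he
  let g : BandHom C B :=
    { toMonoidWithZeroHom := g₀
      map_nullSet := fun x hx ↦ hn _ (by
        rw [AmbientSemiring.map_map]
        change AmbientSemiring.map (f'.toMonoidWithZeroHom.comp g₀) x ∈ _
        rwa [hfg, AmbientSemiring.map_id]) }
  exact ⟨g, BandCat.hom_ext fun b ↦ e.symm_apply_apply b, BandCat.hom_ext he⟩

namespace PrimeMIdeal

variable {B : Type u} [Band B] (h : B)

/-- The localization of a band at the powers of an element. -/
abbrev Away : Type u := Localization (Submonoid.powers h)

/-- The localization map. -/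
abbrev toAway : BandHom B (Away h) := Band.localizationMap (Submonoid.powers h)

theorem toAway_apply (b : B) : toAway h b = Localization.mk b 1 := rfl

theorem isUnit_toAway (s : Submonoid.powers h) : IsUnit (toAway h s) :=
  IsUnit.of_mul_eq_one (Localization.mk 1 s) (by
    rw [toAway_apply, Localization.mk_mul, mul_one, one_mul]
    exact Localization.mk_self s)

theorem mk_mul_toAway (b : B) (s : Submonoid.powers h) :
    (Localization.mk b s : Away h) * toAway h s = toAway h b := by
  rw [toAway_apply, toAway_apply, Localization.mk_mul, mul_one, Localization.mk_eq_mk_iff,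
    Localization.r_iff_exists]
  exact ⟨1, by simp [mul_comm]⟩

theorem mul_mem_iff_of_isUnit {C : Type u} [Band C] (q : PrimeMIdeal C) {c : C} (hc : IsUnit c)
    (b : C) : b * c ∈ q.carrier ↔ b ∈ q.carrier := by
  constructor
  · intro hb
    by_contra hb'
    exact q.mul_mem_compl hb' (q.notMem_of_isUnit hc) hb
  · intro hb
    rw [mul_comm]
    exact q.mul_mem c hb

theorem mk_mem_iff (q : PrimeMIdeal (Away h)) (b : B) (s : Submonoid.powers h) :
    (Localization.mk b s : Away h) ∈ q.carrier ↔ b ∈ (comap (toAway h) q).carrier := by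
  rw [← mul_mem_iff_of_isUnit q (isUnit_toAway h s), mk_mul_toAway]
  rfl

theorem comap_toAway_injective : Function.Injective (comap (toAway h)) := by
  intro q q' e
  refine ext_carrier (Set.ext fun x ↦ ?_)
  induction x using Localization.induction_on with | _ x
  rw [mk_mem_iff, mk_mem_iff, e]

theorem notMem_comap_toAway (q : PrimeMIdeal (Away h)) (s : Submonoid.powers h) :
    (s : B) ∉ (comap (toAway h) q).carrier :=
  q.notMem_of_isUnit (isUnit_toAway h s)

theorem notMem_powers {p : PrimeMIdeal B} (hp : h ∉ p.carrier) (s : Submonoid.powers h) :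
    (s : B) ∉ p.carrier := by
  obtain ⟨_, n, rfl⟩ := s
  exact p.primeCompl.pow_mem hp n

/-- The map from the localization away from an element to the local band at a point where it does
not vanish. -/
def awayToLocal {p : PrimeMIdeal B} (hp : h ∉ p.carrier) : BandHom (Away h) p.Local :=
  Band.localizationLift (Band.localizationMap p.primeCompl) fun s ↦
    isUnit_mk_one (notMem_powers h hp s)

theorem awayToLocal_toAway {p : PrimeMIdeal B} (hp : h ∉ p.carrier) (b : B) :
    awayToLocal h hp (toAway h b) = Localization.mk b 1 :=
  Band.localizationLift_mk _ _ b

theorem zero_not_isUnit_local (p : PrimeMIdeal B) : ¬ IsUnit (0 : p.Local) := by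
  rw [← Localization.mk_zero (1 : p.primeCompl), isUnit_mk_iff]
  exact not_not.2 p.zero_mem

/-- A prime `p` without `h` is the inverse image of the closed point of `B_p` under `B → B[h⁻¹] →
B_p`. -/
theorem range_comap_toAway : Set.range (comap (toAway h)) = basicOpen h := by
  ext p
  constructor
  · rintro ⟨q, rfl⟩
    exact notMem_comap_toAway h q ⟨h, Submonoid.mem_powers h⟩
  · intro (hp : h ∉ p.carrier)
    refine ⟨comap (awayToLocal h hp) (closedPoint (zero_not_isUnit_local p)), ?_⟩
    refine ext_carrier (Set.ext fun b ↦ not_iff_not.1 ?_)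
    change awayToLocal h hp (toAway h b) ∉ (closedPoint (zero_not_isUnit_local p)).carrier ↔ _
    rw [notMem_closedPoint, awayToLocal_toAway, isUnit_mk_iff]

/-- Since denominators are units, the principal open subset of `a / s` is the inverse image of that
of `a`, so the topology is induced. -/
theorem isOpenEmbedding_comap_toAway : Topology.IsOpenEmbedding (comap (toAway h)) := by
  refine ⟨⟨⟨le_antisymm (continuous_comap _).le_induced ?_⟩, comap_toAway_injective h⟩, ?_⟩
  · refine le_generateFrom ?_
    rintro _ ⟨x, rfl⟩
    induction x using Localization.induction_on with | _ x
    refine ⟨basicOpen x.1, isOpen_basicOpen x.1, ?_⟩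
    ext q
    exact not_iff_not.2 (mk_mem_iff h q x.1 x.2).symm
  · rw [range_comap_toAway]
    exact isOpen_basicOpen h

/-- The inverse of the map of local bands. -/
def localInv (q : PrimeMIdeal (Away h)) : BandHom q.Local (comap (toAway h) q).Local :=
  Band.localizationLift (awayToLocal h (notMem_comap_toAway h q ⟨h, Submonoid.mem_powers h⟩)) (by
    rintro ⟨x, hx⟩
    induction x using Localization.induction_on with | _ x
    have h1 : x.1 ∉ (comap (toAway h) q).carrier := fun hx' ↦ hx ((mk_mem_iff h q x.1 x.2).2 hx')
    have h2 := congrArg (awayToLocal h (notMem_comap_toAway h q ⟨h, Submonoid.mem_powers h⟩))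
      (mk_mul_toAway h x.1 x.2)
    rw [map_mul, awayToLocal_toAway, awayToLocal_toAway] at h2
    exact isUnit_of_mul_isUnit_left (h2 ▸ isUnit_mk_one h1))

theorem localInv_localMap (q : PrimeMIdeal (Away h)) :
    (localInv h q).comp (localMap (toAway h) q) = BandHom.id _ :=
  Band.localization_hom_ext fun b ↦ by
    have h1 : localMap (toAway h) q (Localization.mk b 1) = Localization.mk (toAway h b) 1 :=
      Band.localizationLift_mk _ _ b
    have h2 : localInv h q (Localization.mk (toAway h b) 1) = _ :=
      Band.localizationLift_mk _ _ (toAway h b)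
    exact (congrArg (localInv h q) h1).trans (h2.trans (awayToLocal_toAway h _ b))

theorem localMap_injective (q : PrimeMIdeal (Away h)) :
    Function.Injective (localMap (toAway h) q) :=
  Function.LeftInverse.injective (g := localInv h q) fun x ↦
    congrArg (fun k : BandHom _ _ ↦ k x) (localInv_localMap h q)

theorem mem_nullSet_of_localMap (q : PrimeMIdeal (Away h))
    (x : AmbientSemiring (comap (toAway h) q).Local)
    (hx : AmbientSemiring.map (localMap (toAway h) q).toMonoidWithZeroHom x ∈ Band.nullSet) :
    x ∈ Band.nullSet := by
  have h1 := (localInv h q).map_nullSet _ hx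
  rw [AmbientSemiring.map_map] at h1
  have h2 : (localInv h q).toMonoidWithZeroHom.comp (localMap (toAway h) q).toMonoidWithZeroHom =
      MonoidWithZeroHom.id _ := congrArg BandHom.toMonoidWithZeroHom (localInv_localMap h q)
  rwa [h2, AmbientSemiring.map_id] at h1

/-- Clearing denominators, `(a/s) / (c/t)` equals `(a t) / (c s)`. The numerator and denominator do
not depend on `q`, as is needed to transfer regularity of families. -/
theorem exists_localMap_eq (x y : Away h) :
    ∃ a f : B, ∀ (q : PrimeMIdeal (Away h)) (hy : y ∉ q.carrier),
      ∃ hf : f ∉ (comap (toAway h) q).carrier,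
        localMap (toAway h) q (Localization.mk a ⟨f, hf⟩) = Localization.mk x ⟨y, hy⟩ := by
  induction x using Localization.induction_on with | _ x
  induction y using Localization.induction_on with | _ y
  obtain ⟨a, s⟩ := x
  obtain ⟨c, t⟩ := y
  refine ⟨a * t, c * s, fun q hy ↦ ?_⟩
  have hc : c ∉ (comap (toAway h) q).carrier := fun hc ↦ hy ((mk_mem_iff h q c t).2 hc)
  have hf : c * s ∉ (comap (toAway h) q).carrier :=
    (comap (toAway h) q).mul_mem_compl hc (notMem_comap_toAway h q s)
  refine ⟨hf, ?_⟩
  rw [localMap_mk, Localization.mk_eq_mk_iff, Localization.r_iff_exists]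
  refine ⟨1, ?_⟩
  simp only [map_mul, OneMemClass.coe_one, one_mul]
  have h1 := mk_mul_toAway h a s
  have h2 := mk_mul_toAway h c t
  rw [← h1, ← h2]
  have key : ∀ {M : Type u} [CommMonoid M] (x u z v : M),
      z * (x * u * v) = z * v * u * x := by
    intros
    ac_rfl
  exact key (M := Away h) _ _ _ _

-- Sections are families in the local bands, and the local bands at `q` and at its image are
-- isomorphic. Injectivity is therefore pointwise; for surjectivity the preimages are taken
-- pointwise and form a regular family by `exists_localMap_eq`.
variable {h} in
theorem Sections.pullback_bijective (V : Opens (PrimeMIdeal B)) (hV : (V : Set _) ⊆ basicOpen h) :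
    Function.Bijective (Sections.pullback (toAway h) V) := by
  have hr : ∀ p : V, ∃ q, comap (toAway h) q = p.1 := fun p ↦ by
    have := hV p.2
    rwa [← range_comap_toAway] at this
  constructor
  · intro s t e
    refine Sections.ext fun p ↦ ?_
    obtain ⟨p, hp⟩ := p
    obtain ⟨q, rfl⟩ := hr ⟨p, hp⟩
    refine localMap_injective h q ?_
    exact congrArg (fun k : Sections (Sections.preimage (toAway h) V) ↦ k.1 ⟨q, hp⟩) e
  · intro t
    -- The preimage is required to work for every `q` over `p`, although there is only one, so that
    -- the chosen family can be used at any `q` without transport.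
    have hex : ∀ p : V, ∃ x : p.1.Local, ∀ (q : PrimeMIdeal (Away h))
        (hq : comap (toAway h) q = p.1), localMap (toAway h) q (hq ▸ x) =
          t.1 ⟨q, show comap (toAway h) q ∈ V from hq ▸ p.2⟩ := by
      rintro ⟨p, hp⟩
      obtain ⟨q, rfl⟩ := hr ⟨p, hp⟩
      obtain ⟨W, hqW, hWV, x, y, ht⟩ := t.2 ⟨q, hp⟩
      obtain ⟨a, f, haf⟩ := exists_localMap_eq h x y
      obtain ⟨hy, e⟩ := ht ⟨q, hqW⟩
      obtain ⟨hf, e'⟩ := haf q hy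
      refine ⟨Localization.mk a ⟨f, hf⟩, fun q' hq' ↦ ?_⟩
      obtain rfl := comap_toAway_injective h hq'
      exact e'.trans e.symm
    choose s hs using hex
    have hs' : ∀ (q : PrimeMIdeal (Away h)) (hq : comap (toAway h) q ∈ V),
        localMap (toAway h) q (s ⟨comap (toAway h) q, hq⟩) = t.1 ⟨q, hq⟩ := fun q hq ↦
      hs ⟨comap (toAway h) q, hq⟩ q rfl
    refine ⟨⟨s, fun p ↦ ?_⟩, Sections.ext fun q ↦ hs' q.1 q.2⟩
    obtain ⟨p, hp⟩ := p
    obtain ⟨q, rfl⟩ := hr ⟨p, hp⟩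
    obtain ⟨W, hqW, hWV, x, y, ht⟩ := t.2 ⟨q, hp⟩
    obtain ⟨a, f, haf⟩ := exists_localMap_eq h x y
    have hle : comap (toAway h) '' W ⊆ V := by
      rintro _ ⟨r, hrW, rfl⟩
      exact hWV hrW
    refine ⟨⟨comap (toAway h) '' W, (isOpenEmbedding_comap_toAway h).isOpenMap _ W.2⟩,
      ⟨q, hqW, rfl⟩, hle, a, f, ?_⟩
    rintro ⟨_, r, hrW, rfl⟩
    obtain ⟨hy, e⟩ := ht ⟨r, hrW⟩
    obtain ⟨hf, e'⟩ := haf r hy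
    exact ⟨hf, localMap_injective h r ((hs' r (hWV hrW)).trans (e.trans e'.symm))⟩

theorem Sections.mem_nullSet_of_pullback (V : Opens (PrimeMIdeal B))
    (hV : (V : Set _) ⊆ basicOpen h) (x : AmbientSemiring (Sections V))
    (hx : AmbientSemiring.map (Sections.pullback (toAway h) V).toMonoidWithZeroHom x ∈
      Band.nullSet) : x ∈ Band.nullSet := by
  refine (Sections.mem_nullSet_iff x).2 fun p ↦ ?_
  obtain ⟨p, hp⟩ := p
  have : p ∈ Set.range (comap (toAway h)) := by
    rw [range_comap_toAway]
    exact hV hp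
  obtain ⟨q, rfl⟩ := this
  refine mem_nullSet_of_localMap h q _ ?_
  have h1 := (Sections.mem_nullSet_iff _).1 hx ⟨q, hp⟩
  rw [AmbientSemiring.map_map] at h1 ⊢
  exact h1

/-- The spectrum of the localization away from an element is an open subspace. -/
theorem isOpenImm_specMap_toAway : SheafedSpace.IsOpenImmersion (specMap (toAway h)) where
  base_open := isOpenEmbedding_comap_toAway h
  c_iso (V : Opens (PrimeMIdeal (Away h))) := by
    let V' : Opens (PrimeMIdeal B) :=
      ⟨comap (toAway h) '' V.1, (isOpenEmbedding_comap_toAway h).isOpenMap _ V.2⟩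
    have hV : (V' : Set (PrimeMIdeal B)) ⊆ basicOpen h := by
      rw [← range_comap_toAway]
      exact Set.image_subset_range _ _
    let f : BandCat.of (Sections V') ⟶ BandCat.of (Sections (Sections.preimage (toAway h) V')) :=
      Sections.pullback (toAway h) V'
    have hf : IsIso f := BandCat.isIso_of_bijective f (Sections.pullback_bijective V' hV)
      (Sections.mem_nullSet_of_pullback h V' hV)
    exact hf

end PrimeMIdeal

end

/-! ### Affine open subsets as a presentation of a band scheme. -/

noncomputable section

open AlgebraicGeometry BandSpace

/-- Principal open subsets form a basis and not just a subbasis, because the principal open subset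
of `g * h` is contained in those of `g` and `h`. -/
theorem PrimeMIdeal.exists_basicOpen_subset {B : Type u} [Band B] (U : Opens (PrimeMIdeal B))
    (p : PrimeMIdeal B) (hp : p ∈ U) : ∃ h, p ∈ basicOpen h ∧ basicOpen h ⊆ U := by
  have key : ∀ s : Set (PrimeMIdeal B), TopologicalSpace.GenerateOpen (Set.range basicOpen) s →
      p ∈ s → ∃ h, p ∈ basicOpen h ∧ basicOpen h ⊆ s := by
    intro s hs
    induction hs with
    | basic s hs =>
      obtain ⟨b, rfl⟩ := hs
      exact fun hb ↦ ⟨b, hb, subset_rfl⟩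
    | univ => exact fun _ ↦ ⟨1, p.one_mem_compl, Set.subset_univ _⟩
    | inter s t _ _ hs ht =>
      rintro ⟨h1, h2⟩
      obtain ⟨g, hg, hgs⟩ := hs h1
      obtain ⟨h, hh, hht⟩ := ht h2
      refine ⟨g * h, p.mul_mem_compl hg hh, fun q hq ↦ ⟨hgs fun hg ↦ hq ?_, hht fun hh ↦ hq ?_⟩⟩
      · rw [mul_comm]
        exact q.mul_mem h hg
      · exact q.mul_mem g hh
    | sUnion S _ ih =>
      rintro ⟨s, hs, hm⟩
      obtain ⟨h, hh, hhs⟩ := ih s hs hm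
      exact ⟨h, hh, hhs.trans (Set.subset_sUnion_of_mem hs)⟩
  exact key U U.2 hp

namespace BandScheme

variable {X Y Z : BandScheme.{u}}

/-- The lift of a morphism of band schemes along an open immersion. -/
def liftAlong (f : X ⟶ Z) (hf : IsOpenImmersion f) (g : Y ⟶ Z)
    (h : Set.range (Hom.base g.hom) ⊆ Set.range (Hom.base f.hom)) : Y ⟶ X :=
  InducedCategory.homMk (@BandSpace.liftHom _ _ _ f.hom hf g.hom h)

theorem liftAlong_fac (f : X ⟶ Z) (hf : IsOpenImmersion f) (g : Y ⟶ Z)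
    (h : Set.range (Hom.base g.hom) ⊆ Set.range (Hom.base f.hom)) : liftAlong f hf g h ≫ f = g :=
  InducedCategory.hom_ext (@BandSpace.liftHom_fac _ _ _ f.hom hf g.hom h)

theorem isOpenImmersion_liftAlong (f : X ⟶ Z) (hf : IsOpenImmersion f) (g : Y ⟶ Z)
    (hg : IsOpenImmersion g) (h : Set.range (Hom.base g.hom) ⊆ Set.range (Hom.base f.hom)) :
    IsOpenImmersion (liftAlong f hf g h) :=
  @BandSpace.isOpenImm_liftHom _ _ _ f.hom hf g.hom hg h

theorem IsOpenImmersion.cancel {f : X ⟶ Z} (hf : IsOpenImmersion f) {l l' : Y ⟶ X}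
    (h : l ≫ f = l' ≫ f) : l = l' := by
  have hm : Mono (BandSpace.Hom.toHom f.hom) :=
    @SheafedSpace.IsOpenImmersion.instMono _ _ _ _ _ hf
  refine InducedCategory.hom_ext (BandSpace.Hom.ext (hm.right_cancellation _ _ ?_))
  exact congrArg (fun k : Y ⟶ Z ↦ BandSpace.Hom.toHom k.hom) h

/-- The affine open subschemes form a basis of the topology. -/
theorem exists_affine_subset (X : BandScheme.{u}) (W : Opens X.toBandSpace.pt)
    (x : X.toBandSpace.pt) (hx : x ∈ W) :
    ∃ (B : BandCat.{u}) (i : Spec.obj (op B) ⟶ X), IsOpenImmersion i ∧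
      x ∈ Set.range (Hom.base i.hom) ∧ Set.range (Hom.base i.hom) ⊆ W := by
  obtain ⟨B, i, hi, p, rfl⟩ := exists_affine X x
  obtain ⟨h, hp, hW⟩ := PrimeMIdeal.exists_basicOpen_subset (Hom.preimage i.hom W) p hx
  let t : B ⟶ BandCat.of (PrimeMIdeal.Away h) := PrimeMIdeal.toAway (B := B) h
  let st : Spec.obj (op (BandCat.of (PrimeMIdeal.Away h))) ⟶ Spec.obj (op B) :=
    BandScheme.Spec.map t.op
  have ht : Set.range (Hom.base st.hom) = PrimeMIdeal.basicOpen h :=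
    PrimeMIdeal.range_comap_toAway h
  refine ⟨BandCat.of (PrimeMIdeal.Away h), st ≫ i,
    @SheafedSpace.IsOpenImmersion.comp _ _ _ _ _ _ _ (PrimeMIdeal.isOpenImm_specMap_toAway h) hi,
    ?_, ?_⟩
  · rw [← ht] at hp
    obtain ⟨q, rfl⟩ := hp
    exact ⟨q, rfl⟩
  · rintro _ ⟨q, rfl⟩
    exact hW (ht ▸ Set.mem_range_self q)

variable (X) in
/-- The nonempty affine open subsets of a band scheme. -/
def AffineOpens : Type u :=
  {V : Opens X.toBandSpace.pt // (V : Set X.toBandSpace.pt).Nonempty ∧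
    ∃ (B : BandCat.{u}) (i : Spec.obj (op B) ⟶ X), IsOpenImmersion i ∧
      Set.range (Hom.base i.hom) = V}

namespace AffineOpens

instance : Preorder (AffineOpens X) := inferInstanceAs (Preorder {_V : Opens X.toBandSpace.pt // _})

/-- A band whose spectrum is the given affine open subset. -/
def band (V : AffineOpens X) : BandCat.{u} := V.2.2.choose

/-- The inclusion of an affine open subset. -/
def incl (V : AffineOpens X) : Spec.obj (op V.band) ⟶ X := V.2.2.choose_spec.choose

theorem isOpenImmersion_incl (V : AffineOpens X) : IsOpenImmersion V.incl :=
  V.2.2.choose_spec.choose_spec.1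

theorem range_incl (V : AffineOpens X) : Set.range (Hom.base V.incl.hom) = V.1 :=
  V.2.2.choose_spec.choose_spec.2

theorem nonempty_spec (V : AffineOpens X) : Nonempty (PrimeMIdeal V.band) := by
  obtain ⟨x, hx⟩ := V.2.1
  rw [← V.range_incl] at hx
  exact ⟨hx.choose⟩

theorem range_subset {V W : AffineOpens X} (h : V ≤ W) :
    Set.range (Hom.base V.incl.hom) ⊆ Set.range (Hom.base W.incl.hom) := by
  rw [range_incl, range_incl]
  exact h

theorem exists_subset (W : Opens X.toBandSpace.pt) (x : X.toBandSpace.pt) (hx : x ∈ W) :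
    ∃ V : AffineOpens X, x ∈ V.1 ∧ V.1 ≤ W := by
  obtain ⟨B, i, hi, hxi, hW⟩ := exists_affine_subset X W x hx
  exact ⟨⟨⟨_, (@isOpenEmbedding_base _ _ i.hom hi).isOpen_range⟩, ⟨x, hxi⟩, B, i, hi, rfl⟩, hxi, hW⟩

variable (X) in
/-- The diagram of affine open subschemes. -/
def diagram : AffineOpens X ⥤ BandScheme.{u} where
  obj V := Spec.obj (op V.band)
  map {V W} h := liftAlong W.incl W.isOpenImmersion_incl V.incl (range_subset h.le)
  map_id V := V.isOpenImmersion_incl.cancel (by rw [liftAlong_fac, Category.id_comp])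
  map_comp {U V W} f g := W.isOpenImmersion_incl.cancel (by
    rw [liftAlong_fac, Category.assoc, liftAlong_fac, liftAlong_fac])

theorem diagram_map_incl {V W : AffineOpens X} (h : V ⟶ W) :
    (diagram X).map h ≫ W.incl = V.incl := liftAlong_fac _ _ _ _

variable (X) in
/-- The inclusions of the affine open subschemes as a cocone. -/
def cocone : Cocone (diagram X) where
  pt := X
  ι :=
    { app := fun V ↦ V.incl
      naturality := fun _ _ h ↦ (diagram_map_incl h).trans (Category.comp_id _).symm }

variable (X) in
theorem isBasicCover : IsBasicCover fun V : AffineOpens X ↦ V.incl.hom := by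
  refine ⟨fun x ↦ ?_, fun V W x hV hW ↦ ?_⟩
  · obtain ⟨V, hV, -⟩ := exists_subset ⊤ x trivial
    exact ⟨V, V.range_incl.symm.subset hV⟩
  · obtain ⟨U, hU, hUVW⟩ := exists_subset (V.1 ⊓ W.1) x
      ⟨V.range_incl.subset hV, W.range_incl.subset hW⟩
    have h1 : U ≤ V := hUVW.trans inf_le_left
    have h2 : U ≤ W := hUVW.trans inf_le_right
    exact ⟨U, ((diagram X).map (homOfLE h1)).hom, ((diagram X).map (homOfLE h2)).hom,
      congrArg InducedCategory.Hom.hom (diagram_map_incl (homOfLE h1)),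
      congrArg InducedCategory.Hom.hom (diagram_map_incl (homOfLE h2)),
      U.range_incl.symm.subset hU⟩

/-- The inclusions are monomorphisms, so every morphism over `X` between two affine open subschemes
is the one in the diagram. Hence a cocone satisfies the compatibility that `exists_glueHom`
requires. -/
theorem exists_desc (s : Cocone (diagram X)) :
    ∃ f : X ⟶ s.pt, ∀ V : AffineOpens X, V.incl ≫ f = s.ι.app V := by
  have hi : ∀ V : AffineOpens X, IsOpenImm V.incl.hom := fun V ↦ V.isOpenImmersion_incl
  obtain ⟨f, hf⟩ := @exists_glueHom X.toBandSpace s.pt.toBandSpace _ _ _ hi (isBasicCover X)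
    (fun V ↦ (s.ι.app V).hom) fun V U a ha ↦ by
      have hUV : U ≤ V := by
        change (U.1 : Set X.toBandSpace.pt) ⊆ V.1
        rw [← U.range_incl, ← V.range_incl, ← ha]
        rintro _ ⟨y, rfl⟩
        exact ⟨Hom.base a y, rfl⟩
      let a' : (diagram X).obj U ⟶ (diagram X).obj V := InducedCategory.homMk a
      have ha' : a' = (diagram X).map (homOfLE hUV) := V.isOpenImmersion_incl.cancel
        ((InducedCategory.hom_ext ha : a' ≫ V.incl = U.incl).trans
          (diagram_map_incl (homOfLE hUV)).symm)
      have h1 : a' ≫ s.ι.app V = s.ι.app U := ha' ▸ s.w (homOfLE hUV)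
      exact congrArg InducedCategory.Hom.hom h1
  exact ⟨InducedCategory.homMk f, fun V ↦ InducedCategory.hom_ext (hf V)⟩

variable (X) in
/-- A band scheme is the colimit of its affine open subschemes. -/
def isColimit : IsColimit (cocone X) where
  desc s := (exists_desc s).choose
  fac s V := (exists_desc s).choose_spec V
  uniq s m hm := by
    have hi : ∀ V : AffineOpens X, IsOpenImm V.incl.hom := fun V ↦ V.isOpenImmersion_incl
    refine InducedCategory.hom_ext (@Hom.ext_of_openImm X.toBandSpace s.pt.toBandSpace _ _ _ hi
      (isBasicCover X).1 _ _ fun V ↦ ?_)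
    exact congrArg InducedCategory.Hom.hom ((hm V).trans ((exists_desc s).choose_spec V).symm)

end AffineOpens

variable (X) in
/-- The presentation of a band scheme by its affine open subschemes. -/
def affinePresentation : AffinePresentation X where
  J := AffineOpens X
  diagram := AffineOpens.diagram X
  isAffine V := ⟨V.band, ⟨Iso.refl _⟩⟩
  isOpenImmersion_map _ := isOpenImmersion_liftAlong _ _ _ (AffineOpens.isOpenImmersion_incl _) _
  ι := (AffineOpens.cocone X).ι
  isOpenImmersion_ι V := V.isOpenImmersion_incl
  isColimit := AffineOpens.isColimit X

/-! ### Uniqueness of the extension. -/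

section Uniqueness

variable {F F' : BandScheme.{u} ⥤ Scheme.{u}} (θ : Spec ⋙ F ≅ Spec ⋙ F')

/-- A priori `θ` is natural only for morphisms induced by band morphisms; when the source has a
point, `PrimeMIdeal.exists_eq_specMap` shows that there are no others. -/
theorem spec_naturality {B C : BandCat.{u}} (p : PrimeMIdeal C)
    (g : Spec.obj (op C) ⟶ Spec.obj (op B)) :
    F.map g ≫ θ.hom.app (op B) = θ.hom.app (op C) ≫ F'.map g := by
  obtain ⟨f, hf⟩ := PrimeMIdeal.exists_eq_specMap p g.hom
  obtain rfl : BandScheme.Spec.map f.op = g := InducedCategory.hom_ext hf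
  exact θ.hom.naturality f.op

/-- The components of `θ` form an isomorphism between the images of the diagram of affine open
subschemes, and both values at `X` are colimits of these images. That affine opens are nonempty
provides the point needed in `spec_naturality`. -/
theorem exists_iso (hF : IsCompatibleWithPresentations F) (hF' : IsCompatibleWithPresentations F')
    (X : BandScheme.{u}) : ∃ e : F.obj X ≅ F'.obj X, ∀ V : AffineOpens X,
      F.map V.incl ≫ e.hom = θ.hom.app (op V.band) ≫ F'.map V.incl := by
  obtain ⟨h⟩ := hF X (affinePresentation X)
  obtain ⟨h'⟩ := hF' X (affinePresentation X)
  let α : (affinePresentation X).diagram ⋙ F ≅ (affinePresentation X).diagram ⋙ F' :=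
    NatIso.ofComponents (fun V : AffineOpens X ↦ θ.app (op V.band))
      fun {V W} f ↦ spec_naturality θ (AffineOpens.nonempty_spec V).some _
  exact ⟨IsColimit.coconePointsIsoOfNatIso h h' α,
    fun V ↦ IsColimit.comp_coconePointsIsoOfNatIso_hom h h' α V⟩

theorem hom_ext_of_affineOpens (hF : IsCompatibleWithPresentations F) {S : Scheme.{u}}
    {f g : F.obj X ⟶ S} (h : ∀ V : AffineOpens X, F.map V.incl ≫ f = F.map V.incl ≫ g) : f = g := by
  obtain ⟨hc⟩ := hF X (affinePresentation X)
  exact hc.hom_ext h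

/-- The image of the spectrum of the zero band has no nontrivial morphisms. -/
theorem hom_eq_of_isUnit_zero (φ : Spec ⋙ F ≅ universalRing.op ⋙ Scheme.Spec) {B : BandCat.{u}}
    (h : IsUnit (0 : B)) {S : Scheme.{u}} (f g : F.obj (Spec.obj (op B)) ⟶ S) : f = g := by
  have h1 : (0 : B) = 1 := isUnit_zero_iff.1 h
  have h2 : (0 : UniversalRing B) = 1 := by
    rw [← map_zero (UniversalRing.ofHom B), h1, map_one]
  have h3 : Subsingleton (UniversalRing B) := subsingleton_of_zero_eq_one h2
  have h4 : IsEmpty (AlgebraicGeometry.Spec (CommRingCat.of (UniversalRing B))) :=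
    inferInstanceAs (IsEmpty (PrimeSpectrum (UniversalRing B)))
  refine (cancel_epi (φ.app (op B)).inv).1 (IsInitial.hom_ext ?_ _ _)
  exact @isInitialOfIsEmpty (AlgebraicGeometry.Spec (CommRingCat.of (UniversalRing B))) h4

/-- An affine open subset containing the image of the closed point contains the whole image of `a`.
So `a` factors through it, and the identity follows from `he` and `spec_naturality`. Over the zero
band there is no closed point, but then `F` gives an initial scheme. -/
theorem map_comp_iso (φ : Spec ⋙ F ≅ universalRing.op ⋙ Scheme.Spec) (e : F.obj X ≅ F'.obj X)
    (he : ∀ V : AffineOpens X, F.map V.incl ≫ e.hom = θ.hom.app (op V.band) ≫ F'.map V.incl)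
    (B : BandCat.{u}) (a : Spec.obj (op B) ⟶ X) :
    F.map a ≫ e.hom = θ.hom.app (op B) ≫ F'.map a := by
  by_cases h0 : IsUnit (0 : B)
  · exact hom_eq_of_isUnit_zero φ h0 _ _
  · let m : PrimeMIdeal B := PrimeMIdeal.closedPoint h0
    obtain ⟨V, hV, -⟩ := AffineOpens.exists_subset ⊤ (Hom.base a.hom m) trivial
    have hr : Set.range (Hom.base a.hom) ⊆ Set.range (Hom.base V.incl.hom) := by
      rw [V.range_incl]
      rintro _ ⟨p, rfl⟩
      exact PrimeMIdeal.mem_of_closedPoint_mem h0 (Hom.preimage a.hom V.1) hV p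
    have hl := liftAlong_fac V.incl V.isOpenImmersion_incl a hr
    rw [← hl, Functor.map_comp, Category.assoc, he, ← Category.assoc, spec_naturality θ m,
      Category.assoc, Functor.map_comp]

/-- Naturality at `g : X ⟶ Y` is tested on affine open subsets `V` of `X`, where it is
`map_comp_iso` for the composite of `V.incl` with `g`, a morphism that need not be an open
immersion. The values on affine opens also force uniqueness. -/
theorem existsUnique_iso (φ : Spec ⋙ F ≅ universalRing.op ⋙ Scheme.Spec)
    (hF : IsCompatibleWithPresentations F) (hF' : IsCompatibleWithPresentations F') :
    ∃! η : F ≅ F', Functor.isoWhiskerLeft Spec η = θ := by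
  choose e he using exists_iso θ hF hF'
  have key := fun X ↦ map_comp_iso θ φ (e X) (he X)
  refine ⟨NatIso.ofComponents e fun {X Y} g ↦ hom_ext_of_affineOpens hF fun V ↦ ?_, ?_,
    fun η hη ↦ ?_⟩
  · rw [← Category.assoc, ← Functor.map_comp, key, ← Category.assoc, he, Category.assoc,
      Functor.map_comp]
  · ext B : 3
    -- On a spectrum the constructed isomorphism is `θ`, by `key` for the identity morphism.
    have := key _ B.unop (𝟙 (Spec.obj B))
    rw [CategoryTheory.Functor.map_id, CategoryTheory.Functor.map_id, Category.id_comp] at this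
    exact this.trans (Category.comp_id _)
  · ext X : 3
    refine hom_ext_of_affineOpens hF fun V ↦ ?_
    have h1 : η.hom.app (Spec.obj (op V.band)) = θ.hom.app (op V.band) :=
      congrArg (fun k : Spec ⋙ F ≅ Spec ⋙ F' ↦ k.hom.app (op V.band)) hη
    exact (η.hom.naturality V.incl).trans ((congrArg (· ≫ F'.map V.incl) h1).trans (he X V).symm)

end Uniqueness

end BandScheme

end

theorem mainTheorem10 :
    PreservesColimitsOfShape WalkingSpan universalRing.{u} ∧
    (∀ (B : Type u) [Band B] (h : B),
      letI := (UniversalRing.map (Band.localizationMap (Submonoid.powers h))).toAlgebra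
      IsLocalization.Away (UniversalRing.of B h)
        (UniversalRing (Localization (Submonoid.powers h)))) ∧
    (∃ (F : BandScheme.{u} ⥤ AlgebraicGeometry.Scheme.{u})
      (_ : BandScheme.Spec ⋙ F ≅ universalRing.op ⋙ AlgebraicGeometry.Scheme.Spec),
      BandScheme.IsCompatibleWithPresentations F) ∧
    (∀ (F F' : BandScheme.{u} ⥤ AlgebraicGeometry.Scheme.{u})
      (φ : BandScheme.Spec ⋙ F ≅ universalRing.op ⋙ AlgebraicGeometry.Scheme.Spec)
      (φ' : BandScheme.Spec ⋙ F' ≅ universalRing.op ⋙ AlgebraicGeometry.Scheme.Spec),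
      BandScheme.IsCompatibleWithPresentations F →
      BandScheme.IsCompatibleWithPresentations F' →
      ∃! η : F ≅ F', Functor.isoWhiskerLeft BandScheme.Spec η ≪≫ φ' = φ) := by
  refine ⟨inferInstance, fun B _ h ↦ UniversalRing.isLocalization_away h,
    ⟨BandScheme.toScheme, BandScheme.specToSchemeIso,
      BandScheme.isCompatibleWithPresentations_toScheme⟩, ?_⟩
  intro F F' φ φ' hF hF'
  -- Compatibility of `η` with `φ` and `φ'` means that its restriction to spectra is `φ` followed by
  -- the inverse of `φ'`.
  obtain ⟨η, h, hu⟩ := BandScheme.existsUnique_iso (φ ≪≫ φ'.symm) φ hF hF'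
  refine ⟨η, ?_, fun η' h' ↦ hu η' ?_⟩
  · change Functor.isoWhiskerLeft BandScheme.Spec η ≪≫ φ' = φ
    rw [h, Iso.trans_assoc, Iso.symm_self_id, Iso.trans_refl]
  · change Functor.isoWhiskerLeft BandScheme.Spec η' = φ ≪≫ φ'.symm
    rw [← h', Iso.trans_assoc, Iso.self_symm_id, Iso.trans_refl]
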